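/- **Setting.** Let $\widehat\Omega\subset\mathbb R^2$ be an open rectangle with a structured Cartesian background mesh of congruent rectangular cells $\widehat E$, and let $\Omega\subset\widehat\Omega$ be open. The elements of the cut-cell mesh $\mathcal M_h$ are the nonempty sets $E=\widehat E\cap\Omega$. We assume that $\Omega$ and every $E\in\mathcal M_h$ have piecewise $C^1$ boundaries of finite length: outside a set of length zero the boundary is locally a $C^1$ curve with the set on one side of it; $n_E$ denotes the outward unit normal. The internal faces are the sets $\gamma=\bar E_1\cap\bar E_2$ ($E_1\ne E_2$), the boundary faces the sets $\gamma=\bar E\cap\partial\Omega$, each of positive length. For an internal face one of its elements is fixed as the left one $E^L_\gamma$, the other one being $E^R_\gamma$, and $n=n_{E^L_\gamma}$ on $\gamma$; on a boundary face of $E$, $n=n_E$. We write $w^L,w^R$ for the traces and $[\![w]\!]=w^L-w^R$. The faces $\gamma_i$ of $E$ are numbered by $i\in\mathbb I(E)=\{1,\dots,K\}$; $E_i$ is the element across $\gamma_i$, if $\gamma_i$ is internal. For $c>0$ let $f_k(u)=A_ku$ be the acoustic fluxes of states $u=(p,v_1,v_2)$, $A_1=c(e_1e_2^T+e_2e_1^T)$,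 $A_2=c(e_1e_3^T+e_3e_1^T)$, $f_n=n_1f_1+n_2f_2$, and let $\mathfrak M_n(p,v)=(p,v-2(v\cdot n)n)$. Let $S_n(u,v)=S^M_n(u-v)$ with positive semi-definite matrices $S^M_n$ ($|n|=1$) for which $(0,n)$ is an eigenvector (as for the Lax–Friedrichs dissipation $S_n^M=\tfrac c2 I$). Let $\mathcal V^r_h$ be the space of functions on $\Omega$ with values in $\mathbb R^3$ whose components are polynomials of degree at most $r$ on each element, and $$a_h(u,w)=-\sum_E\int_E f(u)\cdot\nabla w+\sum_{\gamma\text{ int.}}\int_\gamma\langle\tfrac12[f_n(u^L)+f_n(u^R)],[\![w]\!]\rangle+\sum_{\gamma\text{ bdry}}\int_\gamma\langle\tfrac12[f_n(u)+f_n(\mathfrak M_nu)],w\rangle,$$ $$s_h(u,w)=\sum_{\gamma\text{ int.}}\int_\gamma\langle S_n(u^L,u^R),[\![w]\!]\rangle+\sum_{\gamma\text{ bdry}}\int_\gamma\langle S_n(u,\mathfrak M_nu),w\rangle .$$ **Small cells.** Fix $\alpha\in(0,1)$ and let $\mathcal I=\{E:|E|/|\widehat E|<\alpha\}$. We assume that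 no $E\in\mathcal I$ has a neighbour in $\mathcal I$, and that the boundary face of each $E\in\mathcal I$ (if any) lies on a line and has constant outward normal $n$. For polynomials $u=(p,v)$ on such an $E$ let $\mathfrak M(u)(x)=(p(x),v(x)-2(v(x^\perp)\cdot n)n)$, $x^\perp$ being the orthogonal projection onto that line. For $\Delta t>0$ let $\eta_E=1-\frac{1}{2r+1}\frac{|E|}{\Delta t\,c\,\max_i|\gamma_i|}$. **Propagation forms.** For $E\in\mathcal I$ let $b_{\gamma_j}(u,v,w)=\int_{\gamma_j}\langle\tfrac12[f_n(u)+f_n(v)],w\rangle$ with $n=n_E$. Let $p_{ij}=p^E_{ij}$ ($i\ne j$ in $\mathbb I(E)$), $p_V=p^E_V$ and $p_V^*=p_V^{E,*}$ be real-valued functions on $(P^r(E)^3)^3$, symmetric in the first two arguments and linear in the third, with $p_{ij}+p_{ji}=p_V+p_V^*$ for $i\neq j$ and $\sum_{i\ne j}p_{ij}=b_{\gamma_j}$ for all $j$. Suppose they are *energy preserving*: for all $i\ne j$ and all polynomials, $$\tfrac{2}{K(K-1)}\int_Ef(w)\cdot\nabla w=\tfrac12p_{ij}(w,w,w)+\tfrac12p_{ji}(w,w,w),\qquad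 p_{ij}(u,v,u-v)=\tfrac12p_{ij}(u,u,u)-\tfrac12p_{ij}(v,v,v),$$ and *reflecting*: $p_{ji}(u,\mathfrak Mv,w)=-p_{ji}(\mathfrak Mu,v,\mathfrak Mw)$, if $\gamma_i$ is the boundary face and $j\ne i$. **Stabilization.** For $u\in\mathcal V_h^r$ let $u_E$ be the polynomial given by $u$ on $E$, extended to the plane. For $E\in\mathcal I$ and a pair $i\neq j$ in $\mathbb I(E)$ let $u_i=u_{E_i}$ if $\gamma_i$ is internal, and $u_i=\mathfrak M(u_{E_j})$ if $\gamma_i$ is the boundary face; similarly $u_j$, $w_i$, $w_j$. Let $w_i^\circ=w_{E_i}$ if $\gamma_i$ is internal and $w_i^\circ=0$ otherwise. With $$J^{0}_{ij}=p_{ij}(u_i,u_j,w_E-w_j^\circ)+p_{ji}(u_i,u_j,w_E-w_i^\circ),$$ $$J^{1}_{ij}=\sum_{\ell\in\{E,i,j\}}\omega_\ell\Big[p_V(u_i,u_j,w_\ell)-\tfrac{2}{K(K-1)}\int_Ef(u_\ell)\cdot\nabla w_\ell+p_V^*(w_i,w_j,u_\ell)\Big],\quad\omega_E=-1,\ \omega_i=\omega_j=\tfrac12,$$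 $$J^{s}_{ij}=\tfrac16\sum_{\gamma\subset\partial E}\int_\gamma\langle S_n(u_i,u_j),w_i-w_j\rangle+\tfrac16\sum_{\gamma\subset\partial E}\int_\gamma\langle S_n(u_j,u_i),w_j-w_i\rangle$$ (sums over the faces of $E$) put $$J^a_h(u,w)=\sum_{E\in\mathcal I}\eta_E\Big[\sum_{i<j}(J^0_{ij}+J^1_{ij})-a_E(u,w)\Big],\qquad J^s_h(u,w)=\sum_{E\in\mathcal I}\eta_E\Big[\sum_{i<j}J^s_{ij}-s_E(u,w)\Big],$$ where $a_E$ and $s_E$ are the sums of the face integrals of $a_h$ and $s_h$, respectively, over the faces of $E$. **Theorem.** Let $T>0$, and let $u_h:[0,T]\to\mathcal V^r_h$ be a solution of the DoD-stabilized semi-discrete scheme $$\int_\Omega\langle \partial_tu_h(t),w_h\rangle+a_h(u_h(t),w_h)+J^a_h(u_h(t),w_h)+s_h(u_h(t),w_h)+J^s_h(u_h(t),w_h)=0\qquad\forall\,w_h\in\mathcal V^r_h .$$ 1. If $\Delta t$ is such that $\eta_E\in[0,1]$ for all $E\in\mathcal I$, then $\tfrac12\|u_h(T)\|^2_{L^2(\Omega)}\le\tfrac12\|u_h(0)\|^2_{L^2(\Omega)}$.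 2. If $S_n=0$ for all $n$, then $\tfrac12\|u_h(T)\|^2_{L^2(\Omega)}=\tfrac12\|u_h(0)\|^2_{L^2(\Omega)}$ (without a condition on $\eta_E$). -/

import Mathlib

noncomputable section

/-- Points of the plane. -/
abbrev Pt := EuclideanSpace ℝ (Fin 2)

/-! ### Boundary regularity and outward normals -/

/-- `n` is the outward unit normal of `A` at the boundary point `x`: near `x`, the set `A` is the
strict sublevel set `{φ < 0}` of a `C¹` function with `φ x = 0` and `∇φ x ≠ 0`, and
`n = ∇φ x / ‖∇φ x‖`. In particular `A` lies locally on one side of its `C¹` boundary. -/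
def IsOuterNormal (A : Set Pt) (x n : Pt) : Prop :=
  ∃ φ : Pt → ℝ, ContDiffAt ℝ 1 φ x ∧ φ x = 0 ∧ gradient φ x ≠ 0 ∧
    (∀ᶠ y in nhds x, y ∈ A ↔ φ y < 0) ∧ n = ‖gradient φ x‖⁻¹ • gradient φ x

open scoped Classical in
/-- The outward unit normal field of `A` (zero at points where there is none, e.g. corners). -/
def outerNormal (A : Set Pt) (x : Pt) : Pt :=
  if h : ∃ n, IsOuterNormal A x n then h.choose else 0

/-- `A` has a piecewise `C¹` boundary of finite length: `∂A` has finite length, and outside a set of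
length zero (corners, cusps) `∂A` is locally a `C¹` curve with `A` on one side of it. -/
def HasPiecewiseC1Boundary (A : Set Pt) : Prop :=
  MeasureTheory.Measure.hausdorffMeasure 1 (frontier A) < ⊤ ∧
    ∀ᵐ x ∂((MeasureTheory.Measure.hausdorffMeasure 1 : MeasureTheory.Measure Pt).restrict
      (frontier A)), ∃ n, IsOuterNormal A x n

/-- Integral over a face with respect to arc length (one-dimensional Hausdorff measure). -/
def lineIntegral (γ : Set Pt) (g : Pt → ℝ) : ℝ :=
  ∫ x in γ, g x ∂(MeasureTheory.Measure.hausdorffMeasure 1 : MeasureTheory.Measure Pt)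

/-- The length `|γ|` of a face. -/
def faceLength (γ : Set Pt) : ℝ :=
  ((MeasureTheory.Measure.hausdorffMeasure 1 : MeasureTheory.Measure Pt) γ).toReal

/-! ### The acoustic flux and the reflection of states -/

/-- The flux matrices `A₁`, `A₂` of the acoustic wave equation, for states `(p, v₁, v₂)`. -/
def fluxMatrix (c : ℝ) : Fin 2 → Matrix (Fin 3) (Fin 3) ℝ :=
  ![!![0, c, 0; c, 0, 0; 0, 0, 0], !![0, 0, c; 0, 0, 0; c, 0, 0]]

/-- `A_n = n₁ A₁ + n₂ A₂`. -/
def normalFlux (c : ℝ) (n : Pt) : Matrix (Fin 3) (Fin 3) ℝ :=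
  n 0 • fluxMatrix c 0 + n 1 • fluxMatrix c 1

/-- The state `(0, n)` with zero pressure and velocity `n`. -/
def normalState (n : Pt) : Fin 3 → ℝ := ![0, n 0, n 1]

/-- The mirrored state `(p, v) ↦ (p, v - 2 (v · n) n)`. -/
def mirrorState (n : Pt) (u : Fin 3 → ℝ) : Fin 3 → ℝ :=
  ![u 0, u 1 - 2 * (u 1 * n 0 + u 2 * n 1) * n 0, u 2 - 2 * (u 1 * n 0 + u 2 * n 1) * n 1]

/-! ### Vector-valued polynomials -/

/-- `P^r(E)³`: triples of real polynomials in two variables of total degree at most `r`. A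
polynomial function on a nonempty open set is identified with its polynomial; thus the polynomial
extension to the whole plane is implicit. -/
abbrev Poly3 (r : ℕ) := Fin 3 → MvPolynomial.restrictTotalDegree (Fin 2) ℝ r

namespace Poly3

variable {r : ℕ}

/-- Point value of a vector-valued polynomial. -/
def val (u : Poly3 r) (x : Pt) : Fin 3 → ℝ :=
  fun i => MvPolynomial.eval (fun k => x k) (u i : MvPolynomial (Fin 2) ℝ)

/-- Point value of the partial derivative `∂_k`. -/
def dval (k : Fin 2) (u : Poly3 r) (x : Pt) : Fin 3 → ℝ :=
  fun i => MvPolynomial.eval (fun l => x l)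
    (MvPolynomial.pderiv k (u i : MvPolynomial (Fin 2) ℝ))

end Poly3

/-- The coordinates of the orthogonal projection `x ↦ x - ((x - q) · n) n` onto the line through
`q` with unit normal `n`, as polynomials. -/
def projPoly (n q : Pt) (k : Fin 2) : MvPolynomial (Fin 2) ℝ :=
  MvPolynomial.X k -
    (∑ l : Fin 2, MvPolynomial.C (n l) * (MvPolynomial.X l - MvPolynomial.C (q l))) *
      MvPolynomial.C (n k)

theorem projPoly_totalDegree (n q : Pt) (k : Fin 2) : (projPoly n q k).totalDegree ≤ 1 := by
  unfold projPoly
  have hX : ∀ l : Fin 2, (MvPolynomial.X l : MvPolynomial (Fin 2) ℝ).totalDegree ≤ 1 :=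
    fun l => (MvPolynomial.totalDegree_X l).le
  refine (MvPolynomial.totalDegree_sub _ _).trans (max_le (hX k) ?_)
  refine (MvPolynomial.totalDegree_mul _ _).trans ?_
  rw [MvPolynomial.totalDegree_C, add_zero]
  refine MvPolynomial.totalDegree_finsetSum_le fun l _ => ?_
  refine (MvPolynomial.totalDegree_mul _ _).trans ?_
  rw [MvPolynomial.totalDegree_C, zero_add]
  refine (MvPolynomial.totalDegree_sub _ _).trans (max_le (hX l) ?_)
  simp

theorem totalDegree_bind_projPoly (n q : Pt) (p : MvPolynomial (Fin 2) ℝ) :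
    (MvPolynomial.bind₁ (projPoly n q) p).totalDegree ≤ p.totalDegree := by
  rw [MvPolynomial.bind₁, MvPolynomial.aeval_def, MvPolynomial.eval₂_eq]
  refine MvPolynomial.totalDegree_finsetSum_le fun d hd => ?_
  refine (MvPolynomial.totalDegree_mul _ _).trans ?_
  rw [MvPolynomial.algebraMap_eq, MvPolynomial.totalDegree_C, zero_add]
  refine (MvPolynomial.totalDegree_finsetProd _ _).trans ?_
  refine le_trans ?_ (MvPolynomial.le_totalDegree hd)
  refine Finset.sum_le_sum fun i _ => ?_
  refine (MvPolynomial.totalDegree_pow _ _).trans ?_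
  exact (Nat.mul_le_mul_left _ (projPoly_totalDegree n q i)).trans (Nat.mul_one _).le

/-- `x ↦ g(x^⊥)`, where `x^⊥` is the orthogonal projection of `x` onto the line through `q` with
unit normal `n`. -/
def compProj {r : ℕ} (n q : Pt) (g : MvPolynomial.restrictTotalDegree (Fin 2) ℝ r) :
    MvPolynomial.restrictTotalDegree (Fin 2) ℝ r :=
  ⟨MvPolynomial.bind₁ (projPoly n q) g,
    (MvPolynomial.mem_restrictTotalDegree _ _ _).2 ((totalDegree_bind_projPoly n q g).trans
      ((MvPolynomial.mem_restrictTotalDegree _ _ _).1 g.2))⟩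

/-- The generalized mirroring operator `(p, v)(x) ↦ (p(x), v(x) - 2 (v(x^⊥) · n) n)` at the straight
wall through `q` with unit normal `n`. -/
def mirrorPoly {r : ℕ} (n q : Pt) (u : Poly3 r) : Poly3 r :=
  ![u 0,
    u 1 - (2 * n 0) • (n 0 • compProj n q (u 1) + n 1 • compProj n q (u 2)),
    u 2 - (2 * n 1) • (n 0 • compProj n q (u 1) + n 1 • compProj n q (u 2))]

/-! ### Cut-cell meshes -/

/-- A domain `Ω` inside the rectangle `∏ (aᵢ, aᵢ + Nᵢ hᵢ)`, which carries the structured Cartesian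
background mesh of `N₁ × N₂` cells with side lengths `h₁, h₂`. -/
structure CutCellMesh where
  origin : Fin 2 → ℝ
  width : Fin 2 → ℝ
  width_pos : ∀ i, 0 < width i
  count : Fin 2 → ℕ
  domain : Set Pt
  isOpen_domain : IsOpen domain
  domain_subset :
    domain ⊆ {x | ∀ i, origin i < x i ∧ x i < origin i + (count i : ℝ) * width i}

namespace CutCellMesh

variable (M : CutCellMesh)

/-- The open background cell with index `k`. -/
def bgCell (k : ∀ i, Fin (M.count i)) : Set Pt :=
  {x | ∀ i, M.origin i + ((k i : ℕ) : ℝ) * M.width i < x i ∧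
    x i < M.origin i + (((k i : ℕ) : ℝ) + 1) * M.width i}

/-- The elements of the cut-cell mesh: the nonempty intersections of background cells with `Ω`. -/
abbrev Cell := {k : ∀ i, Fin (M.count i) // (M.bgCell k ∩ M.domain).Nonempty}

instance : Fintype M.Cell := Fintype.ofFinite _

variable {M}

/-- The element as a subset of the plane. -/
def Cell.set (E : M.Cell) : Set Pt := M.bgCell E.1 ∩ M.domain

variable (M)

/-- The domain and all its cut cells have piecewise `C¹` boundaries. -/
def IsRegular : Prop :=
  HasPiecewiseC1Boundary M.domain ∧ ∀ E : M.Cell, HasPiecewiseC1Boundary (Cell.set E)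

variable {M}

/-- The common face of two elements. -/
def intFace (E F : M.Cell) : Set Pt := closure (Cell.set E) ∩ closure (Cell.set F)

/-- The boundary face of an element. -/
def bdryFace (E : M.Cell) : Set Pt := closure (Cell.set E) ∩ frontier M.domain

/-- `E` and `F` are distinct elements sharing an internal face of positive length. -/
def Adjacent (E F : M.Cell) : Prop :=
  E ≠ F ∧ 0 < (MeasureTheory.Measure.hausdorffMeasure 1 : MeasureTheory.Measure Pt) (intFace E F)

/-- `E` has a boundary face of positive length. -/
def HasBdryFace (E : M.Cell) : Prop :=
  0 < (MeasureTheory.Measure.hausdorffMeasure 1 : MeasureTheory.Measure Pt) (bdryFace E)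

/-- Labels of the faces of `E`: `some F` for the internal face shared with `F`, and `none` for the
boundary face. -/
def IsFace (E : M.Cell) : Option M.Cell → Prop
  | none => HasBdryFace E
  | some F => Adjacent E F

/-- The faces `Γ_h(E)`, equivalently the neighbours `E_i` including the ghost cell. -/
abbrev Face (E : M.Cell) := {o : Option M.Cell // IsFace E o}

instance (E : M.Cell) : Fintype (Face E) := Fintype.ofFinite _

/-- The number `K` of faces of `E`. -/
def numFaces (E : M.Cell) : ℕ := Fintype.card (Face E)

/-- The face as a subset of the plane. -/
def faceSet (E : M.Cell) (i : Face E) : Set Pt :=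
  match i.1 with
  | none => bdryFace E
  | some F => intFace E F

variable (M)

/-- The labelling choices of the mesh: for each internal face one of its two elements is the left
one, and the faces of each element are numbered consecutively. -/
structure Labelling where
  left : M.Cell → M.Cell → Prop
  left_xor : ∀ E F : M.Cell, Adjacent E F → Xor (left E F) (left F E)
  num : ∀ E : M.Cell, Face E ≃ Fin (numFaces E)

/-- `E` is a small cell: its volume fraction is below the threshold `α`. -/
def IsSmall (α : ℝ) (E : M.Cell) : Prop :=
  (MeasureTheory.volume (Cell.set E)).toReal / (MeasureTheory.volume (M.bgCell E.1)).toReal < α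

/-- The set of stabilized cut cells. -/
abbrev SmallCell (α : ℝ) := {E : M.Cell // M.IsSmall α E}

instance (α : ℝ) : Fintype (M.SmallCell α) := Fintype.ofFinite _

/-- The discrete space `V_h^r` of functions that are polynomials of degree `r` on each element. The
extension of `u` from the element `E` to the plane is the polynomial `u E`. -/
abbrev DGSpace (r : ℕ) := M.Cell → Poly3 r

variable {M} {r : ℕ}

/-- The function on `Ω` given by an element of the discrete space. -/
def DGSpace.toFun (u : M.DGSpace r) (x : Pt) : EuclideanSpace ℝ (Fin 3) :=
  WithLp.toLp 2 (∑ E : M.Cell, (Cell.set E).indicator (Poly3.val (u E)) x)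

/-- The norm of `L²(Ω)³`. -/
def l2Norm (u : M.DGSpace r) : ℝ :=
  (MeasureTheory.eLpNorm (DGSpace.toFun u) 2 (MeasureTheory.volume.restrict M.domain)).toReal

/-- The inner product of `L²(Ω)³`. -/
def l2Inner (u w : M.DGSpace r) : ℝ :=
  ∫ x in M.domain, inner ℝ (DGSpace.toFun u x) (DGSpace.toFun w x)

/-! ### The base scheme -/

/-- `∫_E f(u) · ∇w = ∫_E ∑ₖ ⟨A_k u, ∂_k w⟩`. -/
def volForm (c : ℝ) (E : M.Cell) (u w : Poly3 r) : ℝ :=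
  ∫ x in Cell.set E, ∑ k : Fin 2, (fluxMatrix c k).mulVec (u.val x) ⬝ᵥ (w.dval k x)

/-- The surface form `b_γ(u, v, w) = ∫_γ ⟨½ [f_n(u) + f_n(v)], w⟩` at the face `i` of `E`, where `n`
is the unit normal pointing out of `E`. -/
def surfaceForm (c : ℝ) (E : M.Cell) (i : Face E) (u v w : Poly3 r) : ℝ :=
  lineIntegral (faceSet E i) fun x =>
    ((1 / 2 : ℝ) • ((normalFlux c (outerNormal (Cell.set E) x)).mulVec (u.val x) +
      (normalFlux c (outerNormal (Cell.set E) x)).mulVec (v.val x))) ⬝ᵥ w.val x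

/-- Central flux term at the internal face with left element `L` and right element `R`. -/
def centralInt (c : ℝ) (L R : M.Cell) (u w : M.DGSpace r) : ℝ :=
  lineIntegral (intFace L R) fun x =>
    ((1 / 2 : ℝ) • ((normalFlux c (outerNormal (Cell.set L) x)).mulVec ((u L).val x) +
      (normalFlux c (outerNormal (Cell.set L) x)).mulVec ((u R).val x))) ⬝ᵥ
        ((w L).val x - (w R).val x)

/-- Central flux term at the boundary face of `E`. -/
def centralBdry (c : ℝ) (E : M.Cell) (u w : M.DGSpace r) : ℝ :=
  lineIntegral (bdryFace E) fun x =>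
    ((1 / 2 : ℝ) • ((normalFlux c (outerNormal (Cell.set E) x)).mulVec ((u E).val x) +
      (normalFlux c (outerNormal (Cell.set E) x)).mulVec
        (mirrorState (outerNormal (Cell.set E) x) ((u E).val x)))) ⬝ᵥ (w E).val x

/-- Dissipation at the internal face with left element `L` and right element `R`; the operator is
`S_n(u, v) = S_n (u - v)` with the matrix `S n`. -/
def dissipInt (S : Pt → Matrix (Fin 3) (Fin 3) ℝ) (L R : M.Cell) (u w : M.DGSpace r) : ℝ :=
  lineIntegral (intFace L R) fun x =>
    (S (outerNormal (Cell.set L) x)).mulVec ((u L).val x - (u R).val x) ⬝ᵥ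
      ((w L).val x - (w R).val x)

/-- Dissipation at the boundary face of `E`. -/
def dissipBdry (S : Pt → Matrix (Fin 3) (Fin 3) ℝ) (E : M.Cell) (u w : M.DGSpace r) : ℝ :=
  lineIntegral (bdryFace E) fun x =>
    (S (outerNormal (Cell.set E) x)).mulVec
      ((u E).val x - mirrorState (outerNormal (Cell.set E) x) ((u E).val x)) ⬝ᵥ (w E).val x

open scoped Classical in
/-- The internal faces, each listed once as the pair (left element, right element). -/
def intFaces (lab : M.Labelling) : Finset (M.Cell × M.Cell) :=
  Finset.univ.filter fun P => Adjacent P.1 P.2 ∧ lab.left P.1 P.2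

open scoped Classical in
/-- The elements with a boundary face. -/
def bdryCells (M : CutCellMesh) : Finset M.Cell :=
  Finset.univ.filter fun E => HasBdryFace E

/-- The central base form `a_h`. -/
def aForm (lab : M.Labelling) (c : ℝ) (u w : M.DGSpace r) : ℝ :=
  -(∑ E : M.Cell, volForm c E (u E) (w E)) + (∑ P ∈ intFaces lab, centralInt c P.1 P.2 u w) +
    ∑ E ∈ bdryCells M, centralBdry c E u w

/-- The dissipative base form `s_h`. -/
def sForm (lab : M.Labelling) (S : Pt → Matrix (Fin 3) (Fin 3) ℝ) (u w : M.DGSpace r) : ℝ :=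
  (∑ P ∈ intFaces lab, dissipInt S P.1 P.2 u w) + ∑ E ∈ bdryCells M, dissipBdry S E u w

/-! ### Propagation forms -/

open scoped Classical in
/-- A set of propagation forms on the cell `E`: surface forms `p_ij` (`i ≠ j`; the values for `i = j`
play no role) and volume forms `p_V`, `p_V^*`. They are symmetric in the first two arguments, linear
in the third one, balanced and consistent. -/
structure PropagationForms (r : ℕ) (c : ℝ) (E : M.Cell) where
  surf : Face E → Face E → Poly3 r → Poly3 r → (Poly3 r →ₗ[ℝ] ℝ)
  vol : Poly3 r → Poly3 r → (Poly3 r →ₗ[ℝ] ℝ)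
  volStar : Poly3 r → Poly3 r → (Poly3 r →ₗ[ℝ] ℝ)
  surf_symm : ∀ i j, i ≠ j → ∀ u v, surf i j u v = surf i j v u
  vol_symm : ∀ u v, vol u v = vol v u
  volStar_symm : ∀ u v, volStar u v = volStar v u
  balance : ∀ i j, i ≠ j → ∀ u v w,
    surf i j u v w + surf j i u v w = vol u v w + volStar u v w
  consistency : ∀ j u v w,
    ∑ i ∈ Finset.univ.erase j, surf i j u v w = surfaceForm c E j u v w

/-- The factor `2 / (K (K - 1))`. -/
def pairWeight (E : M.Cell) : ℝ := 2 / ((numFaces E : ℝ) * ((numFaces E : ℝ) - 1))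

/-- Energy-preserving propagation forms. -/
def PropagationForms.EnergyPreserving {c : ℝ} {E : M.Cell} (p : PropagationForms r c E) : Prop :=
  (∀ i j, i ≠ j → ∀ w : Poly3 r,
    pairWeight E * volForm c E w w = 1 / 2 * p.surf i j w w w + 1 / 2 * p.surf j i w w w) ∧
  ∀ i j, i ≠ j → ∀ u v : Poly3 r,
    p.surf i j u v (u - v) = 1 / 2 * p.surf i j u u u - 1 / 2 * p.surf i j v v v

/-- Reflecting propagation forms, for a straight wall through `q` with unit normal `n`: if `i` is the
boundary face of `E`, then `p_ji(u, 𝔐v, w) = - p_ji(𝔐u, v, 𝔐w)` for all `j ≠ i`. -/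
def PropagationForms.Reflecting {c : ℝ} {E : M.Cell} (p : PropagationForms r c E)
    (n q : Pt) : Prop :=
  ∀ i : Face E, i.1 = none → ∀ j, j ≠ i → ∀ u v w : Poly3 r,
    p.surf j i u (mirrorPoly n q v) w = -p.surf j i (mirrorPoly n q u) v (mirrorPoly n q w)

/-- The boundary face of `E` lies on the line through `q` with unit normal `n`, and the outward
normal of `E` is `n` along it (up to sets of length zero). -/
def IsFlatWall (E : M.Cell) (n q : Pt) : Prop :=
  ‖n‖ = 1 ∧ ∀ᵐ x ∂((MeasureTheory.Measure.hausdorffMeasure 1 : MeasureTheory.Measure Pt).restrict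
    (bdryFace E)), inner ℝ (x - q) n = 0 ∧ outerNormal (Cell.set E) x = n

/-! ### The stabilization terms -/

/-- The capacity `𝔠_E(Δt) = |E| / ((2r+1) Δt c maxᵢ |γᵢ|)`. -/
def capacity (r : ℕ) (c Δt : ℝ) (E : M.Cell) : ℝ :=
  1 / (2 * (r : ℝ) + 1) * ((MeasureTheory.volume (Cell.set E)).toReal /
    (Δt * c * ⨆ i : Face E, faceLength (faceSet E i)))

/-- The stabilization parameter `η_E = 1 - 𝔠_E`. -/
def stabParam (r : ℕ) (c Δt : ℝ) (E : M.Cell) : ℝ := 1 - capacity r c Δt E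

open scoped Classical in
/-- The central flux term of the base scheme at the face `i` of `E`. -/
def faceCentral (lab : M.Labelling) (c : ℝ) (E : M.Cell) (i : Face E) (u w : M.DGSpace r) : ℝ :=
  match i.1 with
  | none => centralBdry c E u w
  | some F => if lab.left E F then centralInt c E F u w else centralInt c F E u w

open scoped Classical in
/-- The dissipation term of the base scheme at the face `i` of `E`. -/
def faceDissip (lab : M.Labelling) (S : Pt → Matrix (Fin 3) (Fin 3) ℝ) (E : M.Cell) (i : Face E)
    (u w : M.DGSpace r) : ℝ :=
  match i.1 with
  | none => dissipBdry S E u w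
  | some F => if lab.left E F then dissipInt S E F u w else dissipInt S F E u w

open scoped Classical in
/-- The fixed normal `n_γ` at the face `i` of `E`: from left to right at internal faces, outward at
the boundary. -/
def faceNormal (lab : M.Labelling) (E : M.Cell) (i : Face E) (x : Pt) : Pt :=
  match i.1 with
  | none => outerNormal (Cell.set E) x
  | some F => if lab.left E F then outerNormal (Cell.set E) x else outerNormal (Cell.set F) x

/-- The extension of `u` from the neighbour `E_i` in the pair `{i, j}` of faces of `E`: the
polynomial on `E_i` if `i` is internal, and the mirrored polynomial on `E_j` if `i` is the boundary
face (which lies on the line through `q` with unit normal `n`). -/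
def extPair (n q : Pt) (E : M.Cell) (i j : Face E) (u : M.DGSpace r) : Poly3 r :=
  match i.1, j.1 with
  | some F, _ => u F
  | none, some G => mirrorPoly n q (u G)
  | none, none => 0

/-- The polynomial on the neighbour `E_i`, and zero if `i` is the boundary face. -/
def extTest (E : M.Cell) (i : Face E) (w : M.DGSpace r) : Poly3 r :=
  match i.1 with
  | some F => w F
  | none => 0

/-- The pair contribution `J^{0,E}_{h,ij}`. For two internal faces this is
`p_ij(u_i, u_j, w_E - w_j) + p_ji(u_i, u_j, w_E - w_i)`; if `i` is the boundary face, it is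
`p_ij(𝔐u_j, u_j, w_E - w_j) + p_ji(𝔐u_j, u_j, w_E)`, and likewise for `j`. -/
def J0pair {c : ℝ} (n q : Pt) {E : M.Cell} (p : PropagationForms r c E) (i j : Face E)
    (u w : M.DGSpace r) : ℝ :=
  p.surf i j (extPair n q E i j u) (extPair n q E j i u) (w E - extTest E j w) +
    p.surf j i (extPair n q E i j u) (extPair n q E j i u) (w E - extTest E i w)

/-- The summand of `J^{1,E}_{h,ij}` (without the weight `ω`) belonging to the element whose
extensions of `u` and `w` are `uε` and `wε`. -/
def J1term {c : ℝ} (n q : Pt) {E : M.Cell} (p : PropagationForms r c E) (i j : Face E)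
    (u w : M.DGSpace r) (uε wε : Poly3 r) : ℝ :=
  p.vol (extPair n q E i j u) (extPair n q E j i u) wε - pairWeight E * volForm c E uε wε +
    p.volStar (extPair n q E i j w) (extPair n q E j i w) uε

/-- The pair contribution `J^{1,E}_{h,ij}`, with weight `-1` for `E` and `1/2` for `E_i`, `E_j`. -/
def J1pair {c : ℝ} (n q : Pt) {E : M.Cell} (p : PropagationForms r c E) (i j : Face E)
    (u w : M.DGSpace r) : ℝ :=
  -J1term n q p i j u w (u E) (w E) +
    1 / 2 * J1term n q p i j u w (extPair n q E i j u) (extPair n q E i j w) +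
    1 / 2 * J1term n q p i j u w (extPair n q E j i u) (extPair n q E j i w)

/-- The pair contribution `J^{s,E}_{ij}`. -/
def Jspair (lab : M.Labelling) (S : Pt → Matrix (Fin 3) (Fin 3) ℝ) (n q : Pt) (E : M.Cell)
    (i j : Face E) (u w : M.DGSpace r) : ℝ :=
  1 / 6 * (∑ γ : Face E, lineIntegral (faceSet E γ) fun x =>
    (S (faceNormal lab E γ x)).mulVec
      ((extPair n q E i j u).val x - (extPair n q E j i u).val x) ⬝ᵥ
        ((extPair n q E i j w).val x - (extPair n q E j i w).val x)) +
  1 / 6 * (∑ γ : Face E, lineIntegral (faceSet E γ) fun x =>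
    (S (faceNormal lab E γ x)).mulVec
      ((extPair n q E j i u).val x - (extPair n q E i j u).val x) ⬝ᵥ
        ((extPair n q E j i w).val x - (extPair n q E i j w).val x))

/-- The pairs `(i, j)` of faces with `i < j` in the numbering. -/
def facePairs (lab : M.Labelling) (E : M.Cell) : Finset (Face E × Face E) :=
  Finset.univ.filter fun P => lab.num E P.1 < lab.num E P.2

/-- `J^{0,E}_h`. -/
def J0 (lab : M.Labelling) {c : ℝ} (Δt : ℝ) (n q : Pt) {E : M.Cell} (p : PropagationForms r c E)
    (u w : M.DGSpace r) : ℝ :=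
  stabParam r c Δt E * (∑ P ∈ facePairs lab E, J0pair n q p P.1 P.2 u w) -
    stabParam r c Δt E * ∑ i : Face E, faceCentral lab c E i u w

/-- `J^{1,E}_h`. -/
def J1 (lab : M.Labelling) {c : ℝ} (Δt : ℝ) (n q : Pt) {E : M.Cell} (p : PropagationForms r c E)
    (u w : M.DGSpace r) : ℝ :=
  stabParam r c Δt E * ∑ P ∈ facePairs lab E, J1pair n q p P.1 P.2 u w

/-- `J^{s,E}_h`. -/
def Js (lab : M.Labelling) (S : Pt → Matrix (Fin 3) (Fin 3) ℝ) (c Δt : ℝ) (n q : Pt) (E : M.Cell)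
    (u w : M.DGSpace r) : ℝ :=
  stabParam r c Δt E * (∑ P ∈ facePairs lab E, Jspair lab S n q E P.1 P.2 u w) -
    stabParam r c Δt E * ∑ i : Face E, faceDissip lab S E i u w

variable (M)

/-- The data of a stabilized scheme of degree `r`: speed of sound `c`, time step size `Δt`, threshold
`α`, labelling of the mesh, dissipation matrices `S n`, and for each small cell the line carrying its
boundary face (if there is one) and a set of propagation forms. -/
structure DoDScheme (r : ℕ) where
  c : ℝ
  c_pos : 0 < c
  Δt : ℝ
  Δt_pos : 0 < Δt
  α : ℝ
  α_mem : α ∈ Set.Ioo (0 : ℝ) 1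
  lab : M.Labelling
  S : Pt → Matrix (Fin 3) (Fin 3) ℝ
  wallNormal : M.SmallCell α → Pt
  wallPoint : M.SmallCell α → Pt
  flat : ∀ E : M.SmallCell α, HasBdryFace E.1 → IsFlatWall E.1 (wallNormal E) (wallPoint E)
  forms : ∀ E : M.SmallCell α, PropagationForms r c E.1

variable {M}

/-- The central stabilization `J^a_h`. -/
def DoDScheme.Ja (D : M.DoDScheme r) (u w : M.DGSpace r) : ℝ :=
  (∑ E : M.SmallCell D.α, J0 D.lab D.Δt (D.wallNormal E) (D.wallPoint E) (D.forms E) u w) +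
    ∑ E : M.SmallCell D.α, J1 D.lab D.Δt (D.wallNormal E) (D.wallPoint E) (D.forms E) u w

/-- The dissipative stabilization `J^s_h`. -/
def DoDScheme.JsForm (D : M.DoDScheme r) (u w : M.DGSpace r) : ℝ :=
  ∑ E : M.SmallCell D.α, Js D.lab D.S D.c D.Δt (D.wallNormal E) (D.wallPoint E) E.1 u w

/-- `u` solves the stabilized semi-discrete scheme on `[0, T]`. The time derivative in the
finite-dimensional discrete space is taken coefficientwise. -/
def DoDScheme.IsSolution (D : M.DoDScheme r) (T : ℝ) (u : ℝ → M.DGSpace r) : Prop :=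
  ∃ du : ℝ → M.DGSpace r, ∀ t ∈ Set.Icc 0 T,
    (∀ (E : M.Cell) (i : Fin 3) (m : Fin 2 →₀ ℕ),
      HasDerivWithinAt (fun s => MvPolynomial.coeff m (u s E i : MvPolynomial (Fin 2) ℝ))
        (MvPolynomial.coeff m (du t E i : MvPolynomial (Fin 2) ℝ)) (Set.Icc 0 T) t) ∧
    ∀ w : M.DGSpace r,
      l2Inner (du t) w + aForm D.lab D.c (u t) w + D.Ja (u t) w + sForm D.lab D.S (u t) w +
        D.JsForm (u t) w = 0

end CutCellMesh

end

section

open MeasureTheory Set Filter Topology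
open scoped RealInnerProductSpace ENNReal NNReal Manifold

section OuterNormal

variable {A B : Set Pt} {x n m : Pt}

theorem ContDiffAt.continuousAt_gradient {φ : Pt → ℝ} (h : ContDiffAt ℝ 1 φ x) :
    ContinuousAt (gradient φ) x :=
  (InnerProductSpace.toDual ℝ Pt).symm.continuous.continuousAt.comp
    (h.continuousAt_fderiv one_ne_zero)

theorem ContDiffAt.hasFDerivAt_gradient {φ : Pt → ℝ} (h : ContDiffAt ℝ 1 φ x) :
    HasFDerivAt φ (innerSL ℝ (gradient φ x)) x := by
  exact (h.differentiableAt one_ne_zero).hasGradientAt.hasFDerivAt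

theorem ContDiffAt.fderiv_apply_eq_inner_gradient {φ : Pt → ℝ} (h : ContDiffAt ℝ 1 φ x) (v : Pt) :
    fderiv ℝ φ x v = ⟪gradient φ x, v⟫ := by
  rw [h.hasFDerivAt_gradient.fderiv, innerSL_apply_apply]

theorem IsOuterNormal.norm_eq_one (h : IsOuterNormal A x n) : ‖n‖ = 1 := by
  obtain ⟨φ, -, -, h0, -, rfl⟩ := h
  rw [norm_smul, norm_inv, norm_norm, inv_mul_cancel₀ (norm_ne_zero_iff.2 h0)]

theorem eventually_lt_of_inner_gradient_neg {φ : Pt → ℝ} (h : ContDiffAt ℝ 1 φ x) (h0 : φ x = 0)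
    {v : Pt} (hv : ⟪gradient φ x, v⟫ < 0) : ∀ᶠ t : ℝ in 𝓝[>] 0, φ (x + t • v) < 0 := by
  have hl : HasDerivAt (fun t : ℝ => φ (x + t • v)) ⟪gradient φ x, v⟫ 0 := by
    have h1 : HasDerivAt (fun t : ℝ => x + t • v) v 0 := by
      simpa using ((hasDerivAt_id (0 : ℝ)).smul_const v).const_add x
    have h2 : HasFDerivAt φ (innerSL ℝ (gradient φ x)) (x + (0 : ℝ) • v) := by
      simpa using h.hasFDerivAt_gradient
    exact h2.comp_hasDerivAt _ h1
  have h3 := (hasDerivAt_iff_tendsto_slope.1 hl).eventually (gt_mem_nhds hv)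
  have h4 : 𝓝[>] (0 : ℝ) ≤ 𝓝[≠] 0 := nhdsWithin_mono _ fun t ht => ne_of_gt ht
  filter_upwards [h4 h3, self_mem_nhdsWithin] with t ht ht0
  rw [slope_def_field] at ht
  simp only [zero_smul, add_zero, h0, sub_zero] at ht
  by_contra hc
  exact absurd ht (not_lt.2 (div_nonneg (not_lt.1 hc) (le_of_lt ht0)))

theorem eventually_nhds_add_smul {P : Pt → Prop} (h : ∀ᶠ y in 𝓝 x, P y) (v : Pt) :
    ∀ᶠ t : ℝ in 𝓝[>] 0, P (x + t • v) := by
  have h1 : Tendsto (fun t : ℝ => x + t • v) (𝓝[>] 0) (𝓝 x) := by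
    have : Tendsto (fun t : ℝ => x + t • v) (𝓝 0) (𝓝 (x + (0 : ℝ) • v)) :=
      (Continuous.tendsto (by fun_prop) 0)
    rw [zero_smul, add_zero] at this
    exact this.mono_left nhdsWithin_le_nhds
  exact h1.eventually h

theorem IsOuterNormal.eventually_mem (h : IsOuterNormal A x n) {v : Pt} (hv : ⟪n, v⟫ < 0) :
    ∀ᶠ t : ℝ in 𝓝[>] 0, x + t • v ∈ A := by
  obtain ⟨φ, hφ, h0, hg, hA, rfl⟩ := h
  rw [real_inner_smul_left] at hv
  have hv' : ⟪gradient φ x, v⟫ < 0 := by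
    by_contra hc
    exact absurd hv (not_lt.2 (mul_nonneg (by positivity) (not_lt.1 hc)))
  filter_upwards [eventually_lt_of_inner_gradient_neg hφ h0 hv', eventually_nhds_add_smul hA v]
    with t h1 h2
  exact h2.2 h1

theorem IsOuterNormal.eventually_notMem_closure (h : IsOuterNormal A x n) {v : Pt}
    (hv : 0 < ⟪n, v⟫) : ∀ᶠ t : ℝ in 𝓝[>] 0, x + t • v ∉ closure A := by
  obtain ⟨φ, hφ, h0, hg, hA, rfl⟩ := h
  rw [real_inner_smul_left] at hv
  have hv' : ⟪gradient (fun y => -φ y) x, v⟫ < 0 := by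
    rw [← hφ.neg.fderiv_apply_eq_inner_gradient, fderiv_fun_neg,
      neg_apply, hφ.fderiv_apply_eq_inner_gradient, neg_lt_zero]
    by_contra hc
    exact absurd hv (not_lt.2 (mul_nonpos_of_nonneg_of_nonpos (by positivity) (not_lt.1 hc)))
  have hc := (hφ.eventually (by simp)).mono fun y hy => hy.continuousAt
  filter_upwards [eventually_lt_of_inner_gradient_neg hφ.neg (by simp [h0]) hv',
    eventually_nhds_add_smul hA.eventually_nhds v, eventually_nhds_add_smul hc v] with t h1 h2 h3
  rw [← mem_compl_iff, ← interior_compl, mem_interior_iff_mem_nhds]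
  have h1' : 0 < φ (x + t • v) := by simpa using h1
  filter_upwards [h2, h3.eventually (lt_mem_nhds h1')] with y hy1 hy2 hy3
  exact absurd (hy1.1 hy3) (not_lt.2 hy2.le)

theorem eq_of_forall_inner_neg {a b : Pt} (ha : ‖a‖ = 1) (hb : ‖b‖ = 1)
    (h : ∀ v, ⟪a, v⟫ < 0 → ⟪b, v⟫ ≤ 0) : a = b := by
  have haa : ⟪a, a⟫ = 1 := by rw [real_inner_self_eq_norm_sq, ha]; norm_num
  have hbb : ⟪b, b⟫ = 1 := by rw [real_inner_self_eq_norm_sq, hb]; norm_num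
  by_contra hne
  have h1 : ⟪a, b⟫ < 1 := by
    rcases (real_inner_le_norm a b).lt_or_eq with h2 | h2
    · simpa [ha, hb] using h2
    · exact absurd ((inner_eq_one_iff_of_norm_eq_one ha hb).1 (by simpa [ha, hb] using h2)) hne
  have := h (b - a) (by rw [inner_sub_right, haa]; linarith)
  rw [inner_sub_right, hbb, real_inner_comm] at this
  linarith

theorem IsOuterNormal.eq_of_subset (h : IsOuterNormal A x n) (h' : IsOuterNormal B x m)
    (hAB : A ⊆ B) : n = m := by
  refine eq_of_forall_inner_neg h.norm_eq_one h'.norm_eq_one fun v hv => ?_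
  by_contra hc
  obtain ⟨t, h1, h2⟩ :=
    ((h.eventually_mem hv).and (h'.eventually_notMem_closure (not_le.1 hc))).exists
  exact h2 (subset_closure (hAB h1))

theorem IsOuterNormal.unique (h : IsOuterNormal A x n) (h' : IsOuterNormal A x m) : n = m :=
  h.eq_of_subset h' Subset.rfl

theorem IsOuterNormal.eq_neg_of_disjoint (h : IsOuterNormal A x n) (h' : IsOuterNormal B x m)
    (hAB : Disjoint A B) : n = -m := by
  refine eq_of_forall_inner_neg h.norm_eq_one (by rw [norm_neg, h'.norm_eq_one]) fun v hv => ?_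
  rw [inner_neg_left, neg_nonpos]
  by_contra hc
  obtain ⟨t, h1, h2⟩ := ((h.eventually_mem hv).and (h'.eventually_mem (not_le.1 hc))).exists
  exact hAB.le_bot ⟨h1, h2⟩

theorem IsOuterNormal.outerNormal_eq (h : IsOuterNormal A x n) : outerNormal A x = n := by
  have h' : ∃ n, IsOuterNormal A x n := ⟨n, h⟩
  rw [outerNormal, dif_pos h']
  exact h'.choose_spec.unique h

theorem isOuterNormal_outerNormal (h : ∃ n, IsOuterNormal A x n) :
    IsOuterNormal A x (outerNormal A x) := by
  obtain ⟨n, h⟩ := h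
  rwa [h.outerNormal_eq]

theorem norm_outerNormal_le_one (A : Set Pt) (x : Pt) : ‖outerNormal A x‖ ≤ 1 := by
  by_cases h : ∃ n, IsOuterNormal A x n
  · exact (isOuterNormal_outerNormal h).norm_eq_one.le
  · simp [outerNormal, dif_neg h]

/-- Near a point with an outer normal, the boundary is the zero set of any defining function, whose
normalized gradient is the outer normal. -/
theorem eventually_isOuterNormal {φ : Pt → ℝ} (hφ : ContDiffAt ℝ 1 φ x)
    (hg : gradient φ x ≠ 0) (hA : ∀ᶠ y in 𝓝 x, y ∈ A ↔ φ y < 0) :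
    ∀ᶠ y in 𝓝 x, y ∈ frontier A →
      φ y = 0 ∧ IsOuterNormal A y (‖gradient φ y‖⁻¹ • gradient φ y) := by
  filter_upwards [hφ.eventually (by simp), hA.eventually_nhds,
    hφ.continuousAt_gradient.eventually_ne hg] with y h1 h2 h3 hy
  have h0 : φ y = 0 := by
    rcases lt_trichotomy (φ y) 0 with h | h | h
    · refine absurd hy fun hy => hy.2 (mem_interior_iff_mem_nhds.2 ?_)
      filter_upwards [h2, h1.continuousAt.eventually (gt_mem_nhds h)] with z hz1 hz2
      exact hz1.2 hz2
    · exact h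
    · refine absurd hy fun hy => ?_
      have : y ∈ interior Aᶜ := by
        rw [mem_interior_iff_mem_nhds]
        filter_upwards [h2, h1.continuousAt.eventually (lt_mem_nhds h)] with z hz1 hz2 hz3
        exact absurd (hz1.1 hz3) (not_lt.2 hz2.le)
      rw [interior_compl] at this
      exact this hy.1
  exact ⟨h0, φ, h1, h0, h3, h2, rfl⟩

theorem IsOuterNormal.eventually_exists (h : IsOuterNormal A x n) :
    ∀ᶠ y in 𝓝 x, y ∈ frontier A → ∃ m, IsOuterNormal A y m := by
  obtain ⟨φ, hφ, h0, hg, hA, rfl⟩ := h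
  filter_upwards [eventually_isOuterNormal hφ hg hA] with y hy hy'
  exact ⟨_, (hy hy').2⟩

theorem IsOuterNormal.continuousWithinAt (h : IsOuterNormal A x n) :
    ContinuousWithinAt (outerNormal A) (frontier A) x := by
  have hn := h.outerNormal_eq
  obtain ⟨φ, hφ, h0, hg, hA, rfl⟩ := h
  have hc : ContinuousAt (fun y => ‖gradient φ y‖⁻¹ • gradient φ y) x :=
    (hφ.continuousAt_gradient.norm.inv₀ (norm_ne_zero_iff.2 hg)).smul hφ.continuousAt_gradient
  refine hc.continuousWithinAt.congr_of_eventuallyEq ?_ hn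
  filter_upwards [mem_nhdsWithin_of_mem_nhds (eventually_isOuterNormal hφ hg hA),
    self_mem_nhdsWithin] with y hy hy'
  exact (hy hy').2.outerNormal_eq

theorem frontier_regular_isOpen (A : Set Pt) :
    ∃ U : Set Pt, IsOpen U ∧ ∀ y ∈ frontier A, y ∈ U ↔ ∃ m, IsOuterNormal A y m := by
  refine ⟨interior {y | y ∈ frontier A → ∃ m, IsOuterNormal A y m}, isOpen_interior,
    fun y hy => ⟨fun h => interior_subset h hy, fun ⟨m, hm⟩ => ?_⟩⟩
  exact mem_interior_iff_mem_nhds.2 hm.eventually_exists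

end OuterNormal

section Comparison

/-- If `μ ≤ ν + ε κ` holds locally for all `ε > 0`, where `κ` is a finite measure, then `μ ≤ ν`. -/
theorem MeasureTheory.Measure.le_of_locally_le_add {X : Type*} [TopologicalSpace X]
    [SecondCountableTopology X] [MeasurableSpace X] [BorelSpace X] {μ ν κ : Measure X}
    [IsFiniteMeasure κ]
    (h : ∀ ε : ℝ≥0, 0 < ε → ∀ x : X, ∃ U ∈ 𝓝 x, ∀ B, MeasurableSet B → B ⊆ U →
      μ B ≤ ν B + ε * κ B) : μ ≤ ν := by
  have key : ∀ ε : ℝ≥0, 0 < ε → ∀ B, MeasurableSet B → μ B ≤ ν B + ε * κ B := by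
    intro ε hε B hB
    choose U hU hUB using h ε hε
    obtain ⟨s, hs, hsU⟩ := TopologicalSpace.countable_cover_nhds (f := fun x => interior (U x))
      fun x => interior_mem_nhds.2 (hU x)
    have : Encodable s := hs.toEncodable
    have hD : ∀ x : s, MeasurableSet (interior (U x)) := fun x => isOpen_interior.measurableSet
    set V : ℕ → Set X := fun n => ⋃ x ∈ Encodable.decode₂ s n, interior (U (x : s)) with hV
    have hVm : ∀ n, MeasurableSet (V n) := fun n =>
      MeasurableSet.iUnion fun x => MeasurableSet.iUnion fun _ => hD x
    have hVu : ⋃ n, V n = univ := by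
      rw [hV, Encodable.iUnion_decode₂, ← hsU, biUnion_eq_iUnion]
    have hsum : ∀ ρ : Measure X, ρ B = ∑' n, ρ (B ∩ disjointed V n) := by
      intro ρ
      rw [← measure_iUnion (fun i j hij =>
          ((disjoint_disjointed V hij).mono inter_subset_right inter_subset_right))
          (fun n => hB.inter (MeasurableSet.disjointed hVm n)),
        ← inter_iUnion, iUnion_disjointed, hVu, inter_univ]
    have hle : ∀ n, μ (B ∩ disjointed V n) ≤
        ν (B ∩ disjointed V n) + ε * κ (B ∩ disjointed V n) := by
      intro n
      have hm : MeasurableSet (B ∩ disjointed V n) := hB.inter (MeasurableSet.disjointed hVm n)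
      have hsub : B ∩ disjointed V n ⊆ V n := inter_subset_right.trans (disjointed_subset V n)
      rcases hdn : Encodable.decode₂ s n with _ | x
      · have : V n = ∅ := by simp [hV, hdn]
        have h0 : B ∩ disjointed V n = ∅ := subset_empty_iff.1 (this ▸ hsub)
        simp [h0]
      · refine hUB x _ hm (hsub.trans ?_)
        simp only [hV, hdn, Option.mem_def, Option.some.injEq, iUnion_iUnion_eq_right]
        exact interior_subset
    rw [hsum μ, hsum ν, hsum κ, ← ENNReal.tsum_mul_left, ← ENNReal.tsum_add]
    exact ENNReal.tsum_le_tsum hle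
  refine Measure.le_iff.2 fun B hB => ENNReal.le_of_forall_pos_le_add fun δ hδ _ => ?_
  have hK : κ univ ≠ ∞ := measure_ne_top κ univ
  set K : ℝ≥0 := (κ univ).toNNReal + 1 with hKdef
  have hKpos : 0 < K := by positivity
  refine (key (δ / K) (div_pos hδ hKpos) B hB).trans (add_le_add_right ?_ _)
  have h1 : κ B ≤ K := (measure_mono (subset_univ B)).trans (by
    rw [hKdef, ENNReal.coe_add, ENNReal.coe_toNNReal hK]; exact le_self_add)
  calc ((δ / K : ℝ≥0) : ℝ≥0∞) * κ B ≤ ((δ / K : ℝ≥0) : ℝ≥0∞) * K := mul_le_mul_right h1 _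
    _ = δ := by rw [← ENNReal.coe_mul, div_mul_cancel₀ _ hKpos.ne']

theorem hausdorffMeasure_subtype_image {X : Type*} [EMetricSpace X] [MeasurableSpace X]
    [BorelSpace X] {d : ℝ} (hd : 0 ≤ d) (s : Set X) (B : Set s) :
    Measure.hausdorffMeasure d ((↑) '' B : Set X) = Measure.hausdorffMeasure d B :=
  isometry_subtype_coe.hausdorffMeasure_image (Or.inl hd) B

/-- A map that expands distances on `B` at least by the factor `k` expands the length of `B` at
least by this factor. -/
theorem mul_hausdorffMeasure_one_le_image {X : Type*} [MetricSpace X] [MeasurableSpace X]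
    [BorelSpace X] {f : X → ℝ} {B : Set X} {k : ℝ≥0}
    (h : ∀ a ∈ B, ∀ b ∈ B, k * dist a b ≤ dist (f a) (f b)) :
    k * Measure.hausdorffMeasure 1 B ≤ Measure.hausdorffMeasure 1 (f '' B) := by
  rcases eq_or_ne k 0 with rfl | hk
  · simp
  have hanti : AntilipschitzWith k⁻¹ (B.domRestrict f) := by
    refine AntilipschitzWith.of_le_mul_dist fun a b => ?_
    have := h a a.2 b b.2
    rw [NNReal.coe_inv, le_inv_mul_iff₀ (NNReal.coe_pos.2 (pos_iff_ne_zero.2 hk))]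
    exact this
  have h1 := hanti.le_hausdorffMeasure_image (d := 1) zero_le_one univ
  rw [image_univ, range_domRestrict, ← hausdorffMeasure_subtype_image zero_le_one, image_univ,
    Subtype.range_coe, ENNReal.rpow_one] at h1
  calc (k : ℝ≥0∞) * Measure.hausdorffMeasure 1 B
      ≤ k * (((k⁻¹ : ℝ≥0) : ℝ≥0∞) * Measure.hausdorffMeasure 1 (f '' B)) := mul_le_mul_right h1 _
    _ = Measure.hausdorffMeasure 1 (f '' B) := by
      rw [← mul_assoc, ← ENNReal.coe_mul, mul_inv_cancel₀ hk, ENNReal.coe_one, one_mul]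

theorem hausdorffMeasure_one_image_le_mul {X : Type*} [MetricSpace X] [MeasurableSpace X]
    [BorelSpace X] {f : X → ℝ} {B : Set X} {k : ℝ≥0}
    (h : ∀ a ∈ B, ∀ b ∈ B, dist (f a) (f b) ≤ k * dist a b) :
    Measure.hausdorffMeasure 1 (f '' B) ≤ k * Measure.hausdorffMeasure 1 B := by
  simpa using (LipschitzOnWith.of_dist_le_mul h).hausdorffMeasure_image_le zero_le_one

end Comparison

section Projection

variable {e τ : Pt}

/-- The orthonormal basis of the plane consisting of two given vectors. -/
theorem exists_orthonormalBasis_pair (he : ‖e‖ = 1) (hτ : ‖τ‖ = 1) (h : ⟪τ, e⟫ = 0) :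
    ∃ b : OrthonormalBasis (Fin 2) ℝ Pt, b 0 = τ ∧ b 1 = e := by
  have ho : Orthonormal ℝ ![τ, e] := by
    rw [orthonormal_iff_ite]
    intro i j
    fin_cases i <;> fin_cases j <;>
      simp [he, hτ, h, real_inner_comm e τ ▸ h]
  exact ⟨OrthonormalBasis.mk ho (ho.linearIndependent.span_eq_top_of_card_eq_finrank
    (by simp)).ge, by simp, by simp⟩

/-- Coordinates with respect to an orthonormal pair in the plane. -/
theorem orthonormal_pair_expand (he : ‖e‖ = 1) (hτ : ‖τ‖ = 1) (h : ⟪τ, e⟫ = 0) (x : Pt) :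
    x = ⟪τ, x⟫ • τ + ⟪e, x⟫ • e := by
  obtain ⟨b, h0, h1⟩ := exists_orthonormalBasis_pair he hτ h
  have hs := b.sum_repr' x
  simpa [Fin.sum_univ_two, h0, h1] using hs.symm

theorem inner_eq_of_orthonormal_pair (he : ‖e‖ = 1) (hτ : ‖τ‖ = 1) (h : ⟪τ, e⟫ = 0) (x y : Pt) :
    ⟪x, y⟫ = ⟪τ, x⟫ * ⟪τ, y⟫ + ⟪e, x⟫ * ⟪e, y⟫ := by
  conv_lhs => rw [orthonormal_pair_expand he hτ h y]
  rw [inner_add_right, real_inner_smul_right, real_inner_smul_right, real_inner_comm x τ,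
    real_inner_comm x e]
  ring

theorem inner_left_pair (hτ : ‖τ‖ = 1) (h : ⟪τ, e⟫ = 0) (s t : ℝ) :
    ⟪τ, s • τ + t • e⟫ = s := by
  rw [inner_add_right, real_inner_smul_right, real_inner_smul_right, h,
    real_inner_self_eq_norm_sq, hτ]
  ring

theorem inner_right_pair (he : ‖e‖ = 1) (h : ⟪τ, e⟫ = 0) (s t : ℝ) :
    ⟪e, s • τ + t • e⟫ = t := by
  rw [inner_add_right, real_inner_smul_right, real_inner_smul_right, real_inner_comm, h,
    real_inner_self_eq_norm_sq, he]
  ring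

theorem exists_orthonormal_pair (he : ‖e‖ = 1) : ∃ τ : Pt, ‖τ‖ = 1 ∧ ⟪τ, e⟫ = 0 := by
  refine ⟨!₂[-e 1, e 0], ?_, ?_⟩
  · rw [EuclideanSpace.norm_eq] at he ⊢
    simp only [Fin.sum_univ_two, Real.norm_eq_abs, sq_abs] at he ⊢
    simpa [add_comm] using he
  · simp [PiLp.inner_apply, Fin.sum_univ_two]
    ring

/-- The coordinate map of an orthonormal pair preserves the area. -/
theorem measurePreserving_pair (he : ‖e‖ = 1) (hτ : ‖τ‖ = 1) (h : ⟪τ, e⟫ = 0) :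
    MeasurePreserving (fun z : ℝ × ℝ => z.1 • τ + z.2 • e) volume volume ∧
      MeasurableEmbedding (fun z : ℝ × ℝ => z.1 • τ + z.2 • e) := by
  obtain ⟨b, h0, h1⟩ := exists_orthonormalBasis_pair he hτ h
  have hf : (fun z : ℝ × ℝ => z.1 • τ + z.2 • e) =
      b.measurableEquiv.symm ∘ (MeasurableEquiv.toLp 2 (Fin 2 → ℝ)) ∘
        (MeasurableEquiv.finTwoArrow (α := ℝ)).symm := by
    funext z
    simp only [Function.comp]
    apply b.measurableEquiv.injective
    rw [MeasurableEquiv.apply_symm_apply]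
    ext i
    change b.repr _ i = _
    rw [b.repr_apply_apply]
    fin_cases i
    · simpa [h0] using inner_left_pair hτ h z.1 z.2
    · simpa [h1] using inner_right_pair he h z.1 z.2
  rw [hf]
  refine ⟨?_, ?_⟩
  · exact (b.measurePreserving_measurableEquiv.symm _).comp
      ((PiLp.volume_preserving_toLp (Fin 2)).comp (volume_preserving_finTwoArrow ℝ).symm)
  · exact b.measurableEquiv.symm.measurableEmbedding.comp
      ((MeasurableEquiv.toLp 2 (Fin 2 → ℝ)).measurableEmbedding.comp
        (MeasurableEquiv.finTwoArrow (α := ℝ)).symm.measurableEmbedding)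

/-- Fubini's theorem in the coordinates of an orthonormal pair. -/
theorem integral_eq_integral_pair (he : ‖e‖ = 1) (hτ : ‖τ‖ = 1) (h : ⟪τ, e⟫ = 0) {F : Pt → ℝ}
    (hF : Integrable F) : ∫ x, F x = ∫ s : ℝ, ∫ t : ℝ, F (s • τ + t • e) := by
  obtain ⟨hm, hme⟩ := measurePreserving_pair he hτ h
  rw [← hm.integral_comp hme F, Measure.volume_eq_prod, integral_prod]
  exact (hm.integrable_comp_emb hme).2 hF

/-- For two unit vectors `n` and `e` and a displacement `d` that is almost orthogonal to `n`, the
component of `d` orthogonal to `e` has almost the length `⟪n, e⟫ ‖d‖`. -/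
theorem abs_inner_tangential_bounds (he : ‖e‖ = 1) (hτ : ‖τ‖ = 1) (h : ⟪τ, e⟫ = 0) {n d : Pt}
    {ε : ℝ} (hn : ‖n‖ = 1) (hne : 0 ≤ ⟪n, e⟫) (hd : |⟪n, d⟫| ≤ ε * ‖d‖) :
    |⟪τ, d⟫| ≤ (⟪n, e⟫ + ε) * ‖d‖ ∧ (⟪n, e⟫ - 2 * ε) * ‖d‖ ≤ |⟪τ, d⟫| := by
  have hnd := inner_eq_of_orthonormal_pair he hτ h n d
  have hdd := inner_eq_of_orthonormal_pair he hτ h d d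
  have hnn := inner_eq_of_orthonormal_pair he hτ h n n
  rw [real_inner_self_eq_norm_sq] at hdd hnn
  rw [hn] at hnn
  rw [real_inner_comm e n] at hne ⊢
  rw [hnd] at hd
  have hL := norm_nonneg d
  revert hd hdd hnn hne hL
  generalize ⟪τ, n⟫ = σ
  generalize ⟪e, n⟫ = ρ
  generalize ⟪τ, d⟫ = a
  generalize ⟪e, d⟫ = b
  generalize ‖d‖ = L
  intro hρ hd hdd hnn hL
  set g := σ * a + ρ * b with hg
  set k := ρ * a - σ * b with hk
  have hak : a = ρ * k + σ * g := by rw [hg, hk]; linear_combination a * hnn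
  have hkg : k ^ 2 + g ^ 2 = L ^ 2 := by rw [hg, hk]; linear_combination -hdd - (a * a + b * b) * hnn
  have hσ : |σ| ≤ 1 := abs_le_one_iff_mul_self_le_one.2 (by nlinarith [mul_self_nonneg ρ])
  have hρ1 : ρ ≤ 1 := by nlinarith
  have hkL : |k| ≤ L := abs_le_of_sq_le_sq (by nlinarith [sq_nonneg g]) hL
  have hLk : L ≤ |k| + |g| := by
    refine le_of_sq_le_sq ?_ (by positivity)
    have := abs_nonneg k
    have := abs_nonneg g
    nlinarith [sq_abs k, sq_abs g, mul_nonneg (abs_nonneg k) (abs_nonneg g)]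
  have hσg : |σ * g| ≤ ε * L := by
    rw [abs_mul]
    exact (mul_le_of_le_one_left (abs_nonneg g) hσ).trans hd
  have hρk : |ρ * k| = ρ * |k| := by rw [abs_mul, abs_of_nonneg hρ]
  constructor
  · calc |a| = |ρ * k + σ * g| := by rw [← hak]
      _ ≤ |ρ * k| + |σ * g| := abs_add_le _ _
      _ ≤ ρ * L + ε * L := add_le_add (by rw [hρk]; gcongr) hσg
      _ = _ := by ring
  · have h1 : |ρ * k| ≤ |a| + |σ * g| := by
      have : ρ * k = a - σ * g := by rw [hak]; ring
      rw [this]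
      exact abs_sub _ _
    have h2 : ρ * L ≤ ρ * |k| + ρ * |g| := by
      rw [← mul_add]
      exact mul_le_mul_of_nonneg_left hLk hρ
    have h3 : ρ * |g| ≤ ε * L := (mul_le_of_le_one_left (abs_nonneg g) hρ1).trans hd
    rw [hρk] at h1
    linarith

end Projection

section Projection

variable {e τ : Pt}

/-- Projecting a curve `Γ` with unit normals `n` along the direction `e` gives the measure
`⟪n, e⟫ d𝓗¹` on `Γ`. -/
theorem comap_projection_eq_withDensity (he : ‖e‖ = 1) (hτ : ‖τ‖ = 1) (h : ⟪τ, e⟫ = 0) {Γ : Set Pt}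
    (hΓ : MeasurableSet Γ) (hfin : Measure.hausdorffMeasure 1 Γ ≠ ⊤) {n : Pt → Pt}
    (hc : ContinuousOn n Γ) (hn : ∀ x ∈ Γ, ‖n x‖ = 1) (hpos : ∀ x ∈ Γ, 0 < ⟪n x, e⟫)
    (htan : ∀ x ∈ Γ, ∀ ε : ℝ, 0 < ε → ∃ U ∈ 𝓝 x, ∀ a ∈ U ∩ Γ, ∀ b ∈ U ∩ Γ,
      |⟪n x, a - b⟫| ≤ ε * ‖a - b‖)
    (hinj : InjOn (fun x => ⟪τ, x⟫) Γ) :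
    (volume : Measure ℝ).comap (Γ.domRestrict fun x => ⟪τ, x⟫) =
      (Measure.hausdorffMeasure 1 : Measure Γ).withDensity
        fun x => ENNReal.ofReal ⟪n x, e⟫ := by
  have hemb : MeasurableEmbedding (Γ.domRestrict fun x => ⟪τ, x⟫) :=
    ContinuousOn.measurableEmbedding hΓ (by fun_prop) hinj
  set π : Γ → ℝ := Γ.domRestrict fun x => ⟪τ, x⟫ with hπ
  have hρc : Continuous fun x : Γ => ⟪n x, e⟫ :=
    (continuousOn_iff_continuous_domRestrict.1 hc).inner continuous_const
  have hH : IsFiniteMeasure (Measure.hausdorffMeasure 1 : Measure Γ) := ⟨by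
    rw [← hausdorffMeasure_subtype_image zero_le_one, image_univ, Subtype.range_coe]
    exact hfin.lt_top⟩
  have hloc : ∀ ε : ℝ≥0, 0 < ε → ∀ x : Γ, ∃ U ∈ 𝓝 x,
      (∀ y ∈ U, |⟪n y, e⟫ - ⟪n x, e⟫| ≤ ε) ∧
      ∀ a ∈ U, ∀ b ∈ U, |π a - π b| ≤ (⟪n x, e⟫ + ε) * dist a b ∧
        (⟪n x, e⟫ - 2 * ε) * dist a b ≤ |π a - π b| := by
    intro ε hε x
    obtain ⟨U, hU, hUt⟩ := htan x x.2 ε hε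
    refine ⟨(↑) ⁻¹' U ∩ {y | |⟪n y, e⟫ - ⟪n x, e⟫| ≤ ε},
      inter_mem (continuous_subtype_val.continuousAt.preimage_mem_nhds hU) ?_,
      fun y hy => hy.2, fun a ha b hb => ?_⟩
    · filter_upwards [hρc.continuousAt.eventually (Metric.ball_mem_nhds _ (NNReal.coe_pos.2 hε))]
        with y hy
      rw [Real.dist_eq] at hy
      exact hy.le
    · have h1 := abs_inner_tangential_bounds he hτ h (hn x x.2) (hpos x x.2).le
        (hUt a ⟨ha.1, a.2⟩ b ⟨hb.1, b.2⟩)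
      rw [inner_sub_right, ← dist_eq_norm] at h1
      exact h1
  have himg : ∀ B : Set Γ, (volume : Measure ℝ).comap π B = Measure.hausdorffMeasure 1 (π '' B) := by
    intro B
    rw [hemb.comap_apply, hausdorffMeasure_real]
  refine le_antisymm ?_ ?_
  · refine Measure.le_of_locally_le_add (κ := Measure.hausdorffMeasure 1) fun ε hε x => ?_
    obtain ⟨U, hU, hUρ, hUd⟩ := hloc (ε / 2) (by positivity) x
    refine ⟨U, hU, fun B hB hBU => ?_⟩
    rw [himg, withDensity_apply _ hB]
    have h1 := hausdorffMeasure_one_image_le_mul (f := π) (B := B)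
      (k := Real.toNNReal (⟪n x, e⟫ + ε / 2)) (fun a ha b hb => by
        rw [Real.dist_eq, Real.coe_toNNReal _ (by have := hpos x x.2; positivity)]
        exact_mod_cast (hUd a (hBU ha) b (hBU hb)).1)
    refine h1.trans ?_
    rw [← setLIntegral_const, ← setLIntegral_const, ← lintegral_add_right _ measurable_const]
    refine setLIntegral_mono' hB fun y hy => ?_
    have h2 := abs_le.1 (hUρ y (hBU hy))
    rw [← ENNReal.ofReal_coe_nnreal (p := ε), ← ENNReal.ofReal_add (hpos y y.2).le ε.coe_nonneg]
    refine ENNReal.ofReal_le_ofReal ?_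
    push_cast at h2
    linarith [h2.1]
  · refine Measure.le_of_locally_le_add (κ := Measure.hausdorffMeasure 1) fun ε hε x => ?_
    obtain ⟨U, hU, hUρ, hUd⟩ := hloc (ε / 3) (by positivity) x
    refine ⟨U, hU, fun B hB hBU => ?_⟩
    rw [himg, withDensity_apply _ hB]
    have h1 := mul_hausdorffMeasure_one_le_image (f := π) (B := B)
      (k := Real.toNNReal (⟪n x, e⟫ - 2 * (ε / 3))) (fun a ha b hb => by
        rw [Real.dist_eq]
        rcases le_total 0 (⟪n x, e⟫ - 2 * ((ε : ℝ) / 3)) with h0 | h0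
        · rw [Real.coe_toNNReal _ h0]
          exact_mod_cast (hUd a (hBU ha) b (hBU hb)).2
        · rw [Real.toNNReal_of_nonpos h0, NNReal.coe_zero, zero_mul]
          exact abs_nonneg _)
    refine le_trans ?_ (add_le_add_left h1 _)
    rw [← add_mul, ← setLIntegral_const]
    refine setLIntegral_mono' hB fun y hy => ?_
    have h2 := abs_le.1 (hUρ y (hBU hy))
    rw [← ENNReal.ofReal_coe_nnreal (p := ε)]
    refine (ENNReal.ofReal_le_ofReal ?_).trans ENNReal.ofReal_add_le
    push_cast at h2
    linarith [h2.2]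

/-- Integration over the projection of a curve. -/
theorem integral_projection (he : ‖e‖ = 1) (hτ : ‖τ‖ = 1) (h : ⟪τ, e⟫ = 0) {Γ : Set Pt}
    (hΓ : MeasurableSet Γ) (hfin : Measure.hausdorffMeasure 1 Γ ≠ ⊤) {n : Pt → Pt}
    (hc : ContinuousOn n Γ) (hn : ∀ x ∈ Γ, ‖n x‖ = 1) (hpos : ∀ x ∈ Γ, 0 < ⟪n x, e⟫)
    (htan : ∀ x ∈ Γ, ∀ ε : ℝ, 0 < ε → ∃ U ∈ 𝓝 x, ∀ a ∈ U ∩ Γ, ∀ b ∈ U ∩ Γ,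
      |⟪n x, a - b⟫| ≤ ε * ‖a - b‖)
    (hinj : InjOn (fun x => ⟪τ, x⟫) Γ) {G : Pt → ℝ} {g : ℝ → ℝ}
    (hgG : ∀ x ∈ Γ, g ⟪τ, x⟫ = G x) (hg0 : ∀ s, (∀ x ∈ Γ, ⟪τ, x⟫ ≠ s) → g s = 0) :
    ∫ s, g s = ∫ x in Γ, G x * ⟪n x, e⟫ ∂(Measure.hausdorffMeasure 1) := by
  have hemb : MeasurableEmbedding (Γ.domRestrict fun x => ⟪τ, x⟫) :=
    ContinuousOn.measurableEmbedding hΓ (by fun_prop) hinj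
  have hcomap := comap_projection_eq_withDensity he hτ h hΓ hfin hc hn hpos htan hinj
  have hρc : Continuous fun x : Γ => ⟪n x, e⟫ :=
    (continuousOn_iff_continuous_domRestrict.1 hc).inner continuous_const
  calc ∫ s, g s = ∫ s in range (Γ.domRestrict fun x => ⟪τ, x⟫), g s := by
        refine (setIntegral_eq_integral_of_forall_compl_eq_zero fun s hs => hg0 s ?_).symm
        rintro x hx rfl
        exact hs ⟨⟨x, hx⟩, rfl⟩
    _ = ∫ x : Γ, g ⟪τ, (x : Pt)⟫ ∂((volume : Measure ℝ).comap (Γ.domRestrict fun x => ⟪τ, x⟫)) := by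
        rw [← hemb.map_comap, hemb.integral_map]
        rfl
    _ = ∫ x : Γ, G x * ⟪n x, e⟫ ∂(Measure.hausdorffMeasure 1) := by
        rw [hcomap, integral_withDensity_eq_integral_toReal_smul
          (hρc.measurable.ennreal_ofReal) (ae_of_all _ fun x => ENNReal.ofReal_lt_top)]
        refine integral_congr_ae (ae_of_all _ fun x => ?_)
        simp only [smul_eq_mul]
        rw [hgG x x.2, ENNReal.toReal_ofReal (hpos x x.2).le, mul_comm]
    _ = ∫ x in Γ, G x * ⟪n x, e⟫ ∂(Measure.hausdorffMeasure 1) := by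
        have h1 : MeasurableEmbedding ((↑) : Γ → Pt) := MeasurableEmbedding.subtype_coe hΓ
        have h2 := (isometry_subtype_coe (s := Γ)).map_hausdorffMeasure (d := 1)
          (Or.inl zero_le_one)
        rw [Subtype.range_coe] at h2
        rw [← h2, h1.integral_map]

end Projection

section Slices

variable {k k' ψ : ℝ → ℝ} {a b : ℝ} {S : Set ℝ}

theorem setIntegral_Ioo_eq_sub (hk : ∀ t, HasDerivAt k (k' t) t) (hk' : Continuous k')
    (hab : a ≤ b) : ∫ t, (Ioo a b).indicator k' t = k b - k a := by
  rw [integral_indicator measurableSet_Ioo, ← integral_Ioc_eq_integral_Ioo,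
    ← intervalIntegral.integral_of_le hab]
  exact intervalIntegral.integral_eq_sub_of_hasDerivAt (fun t _ => hk t)
    (hk'.intervalIntegrable _ _)

theorem integral_indicator_sublevel_of_zero (hk : ∀ t, HasDerivAt k (k' t) t)
    (hk' : Continuous k') (h0 : k a = 0) (h0' : ∀ t, t ∉ Ioo a b → k' t = 0)
    (hψ : StrictMonoOn ψ (Ioo a b)) (hS : ∀ t ∈ Ioo a b, t ∈ S ↔ ψ t < 0) {c : ℝ}
    (hc : c ∈ Ioo a b) (hψc : ψ c = 0) : ∫ t, S.indicator k' t = k c := by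
  rw [← sub_zero (k c), ← h0, ← setIntegral_Ioo_eq_sub hk hk' hc.1.le]
  congr 1
  funext t
  by_cases ht : t ∈ Ioo a b
  · have : t ∈ S ↔ t ∈ Ioo a c := by
      rw [hS t ht, ← hψc, hψ.lt_iff_lt ht hc]
      exact ⟨fun h => ⟨ht.1, h⟩, fun h => h.2⟩
    by_cases h : t ∈ S
    · rw [indicator_of_mem h, indicator_of_mem (this.1 h)]
    · rw [indicator_of_notMem h, indicator_of_notMem (mt this.2 h)]
  · rw [indicator_apply_eq_zero.2 fun _ => h0' t ht, indicator_apply_eq_zero.2 fun _ => h0' t ht]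

theorem integral_indicator_sublevel_of_ne_zero (hk : ∀ t, HasDerivAt k (k' t) t)
    (hk' : Continuous k') (hab : a ≤ b) (h0 : k a = 0) (h1 : k b = 0)
    (h0' : ∀ t, t ∉ Ioo a b → k' t = 0) (hψc : ContinuousOn ψ (Ioo a b))
    (hS : ∀ t ∈ Ioo a b, t ∈ S ↔ ψ t < 0)
    (hne : ∀ t ∈ Ioo a b, ψ t ≠ 0) : ∫ t, S.indicator k' t = 0 := by
  by_cases h : ∃ t ∈ Ioo a b, ψ t < 0
  · obtain ⟨t, ht, htn⟩ := h
    have hall : ∀ s ∈ Ioo a b, ψ s < 0 := by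
      intro s hs
      by_contra hc
      obtain ⟨z, hz, hz0⟩ := isPreconnected_Ioo.intermediate_value ht hs hψc
        ⟨htn.le, not_lt.1 hc⟩
      exact hne z hz hz0
    rw [← sub_zero (0 : ℝ)]
    nth_rw 1 [← h1]
    rw [← h0, ← setIntegral_Ioo_eq_sub hk hk' hab]
    congr 1
    funext s
    by_cases hs : s ∈ Ioo a b
    · rw [indicator_of_mem ((hS s hs).2 (hall s hs)), indicator_of_mem hs]
    · rw [indicator_apply_eq_zero.2 fun _ => h0' s hs, indicator_of_notMem hs]
  · push Not at h
    have : S.indicator k' = 0 := by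
      funext s
      by_cases hs : s ∈ Ioo a b
      · rw [indicator_of_notMem (mt (hS s hs).1 (not_lt.2 (h s hs)))]; rfl
      · exact indicator_apply_eq_zero.2 fun _ => h0' s hs
    simp [this]

end Slices

theorem IsOuterNormal.mem_frontier {A : Set Pt} {x n : Pt} (h : IsOuterNormal A x n) :
    x ∈ frontier A := by
  have hn : ⟪n, n⟫ = 1 := by rw [real_inner_self_eq_norm_sq, h.norm_eq_one]; norm_num
  have key : ∀ v : Pt, Tendsto (fun t : ℝ => x + t • v) (𝓝[>] 0) (𝓝 x) := fun v =>
    fun P hP => eventually_nhds_add_smul (P := (· ∈ P)) hP v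
  rw [frontier_eq_closure_inter_closure]
  refine ⟨mem_closure_of_tendsto (key (-n)) (h.eventually_mem (by rw [inner_neg_right]; linarith)),
    mem_closure_of_tendsto (key n) ?_⟩
  filter_upwards [h.eventually_notMem_closure (v := n) (by linarith)] with t ht
  exact fun h' => ht (subset_closure h')

/-- The divergence theorem for functions supported near a regular boundary point, in a direction
pointing outwards. -/
theorem IsOuterNormal.exists_nhds_integral_fderiv_eq {A : Set Pt} (hA : MeasurableSet A)
    (hfin : Measure.hausdorffMeasure 1 (frontier A) ≠ ⊤) {x₀ n₀ e : Pt}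
    (hx₀ : IsOuterNormal A x₀ n₀) (he : ‖e‖ = 1) (hne : 0 < ⟪n₀, e⟫) :
    ∃ U ∈ 𝓝 x₀, ∀ f : Pt → ℝ, ContDiff ℝ 1 f → HasCompactSupport f → tsupport f ⊆ U →
      ∫ x in A, fderiv ℝ f x e =
        ∫ x in frontier A, f x * ⟪outerNormal A x, e⟫ ∂(Measure.hausdorffMeasure 1) := by
  obtain ⟨τ, hτ, hτe⟩ := exists_orthonormal_pair he
  obtain ⟨φ, hφ, h0, hg, hAφ, rfl⟩ := hx₀
  rw [real_inner_smul_left] at hne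
  have hne' : 0 < ⟪gradient φ x₀, e⟫ := by
    by_contra hc
    exact absurd hne (not_lt.2 (mul_nonpos_of_nonneg_of_nonpos (by positivity) (not_lt.1 hc)))
  have hev : ∀ᶠ y in 𝓝 x₀, ContDiffAt ℝ 1 φ y ∧ 0 < ⟪gradient φ y, e⟫ ∧ (y ∈ A ↔ φ y < 0) ∧
      (y ∈ frontier A ↔ φ y = 0) ∧
      (y ∈ frontier A → IsOuterNormal A y (‖gradient φ y‖⁻¹ • gradient φ y)) := by
    have hc : ContinuousAt (fun y => ⟪gradient φ y, e⟫) x₀ :=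
      hφ.continuousAt_gradient.inner continuousAt_const
    filter_upwards [hφ.eventually (by simp), hc.eventually (lt_mem_nhds hne'),
      hAφ.eventually_nhds, eventually_isOuterNormal hφ hg hAφ] with y h1 h2 h3 h4
    refine ⟨h1, h2, h3.self_of_nhds, ⟨fun h => (h4 h).1, fun h => ?_⟩, fun h => (h4 h).2⟩
    refine IsOuterNormal.mem_frontier (n := ‖gradient φ y‖⁻¹ • gradient φ y)
      ⟨φ, h1, h, ?_, h3, rfl⟩
    intro hc0
    rw [hc0, inner_zero_left] at h2
    exact lt_irrefl _ h2
  obtain ⟨r, hr, hball⟩ := Metric.eventually_nhds_iff_ball.1 hev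
  set δ := r / 2 with hδ
  have hδpos : 0 < δ := by positivity
  set s₀ := ⟪τ, x₀⟫ with hs₀
  set t₀ := ⟪e, x₀⟫ with ht₀
  set U : Set Pt := {y | ⟪τ, y⟫ ∈ Ioo (s₀ - δ) (s₀ + δ) ∧ ⟪e, y⟫ ∈ Ioo (t₀ - δ) (t₀ + δ)} with hU
  have hUopen : IsOpen U :=
    (isOpen_Ioo.preimage (by fun_prop : Continuous fun y : Pt => ⟪τ, y⟫)).inter
      (isOpen_Ioo.preimage (by fun_prop : Continuous fun y : Pt => ⟪e, y⟫))
  have hUball : ∀ y ∈ U, y ∈ Metric.ball x₀ r := by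
    intro y hy
    rw [Metric.mem_ball, dist_eq_norm]
    have h1 := orthonormal_pair_expand he hτ hτe (y - x₀)
    rw [h1]
    refine (norm_add_le _ _).trans_lt ?_
    rw [norm_smul, norm_smul, he, hτ, mul_one, mul_one, inner_sub_right, inner_sub_right,
      Real.norm_eq_abs, Real.norm_eq_abs]
    have h2 : |⟪τ, y⟫ - s₀| < δ := abs_lt.2 ⟨by linarith [hy.1.1], by linarith [hy.1.2]⟩
    have h3 : |⟪e, y⟫ - t₀| < δ := abs_lt.2 ⟨by linarith [hy.2.1], by linarith [hy.2.2]⟩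
    rw [hδ] at h2 h3
    linarith
  have hUW := fun y hy => hball y (hUball y hy)
  have hmem : ∀ s t : ℝ, s • τ + t • e ∈ U ↔ s ∈ Ioo (s₀ - δ) (s₀ + δ) ∧
      t ∈ Ioo (t₀ - δ) (t₀ + δ) := by
    intro s t
    rw [hU, mem_ofPred_eq, inner_left_pair hτ hτe, inner_right_pair he hτe]
  have hline : ∀ s t : ℝ, HasDerivAt (fun t : ℝ => s • τ + t • e) e t := fun s t => by
    simpa using ((hasDerivAt_id t).smul_const e).const_add (s • τ)
  have hψder : ∀ s t : ℝ, s • τ + t • e ∈ U → HasDerivAt (fun t : ℝ => φ (s • τ + t • e))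
      ⟪gradient φ (s • τ + t • e), e⟫ t := fun s t hst => by
    have h1 := (hUW _ hst).1.hasFDerivAt_gradient.comp_hasDerivAt t (hline s t)
    rwa [innerSL_apply_apply] at h1
  have hψcont : ∀ s ∈ Ioo (s₀ - δ) (s₀ + δ),
      ContinuousOn (fun t : ℝ => φ (s • τ + t • e)) (Ioo (t₀ - δ) (t₀ + δ)) := fun s hs t ht =>
    (hψder s t ((hmem s t).2 ⟨hs, ht⟩)).continuousAt.continuousWithinAt
  have hψmono : ∀ s ∈ Ioo (s₀ - δ) (s₀ + δ),
      StrictMonoOn (fun t : ℝ => φ (s • τ + t • e)) (Ioo (t₀ - δ) (t₀ + δ)) := fun s hs => by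
    refine strictMonoOn_of_deriv_pos (convex_Ioo _ _) (hψcont s hs) fun t ht => ?_
    rw [interior_Ioo] at ht
    have hst := (hmem s t).2 ⟨hs, ht⟩
    rw [(hψder s t hst).deriv]
    exact (hUW _ hst).2.1
  refine ⟨U, hUopen.mem_nhds ⟨⟨by linarith, by linarith⟩, ⟨by linarith, by linarith⟩⟩,
    fun f hf hfc hfU => ?_⟩
  set Γ := frontier A ∩ U with hΓ
  have hf0 : ∀ y, y ∉ U → f y = 0 := fun y hy =>
    image_eq_zero_of_notMem_tsupport fun h => hy (hfU h)
  have hf0' : ∀ y, y ∉ U → fderiv ℝ f y = 0 := fun y hy =>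
    image_eq_zero_of_notMem_tsupport fun h => hy (hfU (tsupport_fderiv_subset ℝ h))
  have hfder : Continuous fun x => fderiv ℝ f x e :=
    (hf.continuous_fderiv one_ne_zero).clm_apply continuous_const
  have hint : Integrable (A.indicator fun x => fderiv ℝ f x e) := by
    refine (hfder.integrable_of_hasCompactSupport ?_).indicator hA
    exact (hfc.fderiv ℝ).comp_left (g := fun L : Pt →L[ℝ] ℝ => L e) (by simp)
  have hnU : ∀ x ∈ Γ, outerNormal A x = ‖gradient φ x‖⁻¹ • gradient φ x := fun x hx =>
    ((hUW x hx.2).2.2.2.2 hx.1).outerNormal_eq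
  have hgne : ∀ x ∈ U, 0 < ‖gradient φ x‖ := fun x hx => by
    refine norm_pos_iff.2 fun hc0 => ?_
    have h2 := (hUW x hx).2.1
    rw [hc0, inner_zero_left] at h2
    exact lt_irrefl _ h2
  rw [← integral_indicator hA, integral_eq_integral_pair he hτ hτe hint]
  have hkd : ∀ s t : ℝ, HasDerivAt (fun t => f (s • τ + t • e)) (fderiv ℝ f (s • τ + t • e) e) t :=
    fun s t => (hf.differentiable one_ne_zero _).hasFDerivAt.comp_hasDerivAt t (hline s t)
  have hslice : ∀ s t : ℝ, A.indicator (fun x => fderiv ℝ f x e) (s • τ + t • e) =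
      {t : ℝ | s • τ + t • e ∈ A}.indicator (fun t => fderiv ℝ f (s • τ + t • e) e) t :=
    fun s t => rfl
  simp only [hslice]
  have hkc : ∀ s : ℝ, Continuous fun t : ℝ => fderiv ℝ f (s • τ + t • e) e := fun s =>
    hfder.comp (by fun_prop)
  have hend : ∀ s t, t ∉ Ioo (t₀ - δ) (t₀ + δ) → s • τ + t • e ∉ U := fun s t ht h =>
    ht ((hmem s t).1 h).2
  refine (integral_projection he hτ hτe (Γ := Γ) (n := outerNormal A) (G := f)
    ?_ ?_ ?_ ?_ ?_ ?_ ?_ ?_ ?_).trans ?_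
  rotate_right
  · rw [hΓ, ← setIntegral_indicator hUopen.measurableSet]
    congr 1
    funext x
    by_cases hx : x ∈ U
    · rw [indicator_of_mem hx]
    · rw [indicator_of_notMem hx, hf0 x hx, zero_mul]
  · exact isClosed_frontier.measurableSet.inter hUopen.measurableSet
  · exact ne_top_of_le_ne_top hfin (measure_mono inter_subset_left)
  · exact fun x hx => ((hUW x hx.2).2.2.2.2 hx.1).continuousWithinAt.mono inter_subset_left
  · intro x hx
    rw [hnU x hx, norm_smul, norm_inv, norm_norm, inv_mul_cancel₀ (hgne x hx.2).ne']
  · intro x hx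
    rw [hnU x hx, real_inner_smul_left]
    exact mul_pos (inv_pos.2 (hgne x hx.2)) (hUW x hx.2).2.1
  · intro x hx ε hε
    have hs : HasStrictFDerivAt φ (innerSL ℝ (gradient φ x)) x := by
      have := (hUW x hx.2).1.hasStrictFDerivAt one_ne_zero
      rwa [(hUW x hx.2).1.hasFDerivAt_gradient.fderiv] at this
    have hlo := hs.isLittleO.def (mul_pos hε (hgne x hx.2))
    rw [nhds_prod_eq] at hlo
    obtain ⟨V, hV, hVV⟩ := mem_prod_self_iff.1 hlo
    refine ⟨V, hV, fun a ha b hb => ?_⟩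
    have h1 : ‖φ a - φ b - innerSL ℝ (gradient φ x) (a - b)‖ ≤ ε * ‖gradient φ x‖ * ‖a - b‖ :=
      hVV (mk_mem_prod ha.1 hb.1)
    rw [((hUW a ha.2.2).2.2.2.1).1 ha.2.1, ((hUW b hb.2.2).2.2.2.1).1 hb.2.1,
      innerSL_apply_apply, sub_zero, zero_sub, norm_neg, Real.norm_eq_abs] at h1
    rw [hnU x hx, real_inner_smul_left, abs_mul, abs_of_pos (inv_pos.2 (hgne x hx.2)),
      inv_mul_le_iff₀ (hgne x hx.2)]
    linarith
  · intro a ha b hb hab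
    have ea := orthonormal_pair_expand he hτ hτe a
    have eb := orthonormal_pair_expand he hτ hτe b
    simp only at hab
    rw [← hab] at eb
    have hφa := ((hUW a ha.2).2.2.2.1).1 ha.1
    have hφb := ((hUW b hb.2).2.2.2.1).1 hb.1
    rw [ea] at hφa
    rw [eb] at hφb
    have := (hψmono _ ha.2.1).injOn ha.2.2 hb.2.2 (hφa.trans hφb.symm)
    rw [ea, eb, this]
  · intro x hx
    have ex := orthonormal_pair_expand he hτ hτe x
    have hφx := ((hUW x hx.2).2.2.2.1).1 hx.1
    have := integral_indicator_sublevel_of_zero (c := ⟪e, x⟫) (hkd ⟪τ, x⟫) (hkc _)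
      (hf0 _ (hend ⟪τ, x⟫ (t₀ - δ) (by simp)))
      (fun t ht => by rw [hf0' _ (hend _ t ht)]; rfl)
      (hψmono _ hx.2.1) (S := {t : ℝ | ⟪τ, x⟫ • τ + t • e ∈ A})
      (fun t ht => (hUW _ ((hmem _ t).2 ⟨hx.2.1, ht⟩)).2.2.1) hx.2.2 (by rw [← ex]; exact hφx)
    rw [this, ← ex]
  · intro s hs
    by_cases hsI : s ∈ Ioo (s₀ - δ) (s₀ + δ)
    · refine integral_indicator_sublevel_of_ne_zero (hkd s) (hkc s) (by linarith)
        (hf0 _ (hend s (t₀ - δ) (by simp))) (hf0 _ (hend s (t₀ + δ) (by simp)))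
        (fun t ht => by rw [hf0' _ (hend s t ht)]; rfl) (hψcont s hsI)
        (fun t ht => (hUW _ ((hmem s t).2 ⟨hsI, ht⟩)).2.2.1) fun t ht h => ?_
      have hst := (hmem s t).2 ⟨hsI, ht⟩
      exact hs _ ⟨((hUW _ hst).2.2.2.1).2 h, hst⟩ (inner_left_pair hτ hτe s t)
    · have : ∀ t : ℝ, fderiv ℝ f (s • τ + t • e) e = 0 := fun t => by
        rw [hf0' _ fun h => hsI ((hmem s t).1 h).1]; rfl
      simp [this]

section Cutoff

/-- A compact set of length zero is covered by finitely many balls with small total radius. -/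
theorem exists_finite_cover_balls {X : Type*} [MetricSpace X] [Nonempty X] [MeasurableSpace X]
    [BorelSpace X] {N : Set X} (hN : IsCompact N) (h0 : Measure.hausdorffMeasure 1 N = 0) {ε : ℝ} (hε : 0 < ε) :
    ∃ (s : Finset ℕ) (x : ℕ → X) (r : ℕ → ℝ), (∀ i ∈ s, x i ∈ N) ∧ (∀ i ∈ s, 0 < r i) ∧
      N ⊆ ⋃ i ∈ s, Metric.ball (x i) (r i) ∧ ∑ i ∈ s, r i < ε := by
  rcases N.eq_empty_or_nonempty with rfl | ⟨p, hp⟩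
  · exact ⟨∅, fun _ => Classical.arbitrary X, fun _ => 0, by simp, by simp, by simp, by simpa⟩
  rw [Measure.hausdorffMeasure_apply] at h0
  have h1 := le_of_eq h0
  rw [iSup₂_le_iff] at h1
  have h2 := h1 1 one_pos
  have h3 : (0 : ℝ≥0∞) < ENNReal.ofReal (ε / 2) := ENNReal.ofReal_pos.2 (by positivity)
  have h4 := lt_of_le_of_lt h2 h3
  simp only [iInf_lt_iff, ENNReal.rpow_one] at h4
  obtain ⟨t, htN, htd, hts⟩ := h4
  have hdle : ∀ n, Metric.ediam (t n) ≤ ⨆ _ : (t n).Nonempty, Metric.ediam (t n) := by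
    intro n
    rcases (t n).eq_empty_or_nonempty with h | h
    · simp [h]
    · exact le_iSup (fun _ : (t n).Nonempty => Metric.ediam (t n)) h
  have hfin : ∀ n, Metric.ediam (t n) ≠ ⊤ := fun n => ne_top_of_le_ne_top ENNReal.one_ne_top (htd n)
  have hex : ∀ n, ∃ x ∈ N, (t n ∩ N).Nonempty → x ∈ t n := by
    intro n
    by_cases h : (t n ∩ N).Nonempty
    · obtain ⟨y, hy⟩ := h
      exact ⟨y, hy.2, fun _ => hy.1⟩
    · exact ⟨p, hp, fun h' => absurd h' h⟩
  choose x hxN hxt using hex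
  set r : ℕ → ℝ := fun n => Metric.diam (t n) + ε / 2 / 2 / 2 ^ n with hr
  have hrpos : ∀ n, 0 < r n := fun n => add_pos_of_nonneg_of_pos Metric.diam_nonneg (by positivity)
  have hcov : N ⊆ ⋃ i, Metric.ball (x i) (r i) := by
    intro y hy
    obtain ⟨n, hn⟩ := mem_iUnion.1 (htN hy)
    refine mem_iUnion.2 ⟨n, Metric.mem_ball.2 ?_⟩
    refine (Metric.dist_le_diam_of_mem' (hfin n) hn (hxt n ⟨y, hn, hy⟩)).trans_lt ?_
    exact lt_add_of_pos_right _ (by positivity)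
  obtain ⟨s, hs⟩ := hN.elim_finite_subcover _ (fun i => Metric.isOpen_ball) hcov
  refine ⟨s, x, r, fun i _ => hxN i, fun i _ => hrpos i, hs, ?_⟩
  rw [hr, Finset.sum_add_distrib]
  have h5 : ∑ i ∈ s, Metric.diam (t i) < ε / 2 := by
    simp only [Metric.diam]
    rw [← ENNReal.toReal_sum fun i _ => hfin i]
    refine ENNReal.toReal_lt_of_lt_ofReal (lt_of_le_of_lt ?_ hts)
    exact (Finset.sum_le_sum fun i _ => hdle i).trans (ENNReal.sum_le_tsum s)
  have h6 : ∑ i ∈ s, ε / 2 / 2 / 2 ^ i ≤ ε / 2 :=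
    (summable_geometric_two' (ε / 2)).sum_le_tsum s (fun i _ => by positivity) |>.trans
      (tsum_geometric_two' (ε / 2)).le
  linarith

/-- A smooth cut-off function for the ball of radius `r` around `c`, with values in `[0, 1]`, and
the integrals of the function and of its gradient scale as in the plane. -/
theorem exists_scaled_bump : ∃ C : ℝ, 0 ≤ C ∧ ∀ (c : Pt) (r : ℝ), 0 < r → ∃ χ : Pt → ℝ,
    ContDiff ℝ 1 χ ∧ (∀ x, 0 ≤ χ x ∧ χ x ≤ 1) ∧ (∀ x ∈ Metric.ball c r, χ x = 1) ∧
    (∀ x, x ∉ Metric.ball c (2 * r) → χ x = 0) ∧ HasCompactSupport χ ∧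
    ∫ x, χ x ≤ C * r ^ 2 ∧ ∫ x, ‖fderiv ℝ χ x‖ ≤ C * r := by
  let b : ContDiffBump (0 : Pt) := ⟨1, 2, one_pos, one_lt_two⟩
  set C := max (∫ x, b x) (∫ x, ‖fderiv ℝ b x‖) with hC
  have hC0 : 0 ≤ C := le_max_of_le_right (integral_nonneg fun x => norm_nonneg _)
  refine ⟨C, hC0, fun c r hr => ⟨fun x => b (r⁻¹ • (x - c)), ?_, fun x => ⟨b.nonneg, b.le_one⟩,
    ?_, ?_, ?_, ?_, ?_⟩⟩
  · exact (b.contDiff (n := 1)).comp (by fun_prop)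
  · intro x hx
    apply b.one_of_mem_closedBall
    rw [mem_closedBall_zero_iff, norm_smul, norm_inv, Real.norm_of_nonneg hr.le,
      inv_mul_le_iff₀ hr, ← dist_eq_norm]
    exact (Metric.mem_ball.1 hx).le.trans (by simp [b])
  · intro x hx
    apply b.zero_of_le_dist
    rw [dist_zero_right, norm_smul, norm_inv, Real.norm_of_nonneg hr.le,
      le_inv_mul_iff₀ hr, ← dist_eq_norm, mul_comm]
    exact not_lt.1 fun h => hx (Metric.mem_ball.2 h)
  · refine HasCompactSupport.of_support_subset_isCompact (isCompact_closedBall c (2 * r)) ?_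
    intro x hx
    by_contra hx'
    refine hx (b.zero_of_le_dist ?_)
    rw [dist_zero_right, norm_smul, norm_inv, Real.norm_of_nonneg hr.le,
      le_inv_mul_iff₀ hr, ← dist_eq_norm, mul_comm]
    exact (not_le.1 fun h => hx' (Metric.mem_closedBall.2 h)).le
  · rw [integral_sub_right_eq_self (fun x => b (r⁻¹ • x)) c,
      Measure.integral_comp_inv_smul_of_nonneg _ _ hr.le]
    simp only [finrank_euclideanSpace, Fintype.card_fin, smul_eq_mul]
    rw [mul_comm]
    exact mul_le_mul_of_nonneg_right (le_max_left _ _) (by positivity)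
  · have hd : ∀ x, ‖fderiv ℝ (fun x => b (r⁻¹ • (x - c))) x‖ =
        r⁻¹ * ‖fderiv ℝ b (r⁻¹ • (x - c))‖ := by
      intro x
      have h1 : HasFDerivAt (fun x : Pt => r⁻¹ • (x - c)) (r⁻¹ • ContinuousLinearMap.id ℝ Pt) x :=
        ((hasFDerivAt_id x).sub_const c).const_smul r⁻¹
      have h2 := (((b.contDiff (n := 1)).differentiable one_ne_zero
        (r⁻¹ • (x - c))).hasFDerivAt).comp x h1
      change ‖fderiv ℝ (b ∘ fun x => r⁻¹ • (x - c)) x‖ = _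
      rw [h2.fderiv, ContinuousLinearMap.comp_smul, ContinuousLinearMap.comp_id, norm_smul,
        norm_inv, Real.norm_of_nonneg hr.le]
    simp only [hd]
    rw [integral_const_mul, integral_sub_right_eq_self (fun x => ‖fderiv ℝ b (r⁻¹ • x)‖) c,
      Measure.integral_comp_inv_smul_of_nonneg _ (fun x => ‖fderiv ℝ b x‖) hr.le]
    simp only [finrank_euclideanSpace, Fintype.card_fin, smul_eq_mul]
    have : r⁻¹ * (r ^ 2 * ∫ x, ‖fderiv ℝ b x‖) = (∫ x, ‖fderiv ℝ b x‖) * r := by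
      field_simp
    rw [this]
    exact mul_le_mul_of_nonneg_right (le_max_right _ _) hr.le

/-- A compact set of length zero can be cut off by smooth functions with small gradient in `L¹`. -/
theorem exists_cutoff_of_hausdorffMeasure_one_eq_zero {N : Set Pt} (hN : IsCompact N)
    (h0 : Measure.hausdorffMeasure 1 N = 0) {ε : ℝ} (hε : 0 < ε) :
    ∃ (g : Pt → ℝ) (W : Set Pt), ContDiff ℝ 1 g ∧ (∀ x, 0 ≤ g x ∧ g x ≤ 1) ∧ IsOpen W ∧ N ⊆ W ∧
      (∀ x ∈ W, g x = 0) ∧ (∀ x, x ∉ Metric.cthickening ε N → g x = 1) ∧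
      HasCompactSupport (fun x => 1 - g x) ∧
      ∫ x, (1 - g x) ≤ ε ∧ ∫ x, ‖fderiv ℝ g x‖ ≤ ε := by
  obtain ⟨C, hC, hbump⟩ := exists_scaled_bump
  set ε' := min (min 1 (ε / 2)) (ε / (C + 1)) with hε'
  have hε'pos : 0 < ε' := by positivity
  obtain ⟨s, x, r, hx, hr, hcov, hsum⟩ := exists_finite_cover_balls hN h0 hε'pos
  have hrε : ∀ i ∈ s, r i ≤ ε' := fun i hi =>
    (Finset.single_le_sum (fun j hj => (hr j hj).le) hi).trans hsum.le
  have key : ∀ s' : Finset ℕ, s' ⊆ s → ∃ g : Pt → ℝ, ContDiff ℝ 1 g ∧ (∀ x, 0 ≤ g x ∧ g x ≤ 1) ∧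
      (∀ y ∈ ⋃ i ∈ s', Metric.ball (x i) (r i), g y = 0) ∧
      (∀ y, y ∉ Metric.cthickening ε N → g y = 1) ∧
      HasCompactSupport (fun x => 1 - g x) ∧
      ∫ x, (1 - g x) ≤ C * ∑ i ∈ s', r i ∧ ∫ x, ‖fderiv ℝ g x‖ ≤ C * ∑ i ∈ s', r i := by
    intro s'
    induction s' using Finset.induction_on with
    | empty =>
      intro _
      refine ⟨fun _ => 1, contDiff_const, fun _ => by simp, by simp, by simp, ?_, by simp, by simp⟩
      simp only [sub_self]
      exact HasCompactSupport.zero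
    | insert i s' his ih =>
      intro hss
      obtain ⟨g, hg1, hg2, hg3, hg4, hg5, hg6, hg7⟩ :=
        ih ((Finset.subset_insert i s').trans hss)
      have his' : i ∈ s := hss (Finset.mem_insert_self i s')
      have hri := hr i his'
      obtain ⟨χ, h1, h2, h3, h4, h5, h6, h7⟩ := hbump (x i) (r i) hri
      have hgi : Integrable fun x => 1 - g x :=
        (continuous_const.sub hg1.continuous).integrable_of_hasCompactSupport hg5
      have hχi : Integrable χ := h1.continuous.integrable_of_hasCompactSupport h5
      have hfd : ∀ y, fderiv ℝ (fun x => 1 - g x) y = -fderiv ℝ g y := fun y => by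
        rw [fderiv_const_sub]
      have hgi' : Integrable fun x => ‖fderiv ℝ g x‖ := by
        have := ((contDiff_const (c := (1 : ℝ))).sub hg1).continuous_fderiv one_ne_zero
          |>.integrable_of_hasCompactSupport (μ := volume) (hg5.fderiv ℝ)
        refine this.norm.congr (ae_of_all _ fun y => ?_)
        simp only
        rw [hfd, norm_neg]
      have hχi' : Integrable fun x => ‖fderiv ℝ χ x‖ :=
        ((h1.continuous_fderiv one_ne_zero).integrable_of_hasCompactSupport (h5.fderiv ℝ)).norm
      have hdiff : ∀ y, fderiv ℝ (fun y => g y * (1 - χ y)) y =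
          g y • (-fderiv ℝ χ y) + (1 - χ y) • fderiv ℝ g y := by
        intro y
        rw [fderiv_fun_mul (hg1.differentiable one_ne_zero y)
          ((h1.differentiable one_ne_zero y).const_sub 1), fderiv_const_sub]
      refine ⟨fun y => g y * (1 - χ y), hg1.mul (contDiff_const.sub h1), fun y => ⟨?_, ?_⟩, ?_,
        ?_, ?_, ?_, ?_⟩
      · exact mul_nonneg (hg2 y).1 (by linarith [(h2 y).2])
      · exact mul_le_one₀ (hg2 y).2 (by linarith [(h2 y).2]) (by linarith [(h2 y).1])
      · intro y hy
        rw [Finset.set_biUnion_insert] at hy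
        rcases hy with hy | hy
        · simp only
          rw [h3 y hy, sub_self, mul_zero]
        · simp only
          rw [hg3 y hy, zero_mul]
      · intro y hy
        simp only
        rw [hg4 y hy, h4 y, sub_zero, mul_one]
        intro hyb
        refine hy (Metric.mem_cthickening_of_dist_le y (x i) ε N (hx i his') ?_)
        have h8 := Metric.mem_ball.1 hyb
        have h9 : ε' ≤ ε / 2 := (min_le_left _ _).trans (min_le_right _ _)
        linarith [hrε i his']
      · have : (fun y => 1 - g y * (1 - χ y)) = (fun y => 1 - g y) + fun y => χ y * g y := by
          funext y
          simp only [Pi.add_apply]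
          ring
        rw [this]
        exact hg5.add h5.mul_right
      · rw [Finset.sum_insert his, mul_add, add_comm]
        calc ∫ y, (1 - g y * (1 - χ y)) ≤ ∫ y, ((1 - g y) + χ y) := by
              refine integral_mono_of_nonneg (ae_of_all _ fun y => ?_) (hgi.add hχi)
                (ae_of_all _ fun y => ?_)
              · change 0 ≤ 1 - g y * (1 - χ y)
                nlinarith [hg2 y, h2 y, mul_nonneg (hg2 y).1 (h2 y).1]
              · change 1 - g y * (1 - χ y) ≤ 1 - g y + χ y
                nlinarith [hg2 y, h2 y, mul_nonneg (sub_nonneg.2 (hg2 y).2) (h2 y).1]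
          _ = (∫ y, (1 - g y)) + ∫ y, χ y := integral_add hgi hχi
          _ ≤ C * ∑ i ∈ s', r i + C * r i := by
              refine add_le_add hg6 (h6.trans ?_)
              have : r i ≤ 1 := (hrε i his').trans ((min_le_left _ _).trans (min_le_left _ _))
              exact mul_le_mul_of_nonneg_left (by nlinarith) hC
      · rw [Finset.sum_insert his, mul_add, add_comm]
        calc ∫ y, ‖fderiv ℝ (fun y => g y * (1 - χ y)) y‖
            ≤ ∫ y, (‖fderiv ℝ g y‖ + ‖fderiv ℝ χ y‖) := by
              refine integral_mono_of_nonneg (ae_of_all _ fun y => norm_nonneg _) (hgi'.add hχi')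
                (ae_of_all _ fun y => ?_)
              simp only
              rw [hdiff, add_comm]
              refine (norm_add_le _ _).trans (add_le_add ?_ ?_)
              · rw [norm_smul, Real.norm_of_nonneg (by linarith [(h2 y).2])]
                exact mul_le_of_le_one_left (norm_nonneg _) (by linarith [(h2 y).1])
              · rw [norm_smul, norm_neg, Real.norm_of_nonneg (hg2 y).1]
                exact mul_le_of_le_one_left (norm_nonneg _) (hg2 y).2
          _ = (∫ y, ‖fderiv ℝ g y‖) + ∫ y, ‖fderiv ℝ χ y‖ := integral_add hgi' hχi'
          _ ≤ C * ∑ i ∈ s', r i + C * r i := add_le_add hg7 h7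
  obtain ⟨g, hg1, hg2, hg3, hg4, hg5, hg6, hg7⟩ := key s Finset.Subset.rfl
  have hCs : C * ∑ i ∈ s, r i ≤ ε := by
    have h1 : ∑ i ∈ s, r i ≤ ε / (C + 1) := hsum.le.trans (min_le_right _ _)
    have h2 : ε / (C + 1) * (C + 1) = ε := div_mul_cancel₀ _ (by positivity)
    have h3 : 0 ≤ ∑ i ∈ s, r i := Finset.sum_nonneg fun i hi => (hr i hi).le
    nlinarith
  exact ⟨g, _, hg1, hg2, isOpen_biUnion fun i _ => Metric.isOpen_ball, hcov, hg3, hg4, hg5,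
    hg6.trans hCs, hg7.trans hCs⟩

end Cutoff

section BoundaryMeasure

variable {A : Set Pt}

/-- The arc length measure on the boundary of `A`. -/
noncomputable abbrev boundaryMeasure (A : Set Pt) : Measure Pt :=
  (Measure.hausdorffMeasure 1 : Measure Pt).restrict (frontier A)

theorem HasPiecewiseC1Boundary.isFiniteMeasure (h : HasPiecewiseC1Boundary A) :
    IsFiniteMeasure (boundaryMeasure A) :=
  ⟨by rw [Measure.restrict_apply_univ]; exact h.1⟩

theorem HasPiecewiseC1Boundary.aestronglyMeasurable_outerNormal (h : HasPiecewiseC1Boundary A) :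
    AEStronglyMeasurable (outerNormal A) (boundaryMeasure A) := by
  obtain ⟨U, hU, hUA⟩ := frontier_regular_isOpen A
  have h1 : ContinuousOn (outerNormal A) (frontier A ∩ U) := fun x hx => by
    obtain ⟨n, hn⟩ := (hUA x hx.1).1 hx.2
    exact hn.continuousWithinAt.mono inter_subset_left
  have h2 : boundaryMeasure A =
      (Measure.hausdorffMeasure 1 : Measure Pt).restrict (frontier A ∩ U) := by
    rw [inter_comm, ← Measure.restrict_restrict hU.measurableSet]
    refine (Measure.restrict_eq_self_of_ae_mem ?_).symm
    filter_upwards [h.2, ae_restrict_mem isClosed_frontier.measurableSet] with x hx hxf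
    exact (hUA x hxf).2 hx
  rw [h2]
  exact h1.aestronglyMeasurable (isClosed_frontier.measurableSet.inter hU.measurableSet)

/-- Continuous functions of position and normal are integrable along the boundary. -/
theorem HasPiecewiseC1Boundary.integrable_continuous_normal (h : HasPiecewiseC1Boundary A)
    (hb : Bornology.IsBounded A) {G : Pt × Pt → ℝ} (hG : Continuous G) :
    Integrable (fun x => G (x, outerNormal A x)) (boundaryMeasure A) := by
  have := h.isFiniteMeasure
  have hK : IsCompact (closure A ×ˢ Metric.closedBall (0 : Pt) 1) :=
    hb.isCompact_closure.prod (isCompact_closedBall _ _)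
  obtain ⟨C, hC⟩ := hK.exists_bound_of_continuousOn hG.continuousOn
  refine Integrable.of_bound (hG.comp_aestronglyMeasurable
    (aestronglyMeasurable_id.prodMk h.aestronglyMeasurable_outerNormal)) C ?_
  filter_upwards [ae_restrict_mem isClosed_frontier.measurableSet] with x hx
  exact hC _ ⟨frontier_subset_closure hx, mem_closedBall_zero_iff.2 (norm_outerNormal_le_one A x)⟩

end BoundaryMeasure

section Gauss

variable {A : Set Pt} {f g : Pt → ℝ}

/-- The defect in the divergence theorem for the vector field `f e`. -/
noncomputable def gaussDefect (A : Set Pt) (f : Pt → ℝ) (e : Pt) : ℝ :=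
  (∫ x in A, fderiv ℝ f x e) - ∫ x, f x * ⟪outerNormal A x, e⟫ ∂boundaryMeasure A

theorem integrableOn_of_isBounded (hb : Bornology.IsBounded A) (hf : Continuous f) :
    IntegrableOn f A :=
  (hf.continuousOn.integrableOn_compact hb.isCompact_closure).mono_set subset_closure

theorem continuous_fderiv_apply (hf : ContDiff ℝ 1 f) (e : Pt) :
    Continuous fun x => fderiv ℝ f x e :=
  (hf.continuous_fderiv one_ne_zero).clm_apply continuous_const

theorem integrable_mul_inner_outerNormal (hA : HasPiecewiseC1Boundary A)
    (hb : Bornology.IsBounded A) (hf : Continuous f) (e : Pt) :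
    Integrable (fun x => f x * ⟪outerNormal A x, e⟫) (boundaryMeasure A) :=
  hA.integrable_continuous_normal hb (G := fun z => f z.1 * ⟪z.2, e⟫) (by fun_prop)

theorem gaussDefect_add_smul (hA : HasPiecewiseC1Boundary A) (hb : Bornology.IsBounded A)
    (hf : ContDiff ℝ 1 f) (a b : ℝ) (v w : Pt) :
    gaussDefect A f (a • v + b • w) = a * gaussDefect A f v + b * gaussDefect A f w := by
  have hi := fun e => integrableOn_of_isBounded hb (continuous_fderiv_apply hf e)
  have hi' := integrable_mul_inner_outerNormal hA hb hf.continuous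
  have h1 : ∫ x in A, fderiv ℝ f x (a • v + b • w) =
      a * (∫ x in A, fderiv ℝ f x v) + b * ∫ x in A, fderiv ℝ f x w := by
    rw [← integral_const_mul, ← integral_const_mul,
      ← integral_add ((hi v).const_mul a) ((hi w).const_mul b)]
    simp
  have h2 : ∫ x, f x * ⟪outerNormal A x, a • v + b • w⟫ ∂boundaryMeasure A =
      a * (∫ x, f x * ⟪outerNormal A x, v⟫ ∂boundaryMeasure A) +
        b * ∫ x, f x * ⟪outerNormal A x, w⟫ ∂boundaryMeasure A := by
    rw [← integral_const_mul, ← integral_const_mul,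
      ← integral_add ((hi' v).const_mul a) ((hi' w).const_mul b)]
    congr 1
    funext x
    rw [inner_add_right, real_inner_smul_right, real_inner_smul_right]
    ring
  rw [gaussDefect, h1, h2, gaussDefect, gaussDefect]
  ring

theorem gaussDefect_sum (hA : HasPiecewiseC1Boundary A) (hb : Bornology.IsBounded A)
    {ι : Type*} (s : Finset ι) {F : ι → Pt → ℝ} (hF : ∀ i ∈ s, ContDiff ℝ 1 (F i)) (e : Pt) :
    gaussDefect A (fun x => ∑ i ∈ s, F i x) e = ∑ i ∈ s, gaussDefect A (F i) e := by
  simp only [gaussDefect]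
  rw [Finset.sum_sub_distrib,
    ← integral_finsetSum _ fun i hi =>
      integrableOn_of_isBounded hb (continuous_fderiv_apply (hF i hi) e),
    ← integral_finsetSum _ fun i hi =>
      integrable_mul_inner_outerNormal hA hb (hF i hi).continuous e]
  congr 2
  · funext x
    rw [fderiv_fun_sum fun i hi => (hF i hi).differentiable one_ne_zero x,
      sum_apply]
  · funext x
    rw [Finset.sum_mul]

theorem gaussDefect_congr (hA : IsOpen A) (h : EqOn f g (closure A)) (e : Pt) :
    gaussDefect A f e = gaussDefect A g e := by
  unfold gaussDefect
  congr 1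
  · refine setIntegral_congr_fun hA.measurableSet fun x hx => ?_
    have : f =ᶠ[𝓝 x] g := by
      filter_upwards [hA.mem_nhds hx] with y hy
      exact h (subset_closure hy)
    rw [this.fderiv_eq]
  · refine setIntegral_congr_fun isClosed_frontier.measurableSet fun x hx => ?_
    rw [h (frontier_subset_closure hx)]

/-- The divergence theorem holds near a regular boundary point. -/
theorem exists_nhds_gaussDefect_eq_zero_of_isOuterNormal (hA : HasPiecewiseC1Boundary A)
    (hAo : IsOpen A) (hb : Bornology.IsBounded A) {x₀ n : Pt} (hx : IsOuterNormal A x₀ n) :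
    ∃ U ∈ 𝓝 x₀, ∀ f : Pt → ℝ, ContDiff ℝ 1 f → HasCompactSupport f → tsupport f ⊆ U →
      ∀ e, gaussDefect A f e = 0 := by
  obtain ⟨τ, hτ, hτn⟩ := exists_orthonormal_pair hx.norm_eq_one
  have hn := hx.norm_eq_one
  have hnn : ⟪n, n⟫ = 1 := by rw [real_inner_self_eq_norm_sq, hn]; norm_num
  have hττ : ⟪τ, τ⟫ = 1 := by rw [real_inner_self_eq_norm_sq, hτ]; norm_num
  have hnτ : ⟪n, τ⟫ = 0 := by rw [real_inner_comm]; exact hτn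
  set e' : Pt := (3 / 5 : ℝ) • n + (4 / 5 : ℝ) • τ with he'
  have hne' : ⟪n, e'⟫ = 3 / 5 := by
    rw [he', inner_add_right, real_inner_smul_right, real_inner_smul_right, hnn, hnτ]; norm_num
  have hτe' : ⟪τ, e'⟫ = 4 / 5 := by
    rw [he', inner_add_right, real_inner_smul_right, real_inner_smul_right, hττ, hτn]; norm_num
  have he'1 : ‖e'‖ = 1 := by
    have : ‖e'‖ ^ 2 = 1 ^ 2 := by
      rw [← real_inner_self_eq_norm_sq, inner_eq_of_orthonormal_pair hn hτ hτn, hne', hτe']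
      norm_num
    exact (pow_left_inj₀ (norm_nonneg _) zero_le_one two_ne_zero).1 this
  obtain ⟨U₁, hU₁, h₁⟩ := hx.exists_nhds_integral_fderiv_eq hAo.measurableSet hA.1.ne hn
    (by rw [hnn]; norm_num)
  obtain ⟨U₂, hU₂, h₂⟩ := hx.exists_nhds_integral_fderiv_eq hAo.measurableSet hA.1.ne he'1
    (by rw [hne']; norm_num)
  refine ⟨U₁ ∩ U₂, inter_mem hU₁ hU₂, fun f hf hfc hfU e => ?_⟩
  have d₁ : gaussDefect A f n = 0 :=
    sub_eq_zero.2 (h₁ f hf hfc (hfU.trans inter_subset_left))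
  have d₂ : gaussDefect A f e' = 0 :=
    sub_eq_zero.2 (h₂ f hf hfc (hfU.trans inter_subset_right))
  have he : e = (⟪n, e⟫ - 3 / 4 * ⟪τ, e⟫) • n + (5 / 4 * ⟪τ, e⟫) • e' := by
    conv_lhs => rw [orthonormal_pair_expand hn hτ hτn e]
    rw [he']
    module
  rw [he, gaussDefect_add_smul hA hb hf, d₁, d₂, mul_zero, mul_zero, add_zero]

theorem integral_fderiv_apply_eq_zero (hf : ContDiff ℝ 1 f) (hfc : HasCompactSupport f) (e : Pt) :
    ∫ x, fderiv ℝ f x e = 0 := by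
  have h1 : Integrable fun x => fderiv ℝ f x e :=
    (continuous_fderiv_apply hf e).integrable_of_hasCompactSupport
      ((hfc.fderiv ℝ).comp_left (g := fun L : Pt →L[ℝ] ℝ => L e) (by simp))
  have h2 := integral_mul_fderiv_eq_neg_fderiv_mul_of_integrable (μ := (volume : Measure Pt))
    (f := fun _ : Pt => (1 : ℝ)) (g := f) (v := e) (by simp) (by simpa using h1)
    (by simpa using hf.continuous.integrable_of_hasCompactSupport hfc)
    (fun x _ => differentiableAt_const _) (fun x _ => hf.differentiable one_ne_zero x)
  simpa using h2

theorem gaussDefect_eq_zero_of_tsupport_subset (hA : IsOpen A) (hf : ContDiff ℝ 1 f)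
    (hfc : HasCompactSupport f) (h : tsupport f ⊆ A) (e : Pt) : gaussDefect A f e = 0 := by
  have h1 : ∫ x in A, fderiv ℝ f x e = 0 := by
    rw [← integral_fderiv_apply_eq_zero hf hfc e]
    refine setIntegral_eq_integral_of_forall_compl_eq_zero fun x hx => ?_
    rw [image_eq_zero_of_notMem_tsupport fun h' => hx (h (tsupport_fderiv_subset ℝ h'))]
    rfl
  have h2 : ∫ x, f x * ⟪outerNormal A x, e⟫ ∂boundaryMeasure A = 0 := by
    refine setIntegral_eq_zero_of_forall_eq_zero fun x hx => ?_
    rw [hA.frontier_eq] at hx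
    have hfx : f x = 0 := image_eq_zero_of_notMem_tsupport fun h' => hx.2 (h h')
    rw [hfx, zero_mul]
  rw [gaussDefect, h1, h2, sub_zero]

/-- The divergence theorem for functions that vanish near the irregular boundary points. -/
theorem gaussDefect_eq_zero_of_eqOn_zero (hA : HasPiecewiseC1Boundary A) (hAo : IsOpen A)
    (hb : Bornology.IsBounded A) (hf : ContDiff ℝ 1 f) {W : Set Pt} (hW : IsOpen W)
    (hWA : ∀ x ∈ frontier A, x ∉ W → ∃ n, IsOuterNormal A x n) (hfW : ∀ x ∈ W, f x = 0) (e : Pt) :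
    gaussDefect A f e = 0 := by
  set K := closure A \ W with hK
  have hKc : IsCompact K := hb.isCompact_closure.diff hW
  have hloc : ∀ x : Pt, ∃ U : Set Pt, IsOpen U ∧ x ∈ U ∧ Bornology.IsBounded U ∧
      (x ∈ K → ∀ f : Pt → ℝ, ContDiff ℝ 1 f → HasCompactSupport f → tsupport f ⊆ U →
        ∀ e, gaussDefect A f e = 0) := by
    intro x
    by_cases hx : x ∈ K
    · have : ∃ U ∈ 𝓝 x, ∀ f : Pt → ℝ, ContDiff ℝ 1 f → HasCompactSupport f → tsupport f ⊆ U →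
          ∀ e, gaussDefect A f e = 0 := by
        by_cases hxA : x ∈ A
        · exact ⟨A, hAo.mem_nhds hxA, fun f hf hfc hfU e =>
            gaussDefect_eq_zero_of_tsupport_subset hAo hf hfc hfU e⟩
        · obtain ⟨n, hn⟩ := hWA x (by rw [hAo.frontier_eq]; exact ⟨hx.1, hxA⟩) hx.2
          exact exists_nhds_gaussDefect_eq_zero_of_isOuterNormal hA hAo hb hn
      obtain ⟨U, hU, hUf⟩ := this
      refine ⟨interior U ∩ Metric.ball x 1, isOpen_interior.inter Metric.isOpen_ball,
        ⟨mem_interior_iff_mem_nhds.2 hU, Metric.mem_ball_self one_pos⟩,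
        Metric.isBounded_ball.subset inter_subset_right, fun _ f hf hfc hfU => ?_⟩
      exact hUf f hf hfc ((hfU.trans inter_subset_left).trans interior_subset)
    · exact ⟨Metric.ball x 1, Metric.isOpen_ball, Metric.mem_ball_self one_pos,
        Metric.isBounded_ball, fun h => absurd h hx⟩
  choose U hUo hxU hUb hU using hloc
  obtain ⟨t, htK, ht⟩ := hKc.elim_nhds_subcover U fun x _ => (hUo x).mem_nhds (hxU x)
  obtain ⟨ρ, hρ⟩ := SmoothPartitionOfUnity.exists_isSubordinate 𝓘(ℝ, Pt) hKc.isClosed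
    (fun i : t => U i) (fun i => hUo i) fun y hy => by
      obtain ⟨x, hx, hxy⟩ := mem_iUnion₂.1 (ht hy)
      exact mem_iUnion.2 ⟨⟨x, hx⟩, hxy⟩
  have hρc : ∀ i, ContDiff ℝ 1 (ρ i) := fun i => (ρ i).contMDiff.contDiff.of_le (by simp)
  have hmul : ∀ i, ContDiff ℝ 1 fun x => ρ i x * f x := fun i => (hρc i).mul hf
  have heq : EqOn f (fun x => ∑ i, ρ i x * f x) (closure A) := by
    intro x hx
    simp only
    rw [← Finset.sum_mul]
    by_cases hxW : x ∈ W
    · rw [hfW x hxW, mul_zero]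
    · have := ρ.sum_eq_one (x := x) ⟨hx, hxW⟩
      rw [finsum_eq_sum_of_fintype] at this
      rw [this, one_mul]
  rw [gaussDefect_congr hAo heq, gaussDefect_sum hA hb _ fun i _ => hmul i]
  refine Finset.sum_eq_zero fun i _ => ?_
  have hts : tsupport (fun x => ρ i x * f x) ⊆ U i :=
    (tsupport_mul_subset_left).trans (hρ i)
  refine hU i (htK i i.2) _ (hmul i) ?_ hts e
  exact ((hUb i).isCompact_closure).of_isClosed_subset (isClosed_tsupport _)
    (hts.trans subset_closure)

/-- **The divergence theorem** on a bounded open set with piecewise `C¹` boundary. -/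
theorem HasPiecewiseC1Boundary.gaussDefect_eq_zero (hA : HasPiecewiseC1Boundary A) (hAo : IsOpen A)
    (hb : Bornology.IsBounded A) (hf : ContDiff ℝ 1 f) (e : Pt) : gaussDefect A f e = 0 := by
  have := hA.isFiniteMeasure
  obtain ⟨U, hU, hUA⟩ := frontier_regular_isOpen A
  set N := frontier A \ U with hN
  have hNc : IsCompact N := (hb.isCompact_closure.of_isClosed_subset isClosed_frontier
    frontier_subset_closure).diff hU
  have hN0 : Measure.hausdorffMeasure 1 N = 0 := by
    have h1 := (ae_restrict_iff' isClosed_frontier.measurableSet).1 hA.2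
    rw [ae_iff] at h1
    refine measure_mono_null (fun x hx => ?_) h1
    exact fun h => hx.2 ((hUA x hx.1).2 (h hx.1))
  obtain ⟨C₀, hC₀⟩ := hb.isCompact_closure.exists_bound_of_continuousOn hf.continuous.continuousOn
  obtain ⟨C₁, hC₁⟩ := hb.isCompact_closure.exists_bound_of_continuousOn
    (continuous_fderiv_apply hf e).continuousOn
  have hlim : Tendsto (fun ε : ℝ => |C₁| * ε + |C₀| * ‖e‖ * ε +
      |C₀| * ‖e‖ * (boundaryMeasure A).real (Metric.cthickening ε N)) (𝓝[>] 0) (𝓝 0) := by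
    have h1 : Tendsto (fun ε : ℝ => boundaryMeasure A (Metric.cthickening ε N)) (𝓝 0)
        (𝓝 (boundaryMeasure A N)) :=
      tendsto_measure_cthickening_of_isClosed ⟨1, one_pos, measure_ne_top _ _⟩ hNc.isClosed
    have h2 : boundaryMeasure A N = 0 :=
      le_antisymm ((Measure.restrict_apply_le _ _).trans hN0.le) zero_le
    rw [h2] at h1
    have h3 := ((ENNReal.tendsto_toReal ENNReal.zero_ne_top).comp h1).mono_left
      (nhdsWithin_le_nhds (s := Ioi 0))
    have h4 : Tendsto (fun ε : ℝ => ε) (𝓝[>] 0) (𝓝 0) := nhdsWithin_le_nhds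
    have h5 := ((h4.const_mul |C₁|).add (h4.const_mul (|C₀| * ‖e‖))).add
      (h3.const_mul (|C₀| * ‖e‖))
    simpa [Measure.real] using h5
  have hbound : ∀ ε : ℝ, 0 < ε → |gaussDefect A f e| ≤ |C₁| * ε + |C₀| * ‖e‖ * ε +
      |C₀| * ‖e‖ * (boundaryMeasure A).real (Metric.cthickening ε N) := by
    intro ε hε
    obtain ⟨g, W, hg, hg01, hW, hNW, hgW, hg1, hgc, hgi, hgd⟩ :=
      exists_cutoff_of_hausdorffMeasure_one_eq_zero hNc hN0 hε
    have hfg : ContDiff ℝ 1 fun x => f x * g x := hf.mul hg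
    have hfg0 : gaussDefect A (fun x => f x * g x) e = 0 :=
      gaussDefect_eq_zero_of_eqOn_zero hA hAo hb hfg hW
        (fun x hx hxW => (hUA x hx).1 (by_contra fun h => hxW (hNW ⟨hx, h⟩)))
        (fun x hx => by rw [hgW x hx, mul_zero]) e
    have hgint : Integrable fun x => 1 - g x :=
      (continuous_const.sub hg.continuous).integrable_of_hasCompactSupport hgc
    have hgdint : Integrable fun x => ‖fderiv ℝ g x‖ := by
      have := ((contDiff_const (c := (1 : ℝ))).sub hg).continuous_fderiv one_ne_zero
        |>.integrable_of_hasCompactSupport (μ := volume) (hgc.fderiv ℝ)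
      refine this.norm.congr (ae_of_all _ fun y => ?_)
      simp only
      rw [fderiv_const_sub, norm_neg]
    rw [← sub_zero (gaussDefect A f e), ← hfg0, gaussDefect, gaussDefect, sub_sub_sub_comm,
      ← integral_sub (integrableOn_of_isBounded hb (continuous_fderiv_apply hf e))
        (integrableOn_of_isBounded hb (continuous_fderiv_apply hfg e)),
      ← integral_sub (integrable_mul_inner_outerNormal hA hb hf.continuous e)
        (integrable_mul_inner_outerNormal hA hb hfg.continuous e)]
    refine (abs_sub _ _).trans (add_le_add ?_ ?_)
    · have hI : Integrable fun x => |C₁| * (1 - g x) + |C₀| * ‖e‖ * ‖fderiv ℝ g x‖ :=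
        (hgint.const_mul _).add (hgdint.const_mul _)
      have hle : ‖∫ x in A, (fderiv ℝ f x e - fderiv ℝ (fun x => f x * g x) x e)‖ ≤
          ∫ x in A, (|C₁| * (1 - g x) + |C₀| * ‖e‖ * ‖fderiv ℝ g x‖) := by
        refine norm_integral_le_of_norm_le hI.integrableOn ?_
        refine ae_restrict_of_forall_mem hAo.measurableSet fun x hx => ?_
        have hxc := subset_closure hx
        rw [fderiv_fun_mul (hf.differentiable one_ne_zero x) (hg.differentiable one_ne_zero x)]
        have : fderiv ℝ f x e - (f x • fderiv ℝ g x + g x • fderiv ℝ f x) e =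
            fderiv ℝ f x e * (1 - g x) - f x * fderiv ℝ g x e := by
          simp only [add_apply, smul_apply, smul_eq_mul]
          ring
        rw [this]
        refine (norm_sub_le _ _).trans (add_le_add ?_ ?_)
        · rw [norm_mul, Real.norm_of_nonneg (sub_nonneg.2 (hg01 x).2)]
          exact mul_le_mul_of_nonneg_right ((hC₁ x hxc).trans (le_abs_self _))
            (sub_nonneg.2 (hg01 x).2)
        · rw [norm_mul, mul_assoc, mul_comm ‖e‖]
          exact mul_le_mul ((hC₀ x hxc).trans (le_abs_self _)) ((fderiv ℝ g x).le_opNorm e)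
            (norm_nonneg _) (abs_nonneg _)
      refine hle.trans ((setIntegral_le_integral hI (ae_of_all _ fun x => ?_)).trans ?_)
      · have := sub_nonneg.2 (hg01 x).2
        change 0 ≤ |C₁| * (1 - g x) + |C₀| * ‖e‖ * ‖fderiv ℝ g x‖
        positivity
      · rw [integral_add (hgint.const_mul _) (hgdint.const_mul _), integral_const_mul,
          integral_const_mul]
        gcongr
    · have hm : MeasurableSet (Metric.cthickening ε N) := Metric.isClosed_cthickening.measurableSet
      have hI : Integrable ((Metric.cthickening ε N).indicator fun _ => |C₀| * ‖e‖)
          (boundaryMeasure A) := (integrable_const _).indicator hm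
      rw [← Real.norm_eq_abs]
      refine (norm_integral_le_of_norm_le hI ?_).trans ?_
      · refine ae_restrict_of_forall_mem isClosed_frontier.measurableSet fun x hx => ?_
        have hxc := frontier_subset_closure hx
        by_cases hxN : x ∈ Metric.cthickening ε N
        · rw [indicator_of_mem hxN]
          have : f x * ⟪outerNormal A x, e⟫ - f x * g x * ⟪outerNormal A x, e⟫ =
              f x * ((1 - g x) * ⟪outerNormal A x, e⟫) := by ring
          rw [this, norm_mul, norm_mul, Real.norm_of_nonneg (sub_nonneg.2 (hg01 x).2)]
          refine mul_le_mul ((hC₀ x hxc).trans (le_abs_self _)) ?_ (by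
            have := sub_nonneg.2 (hg01 x).2
            positivity) (abs_nonneg _)
          have h1 : ‖⟪outerNormal A x, e⟫‖ ≤ ‖e‖ :=
            (norm_inner_le_norm _ _).trans
              (mul_le_of_le_one_left (norm_nonneg _) (norm_outerNormal_le_one A x))
          exact (mul_le_of_le_one_left (norm_nonneg _) (by linarith [(hg01 x).1])).trans h1
        · rw [indicator_of_notMem hxN, hg1 x hxN, mul_one, sub_self, norm_zero]
      · rw [integral_indicator hm, setIntegral_const, smul_eq_mul, mul_comm]
  have h0 : |gaussDefect A f e| ≤ 0 :=
    ge_of_tendsto hlim (by filter_upwards [self_mem_nhdsWithin] with ε hε using hbound ε hε)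
  exact abs_nonpos_iff.1 h0

/-- The divergence theorem in integral form. -/
theorem HasPiecewiseC1Boundary.integral_fderiv_eq (hA : HasPiecewiseC1Boundary A) (hAo : IsOpen A)
    (hb : Bornology.IsBounded A) (hf : ContDiff ℝ 1 f) (e : Pt) :
    ∫ x in A, fderiv ℝ f x e = ∫ x, f x * ⟪outerNormal A x, e⟫ ∂boundaryMeasure A :=
  sub_eq_zero.1 (hA.gaussDefect_eq_zero hAo hb hf e)

end Gauss

namespace CutCellMesh

variable {M : CutCellMesh}

theorem isOpen_bgCell (k : ∀ i, Fin (M.count i)) : IsOpen (M.bgCell k) := by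
  have : M.bgCell k = ⋂ i, {x : Pt | M.origin i + ((k i : ℕ) : ℝ) * M.width i < x i} ∩
      {x : Pt | x i < M.origin i + (((k i : ℕ) : ℝ) + 1) * M.width i} := by
    ext x
    simp [bgCell]
  rw [this]
  exact isOpen_iInter_of_finite fun i =>
    (isOpen_lt continuous_const (by fun_prop)).inter (isOpen_lt (by fun_prop) continuous_const)

theorem Cell.isOpen_set (E : M.Cell) : IsOpen (Cell.set E) :=
  (isOpen_bgCell E.1).inter M.isOpen_domain

theorem Cell.set_subset_domain (E : M.Cell) : Cell.set E ⊆ M.domain := inter_subset_right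

theorem isBounded_domain (M : CutCellMesh) : Bornology.IsBounded M.domain := by
  refine Bornology.IsBounded.subset (?_ : Bornology.IsBounded
    {x : Pt | ∀ i, M.origin i < x i ∧ x i < M.origin i + (M.count i : ℝ) * M.width i})
    M.domain_subset
  have h : Bornology.IsBounded ((WithLp.toLp 2 : (Fin 2 → ℝ) → Pt) '' (Set.pi univ fun i =>
      Icc (M.origin i) (M.origin i + (M.count i : ℝ) * M.width i))) := by
    refine (IsCompact.image (isCompact_univ_pi fun i => isCompact_Icc) ?_).isBounded
    exact PiLp.continuous_toLp 2 _
  refine h.subset fun x hx => ⟨WithLp.ofLp x, fun i _ => ⟨(hx i).1.le, (hx i).2.le⟩, rfl⟩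

theorem Cell.isBounded_set (E : M.Cell) : Bornology.IsBounded (Cell.set E) :=
  (isBounded_domain M).subset (Cell.set_subset_domain E)

theorem disjoint_bgCell {k l : ∀ i, Fin (M.count i)} (h : k ≠ l) :
    Disjoint (M.bgCell k) (M.bgCell l) := by
  rw [Set.disjoint_left]
  intro x hk hl
  refine h (funext fun i => Fin.ext ?_)
  have hw := M.width_pos i
  have h1 : ((k i : ℕ) : ℝ) < ((l i : ℕ) : ℝ) + 1 := by
    have := (hk i).1.trans (hl i).2
    exact lt_of_mul_lt_mul_right (by linarith) hw.le
  have h2 : ((l i : ℕ) : ℝ) < ((k i : ℕ) : ℝ) + 1 := by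
    have := (hl i).1.trans (hk i).2
    exact lt_of_mul_lt_mul_right (by linarith) hw.le
  have h3 : (k i : ℕ) < (l i : ℕ) + 1 := by exact_mod_cast h1
  have h4 : (l i : ℕ) < (k i : ℕ) + 1 := by exact_mod_cast h2
  omega

theorem Cell.disjoint_set {E F : M.Cell} (h : E ≠ F) : Disjoint (Cell.set E) (Cell.set F) :=
  (disjoint_bgCell fun h' => h (Subtype.ext h')).mono inter_subset_left inter_subset_left

theorem domain_subset_iUnion_closure (M : CutCellMesh) :
    M.domain ⊆ ⋃ E : M.Cell, closure (Cell.set E) := by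
  intro y hy
  have hrect := M.domain_subset hy
  have hnn : ∀ i, 0 ≤ (y i - M.origin i) / M.width i := fun i =>
    div_nonneg (by linarith [(hrect i).1]) (M.width_pos i).le
  have hk : ∀ i, ⌊(y i - M.origin i) / M.width i⌋₊ < M.count i := fun i => by
    rw [Nat.floor_lt (hnn i), div_lt_iff₀ (M.width_pos i)]
    linarith [(hrect i).2]
  set k : ∀ i, Fin (M.count i) := fun i => ⟨_, hk i⟩ with hkdef
  have hle : ∀ i, M.origin i + ((k i : ℕ) : ℝ) * M.width i ≤ y i := fun i => by
    have := Nat.floor_le (hnn i)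
    rw [le_div_iff₀ (M.width_pos i)] at this
    simp only [hkdef]
    linarith
  have hlt : ∀ i, y i < M.origin i + (((k i : ℕ) : ℝ) + 1) * M.width i := fun i => by
    have := Nat.lt_floor_add_one ((y i - M.origin i) / M.width i)
    rw [div_lt_iff₀ (M.width_pos i)] at this
    simp only [hkdef]
    linarith
  set v : Pt := WithLp.toLp 2 fun _ => 1 with hv
  have hev : ∀ᶠ t : ℝ in 𝓝[>] 0, y + t • v ∈ M.bgCell k ∩ M.domain := by
    have h1 := eventually_nhds_add_smul (M.isOpen_domain.mem_nhds hy) v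
    have h2 : ∀ i, ∀ᶠ t : ℝ in 𝓝[>] 0,
        (y + t • v) i < M.origin i + (((k i : ℕ) : ℝ) + 1) * M.width i := fun i =>
      eventually_nhds_add_smul (P := fun z => z i < M.origin i + (((k i : ℕ) : ℝ) + 1) * M.width i)
        ((isOpen_lt (by fun_prop) continuous_const).mem_nhds (hlt i)) v
    filter_upwards [h1, eventually_all.2 h2, self_mem_nhdsWithin] with t ht1 ht2 ht3
    refine ⟨fun i => ⟨?_, ht2 i⟩, ht1⟩
    have : (y + t • v) i = y i + t := by simp [hv]
    rw [this]
    exact (hle i).trans_lt (lt_add_of_pos_right _ ht3)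
  have hlim : Tendsto (fun t : ℝ => y + t • v) (𝓝[>] 0) (𝓝 y) := fun P hP =>
    eventually_nhds_add_smul (P := (· ∈ P)) hP v
  obtain ⟨t, ht⟩ := hev.exists
  exact mem_iUnion.2 ⟨⟨k, ⟨_, ht⟩⟩, mem_closure_of_tendsto hlim hev⟩

theorem intFace_comm (E F : M.Cell) : intFace E F = intFace F E := inter_comm _ _

theorem Adjacent.symm {E F : M.Cell} (h : Adjacent E F) : Adjacent F E :=
  ⟨h.1.symm, by rw [intFace_comm]; exact h.2⟩

theorem intFace_subset_frontier {E F : M.Cell} (h : E ≠ F) :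
    intFace E F ⊆ frontier (Cell.set E) := by
  rw [(Cell.isOpen_set E).frontier_eq]
  rintro x ⟨hE, hF⟩
  refine ⟨hE, fun hxE => ?_⟩
  obtain ⟨y, hy⟩ := mem_closure_iff.1 hF _ (Cell.isOpen_set E) hxE
  exact (Cell.disjoint_set h).le_bot hy

theorem bdryFace_subset_frontier (E : M.Cell) : bdryFace E ⊆ frontier (Cell.set E) := by
  rw [(Cell.isOpen_set E).frontier_eq]
  rintro x ⟨hE, hx⟩
  rw [M.isOpen_domain.frontier_eq] at hx
  exact ⟨hE, fun hxE => hx.2 (Cell.set_subset_domain E hxE)⟩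

theorem faceSet_subset_frontier (E : M.Cell) (i : Face E) :
    faceSet E i ⊆ frontier (Cell.set E) := by
  rcases i with ⟨_ | F, hi⟩
  · exact bdryFace_subset_frontier E
  · exact intFace_subset_frontier hi.1

theorem measurableSet_faceSet (E : M.Cell) (i : Face E) : MeasurableSet (faceSet E i) := by
  rcases i with ⟨_ | F, hi⟩
  · exact (isClosed_closure.inter isClosed_frontier).measurableSet
  · exact (isClosed_closure.inter isClosed_closure).measurableSet

/-- At a regular point all cells and the domain have outer normals if it is a boundary point. -/
def IsRegularPoint (M : CutCellMesh) (x : Pt) : Prop :=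
  (x ∈ frontier M.domain → ∃ n, IsOuterNormal M.domain x n) ∧
    ∀ E : M.Cell, x ∈ frontier (Cell.set E) → ∃ n, IsOuterNormal (Cell.set E) x n

theorem IsRegular.ae_isRegularPoint (hM : M.IsRegular) :
    ∀ᵐ x ∂(Measure.hausdorffMeasure 1 : Measure Pt), M.IsRegularPoint x :=
  ((ae_restrict_iff' isClosed_frontier.measurableSet).1 hM.1.2).and
    (ae_all_iff.2 fun E => (ae_restrict_iff' isClosed_frontier.measurableSet).1 (hM.2 E).2)

namespace IsRegularPoint

variable {x : Pt} (hx : M.IsRegularPoint x)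

include hx

theorem isOuterNormal {E : M.Cell} (hE : x ∈ frontier (Cell.set E)) :
    IsOuterNormal (Cell.set E) x (outerNormal (Cell.set E) x) :=
  isOuterNormal_outerNormal (hx.2 E hE)

theorem norm_outerNormal {E : M.Cell} (hE : x ∈ frontier (Cell.set E)) :
    ‖outerNormal (Cell.set E) x‖ = 1 :=
  (hx.isOuterNormal hE).norm_eq_one

theorem outerNormal_eq_neg {E F : M.Cell} (h : E ≠ F) (hEF : x ∈ intFace E F) :
    outerNormal (Cell.set F) x = -outerNormal (Cell.set E) x :=
  (hx.isOuterNormal (intFace_subset_frontier h.symm (intFace_comm E F ▸ hEF))).eq_neg_of_disjoint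
    (hx.isOuterNormal (intFace_subset_frontier h hEF)) (Cell.disjoint_set h.symm)

theorem notMem_intFace_of_mem_intFace {E F G : M.Cell} (hEF : E ≠ F) (hEG : E ≠ G) (hFG : F ≠ G)
    (h : x ∈ intFace E F) : x ∉ intFace E G := by
  intro h'
  have h1 := hx.outerNormal_eq_neg hEF h
  have h2 := hx.outerNormal_eq_neg hEG h'
  have h3 := hx.outerNormal_eq_neg hFG (⟨h.2, h'.2⟩ : x ∈ intFace F G)
  have h4 := hx.norm_outerNormal (intFace_subset_frontier hEF h)
  rw [h1, h2, neg_neg] at h3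
  have h5 : outerNormal (Cell.set E) x = 0 := by
    rw [neg_eq_iff_add_eq_zero, ← two_smul ℝ] at h3
    exact (smul_eq_zero.1 h3).resolve_left two_ne_zero
  rw [h5, norm_zero] at h4
  exact zero_ne_one h4

theorem notMem_intFace_of_mem_bdryFace {E F : M.Cell} (hEF : E ≠ F) (h : x ∈ bdryFace E) :
    x ∉ intFace E F := by
  intro h'
  obtain ⟨n, hn⟩ := hx.1 h.2
  have h1 := hx.outerNormal_eq_neg hEF h'
  have hE := hx.isOuterNormal (intFace_subset_frontier hEF h')
  have hF := hx.isOuterNormal (intFace_subset_frontier hEF.symm (intFace_comm E F ▸ h'))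
  have h2 := hE.eq_of_subset hn (Cell.set_subset_domain E)
  have h3 := hF.eq_of_subset hn (Cell.set_subset_domain F)
  rw [h1, h2] at h3
  have h5 : n = 0 := by
    rw [neg_eq_iff_add_eq_zero, ← two_smul ℝ] at h3
    exact (smul_eq_zero.1 h3).resolve_left two_ne_zero
  have h4 := hn.norm_eq_one
  rw [h5, norm_zero] at h4
  exact zero_ne_one h4

theorem mem_bdryFace_or_mem_intFace {E : M.Cell} (hE : x ∈ frontier (Cell.set E)) :
    x ∈ bdryFace E ∨ ∃ F, E ≠ F ∧ x ∈ intFace E F := by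
  have hxc := frontier_subset_closure hE
  by_cases hxΩ : x ∈ M.domain
  · right
    have hn := hx.isOuterNormal hE
    set n := outerNormal (Cell.set E) x
    have hnn : 0 < ⟪n, n⟫ := by rw [real_inner_self_eq_norm_sq, hn.norm_eq_one]; norm_num
    have hev : ∀ᶠ t : ℝ in 𝓝[>] 0, x + t • n ∈ ⋃ F ∈ {F : M.Cell | E ≠ F},
        closure (Cell.set F) := by
      filter_upwards [hn.eventually_notMem_closure hnn,
        eventually_nhds_add_smul (M.isOpen_domain.mem_nhds hxΩ) n] with t h1 h2
      obtain ⟨F, hF⟩ := mem_iUnion.1 (domain_subset_iUnion_closure M h2)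
      refine mem_iUnion₂.2 ⟨F, ?_, hF⟩
      rintro rfl
      exact h1 hF
    have hlim : Tendsto (fun t : ℝ => x + t • n) (𝓝[>] 0) (𝓝 x) := fun P hP =>
      eventually_nhds_add_smul (P := (· ∈ P)) hP n
    have hcl : IsClosed (⋃ F ∈ {F : M.Cell | E ≠ F}, closure (Cell.set F)) :=
      (toFinite _).isClosed_biUnion fun F _ => isClosed_closure
    obtain ⟨F, hF, hxF⟩ := mem_iUnion₂.1 (hcl.mem_of_tendsto hlim hev)
    exact ⟨F, hF, hxc, hxF⟩
  · left
    refine ⟨hxc, ?_⟩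
    rw [M.isOpen_domain.frontier_eq]
    exact ⟨closure_mono (Cell.set_subset_domain E) hxc, hxΩ⟩

theorem notMem_faceSet_of_mem_faceSet {E : M.Cell} {i j : Face E} (hij : i ≠ j)
    (h : x ∈ faceSet E i) : x ∉ faceSet E j := by
  rcases i with ⟨_ | F, hi⟩ <;> rcases j with ⟨_ | G, hj⟩
  · exact absurd rfl hij
  · exact hx.notMem_intFace_of_mem_bdryFace hj.1 h
  · exact fun h' => hx.notMem_intFace_of_mem_bdryFace hi.1 h' h
  · refine hx.notMem_intFace_of_mem_intFace hi.1 hj.1 (fun hFG => hij ?_) h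
    subst hFG
    rfl

end IsRegularPoint

/-- The boundary of an element consists of its faces, up to a set of length zero. -/
theorem IsRegular.iUnion_faceSet_ae_eq (hM : M.IsRegular) (E : M.Cell) :
    (⋃ i : Face E, faceSet E i : Set Pt) =ᵐ[Measure.hausdorffMeasure 1] frontier (Cell.set E) := by
  have h0 : ∀ᵐ x ∂(Measure.hausdorffMeasure 1 : Measure Pt),
      x ∈ bdryFace E → HasBdryFace E := by
    by_cases h : HasBdryFace E
    · exact ae_of_all _ fun _ _ => h
    · have h' : Measure.hausdorffMeasure 1 (bdryFace E) = 0 := by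
        simpa [HasBdryFace] using h
      filter_upwards [measure_eq_zero_iff_ae_notMem.1 h'] with x hx hx'
      exact absurd hx' hx
  have h1 : ∀ᵐ x ∂(Measure.hausdorffMeasure 1 : Measure Pt),
      ∀ F : M.Cell, E ≠ F → x ∈ intFace E F → Adjacent E F := by
    refine ae_all_iff.2 fun F => ?_
    by_cases h : Measure.hausdorffMeasure 1 (intFace E F) = 0
    · filter_upwards [measure_eq_zero_iff_ae_notMem.1 h] with x hx _ hx'
      exact absurd hx' hx
    · exact ae_of_all _ fun _ hEF _ => ⟨hEF, pos_iff_ne_zero.2 h⟩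
  filter_upwards [hM.ae_isRegularPoint, h0, h1] with x hx h0 h1
  refine propext ⟨fun h => ?_, fun h => ?_⟩
  · obtain ⟨i, hi⟩ := mem_iUnion.1 h
    exact faceSet_subset_frontier E i hi
  · rcases hx.mem_bdryFace_or_mem_intFace h with h' | ⟨F, hEF, h'⟩
    · exact mem_iUnion.2 ⟨⟨none, h0 h'⟩, h'⟩
    · exact mem_iUnion.2 ⟨⟨some F, h1 F hEF h'⟩, h'⟩

theorem IsRegular.integral_boundaryMeasure_eq_sum (hM : M.IsRegular) (E : M.Cell) {G : Pt → ℝ}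
    (hG : Integrable G (boundaryMeasure (Cell.set E))) :
    ∫ x, G x ∂boundaryMeasure (Cell.set E) = ∑ i : Face E, lineIntegral (faceSet E i) G := by
  rw [boundaryMeasure, ← setIntegral_congr_set (hM.iUnion_faceSet_ae_eq E), integral_iUnion_ae,
    tsum_fintype]
  · rfl
  · exact fun i => (measurableSet_faceSet E i).nullMeasurableSet
  · intro i j hij
    refine measure_eq_zero_iff_ae_notMem.2 ?_
    filter_upwards [hM.ae_isRegularPoint] with x hx h
    exact hx.notMem_faceSet_of_mem_faceSet hij h.1 h.2
  · exact IntegrableOn.mono_set hG (iUnion_subset fun i => faceSet_subset_frontier E i)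

end CutCellMesh

section PolynomialCalculus

variable {r : ℕ}

theorem MvPolynomial.contDiff_eval_pt (p : MvPolynomial (Fin 2) ℝ) {n : WithTop ℕ∞} :
    ContDiff ℝ n fun x : Pt => MvPolynomial.eval (fun k => x k) p := by
  have h := AnalyticOnNhd.eval_continuousLinearMap' (fun k : Fin 2 =>
    (EuclideanSpace.proj k : Pt →L[ℝ] ℝ)) p
  exact (contDiff_iff_contDiffAt.2 fun x => (h x (mem_univ x)).contDiffAt)

theorem MvPolynomial.hasFDerivAt_eval_pt (p : MvPolynomial (Fin 2) ℝ) (x : Pt) :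
    HasFDerivAt (fun x : Pt => MvPolynomial.eval (fun k => x k) p)
      (∑ k : Fin 2, MvPolynomial.eval (fun l => x l) (MvPolynomial.pderiv k p) •
        (EuclideanSpace.proj k : Pt →L[ℝ] ℝ)) x := by
  induction p using MvPolynomial.induction_on with
  | C a => simpa using hasFDerivAt_const a x
  | add p q hp hq =>
    simp only [map_add, add_smul, Finset.sum_add_distrib]
    exact hp.add hq
  | mul_X p i hp =>
    have hX : HasFDerivAt (fun x : Pt => x i) (EuclideanSpace.proj i : Pt →L[ℝ] ℝ) x :=
      (EuclideanSpace.proj i : Pt →L[ℝ] ℝ).hasFDerivAt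
    have h := hp.mul hX
    simp only [map_mul, MvPolynomial.eval_X]
    refine h.congr_fderiv ?_
    ext v
    fin_cases i <;> simp [Fin.sum_univ_two, MvPolynomial.pderiv_X, Pi.single_apply] <;> ring

namespace Poly3

theorem contDiff_val (u : Poly3 r) (i : Fin 3) {n : WithTop ℕ∞} :
    ContDiff ℝ n fun x => u.val x i :=
  MvPolynomial.contDiff_eval_pt _

theorem continuous_val (u : Poly3 r) : Continuous u.val :=
  continuous_pi fun i => (contDiff_val u i (n := 0)).continuous

theorem fderiv_val (u : Poly3 r) (i : Fin 3) (k : Fin 2) (x : Pt) :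
    fderiv ℝ (fun x => u.val x i) x (EuclideanSpace.single k 1) = u.dval k x i := by
  have h := MvPolynomial.hasFDerivAt_eval_pt (u i : MvPolynomial (Fin 2) ℝ) x
  change fderiv ℝ (fun x : Pt => MvPolynomial.eval (fun k => x k) (u i : MvPolynomial (Fin 2) ℝ)) x
    _ = _
  rw [h.fderiv]
  fin_cases k <;> simp [Fin.sum_univ_two, dval]

end Poly3

end PolynomialCalculus

section Flux

/-- The quadratic form `⟨A_n v, v⟩ = 2 c v₀ (v₁ n₁ + v₂ n₂)` of the flux in normal direction. -/
theorem normalFlux_mulVec_dotProduct (c : ℝ) (n : Pt) (v w : Fin 3 → ℝ) :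
    (normalFlux c n).mulVec v ⬝ᵥ w =
      c * (v 0 * (w 1 * n 0 + w 2 * n 1) + (v 1 * n 0 + v 2 * n 1) * w 0) := by
  simp [normalFlux, fluxMatrix, Matrix.mulVec, dotProduct, Fin.sum_univ_three]
  ring

theorem normalFlux_neg (c : ℝ) (n : Pt) : normalFlux c (-n) = -normalFlux c n := by
  simp [normalFlux]
  abel

theorem normalFlux_symm (c : ℝ) (n : Pt) (v w : Fin 3 → ℝ) :
    (normalFlux c n).mulVec v ⬝ᵥ w = (normalFlux c n).mulVec w ⬝ᵥ v := by
  rw [normalFlux_mulVec_dotProduct, normalFlux_mulVec_dotProduct]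
  ring

/-- The central flux of two states is energy-stable. -/
theorem central_flux_dotProduct_sub (c : ℝ) (n : Pt) (v w : Fin 3 → ℝ) :
    ((1 / 2 : ℝ) • ((normalFlux c n).mulVec v + (normalFlux c n).mulVec w)) ⬝ᵥ (v - w) =
      1 / 2 * ((normalFlux c n).mulVec v ⬝ᵥ v) - 1 / 2 * ((normalFlux c n).mulVec w ⬝ᵥ w) := by
  rw [smul_dotProduct, add_dotProduct, dotProduct_sub, dotProduct_sub, normalFlux_symm c n w v,
    smul_eq_mul]
  ring

theorem central_flux_dotProduct_self (c : ℝ) (n : Pt) (v : Fin 3 → ℝ) :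
    ((1 / 2 : ℝ) • ((normalFlux c n).mulVec v + (normalFlux c n).mulVec v)) ⬝ᵥ v =
      (normalFlux c n).mulVec v ⬝ᵥ v := by
  rw [smul_dotProduct, add_dotProduct, smul_eq_mul]
  ring

theorem inner_mirrorState (n : Pt) (hn : ‖n‖ = 1) (v : Fin 3 → ℝ) :
    (mirrorState n v 1) * n 0 + (mirrorState n v 2) * n 1 = -(v 1 * n 0 + v 2 * n 1) := by
  have h : n 0 ^ 2 + n 1 ^ 2 = 1 := by
    have := EuclideanSpace.norm_sq_eq n
    rw [hn, Fin.sum_univ_two, Real.norm_eq_abs, Real.norm_eq_abs, sq_abs, sq_abs] at this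
    linarith
  simp only [mirrorState, Matrix.cons_val_one, Matrix.cons_val]
  linear_combination (-2 * (v 1 * n 0 + v 2 * n 1)) * h

theorem central_flux_mirrorState_dotProduct (c : ℝ) (n : Pt) (hn : ‖n‖ = 1) (v : Fin 3 → ℝ) :
    ((1 / 2 : ℝ) • ((normalFlux c n).mulVec v + (normalFlux c n).mulVec (mirrorState n v))) ⬝ᵥ v =
      1 / 2 * ((normalFlux c n).mulVec v ⬝ᵥ v) := by
  rw [smul_dotProduct, add_dotProduct, normalFlux_mulVec_dotProduct, normalFlux_mulVec_dotProduct,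
    inner_mirrorState n hn, smul_eq_mul]
  simp only [mirrorState, Matrix.cons_val_zero]
  ring

end Flux

namespace CutCellMesh

variable {M : CutCellMesh} {r : ℕ}

theorem integrableOn_faceSet (hM : M.IsRegular) (E : M.Cell) (i : Face E) {G : Pt × Pt → ℝ}
    (hG : Continuous G) :
    IntegrableOn (fun x => G (x, outerNormal (Cell.set E) x)) (faceSet E i)
      (Measure.hausdorffMeasure 1) :=
  IntegrableOn.mono_set ((hM.2 E).integrable_continuous_normal (Cell.isBounded_set E) hG)
    (faceSet_subset_frontier E i)

theorem continuous_normalFlux_mulVec_dotProduct (c : ℝ) (u w : Poly3 r) :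
    Continuous fun z : Pt × Pt => (normalFlux c z.2).mulVec (u.val z.1) ⬝ᵥ w.val z.1 := by
  have h := fun (v : Poly3 r) (i : Fin 3) =>
    ((Poly3.contDiff_val v i (n := 0)).continuous.comp (continuous_fst : Continuous
      (Prod.fst : Pt × Pt → Pt)))
  simp only [normalFlux_mulVec_dotProduct]
  have hn : ∀ k : Fin 2, Continuous fun z : Pt × Pt => z.2 k := fun k => by fun_prop
  exact continuous_const.mul (((h u 0).mul (((h w 1).mul (hn 0)).add ((h w 2).mul (hn 1)))).add
    ((((h u 1).mul (hn 0)).add ((h u 2).mul (hn 1))).mul (h w 0)))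

/-- The integral of the boundary energy flux `⟨f_n(w), w⟩` over the face `i` of `E`. -/
theorem surfaceForm_self (c : ℝ) (E : M.Cell) (i : Face E) (w : Poly3 r) :
    surfaceForm c E i w w w = lineIntegral (faceSet E i) fun x =>
      (normalFlux c (outerNormal (Cell.set E) x)).mulVec (w.val x) ⬝ᵥ w.val x := by
  simp only [surfaceForm, central_flux_dotProduct_self]

/-- The energy identity on an element. -/
theorem volForm_self (hM : M.IsRegular) (c : ℝ) (E : M.Cell) (u : Poly3 r) :
    volForm c E u u = 1 / 2 * ∑ i : Face E, surfaceForm c E i u u u := by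
  have hA := hM.2 E
  have hb := Cell.isBounded_set E
  have hd : ∀ (i : Fin 3), ContDiff ℝ 1 fun x => c * (u.val x 0 * u.val x i) := fun i =>
    contDiff_const.mul ((Poly3.contDiff_val u 0).mul (Poly3.contDiff_val u i))
  have hfd : ∀ (i : Fin 3) (k : Fin 2) (x : Pt),
      fderiv ℝ (fun x => c * (u.val x 0 * u.val x i)) x (EuclideanSpace.single k 1) =
        c * (u.val x 0 * u.dval k x i + u.val x i * u.dval k x 0) := by
    intro i k x
    have hdi := fun i => (Poly3.contDiff_val u i (n := 1)).differentiable one_ne_zero x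
    rw [fderiv_const_mul ((hdi 0).fun_mul (hdi i)), fderiv_fun_mul (hdi 0) (hdi i)]
    simp only [add_apply, smul_apply, smul_eq_mul, Poly3.fderiv_val]
  have hG := fun (i : Fin 3) (k : Fin 2) =>
    hA.integral_fderiv_eq (Cell.isOpen_set E) hb (hd i) (EuclideanSpace.single k 1)
  have hint : volForm c E u u =
      (∫ x in Cell.set E, fderiv ℝ (fun x => c * (u.val x 0 * u.val x 1)) x
        (EuclideanSpace.single 0 1)) +
      ∫ x in Cell.set E, fderiv ℝ (fun x => c * (u.val x 0 * u.val x 2)) x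
        (EuclideanSpace.single 1 1) := by
    rw [volForm, ← integral_add (integrableOn_of_isBounded hb (continuous_fderiv_apply (hd 1) _))
      (integrableOn_of_isBounded hb (continuous_fderiv_apply (hd 2) _))]
    congr 1
    funext x
    rw [hfd, hfd]
    simp [fluxMatrix, Matrix.mulVec, dotProduct, Fin.sum_univ_three, Fin.sum_univ_two]
    ring
  have hflux := continuous_normalFlux_mulVec_dotProduct c u u
  simp only [surfaceForm_self]
  rw [← hM.integral_boundaryMeasure_eq_sum E (hA.integrable_continuous_normal hb hflux), hint, hG,
    hG, ← integral_add (integrable_mul_inner_outerNormal hA hb (hd 1).continuous _)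
      (integrable_mul_inner_outerNormal hA hb (hd 2).continuous _), ← integral_const_mul]
  congr 1
  funext x
  rw [normalFlux_mulVec_dotProduct]
  simp [EuclideanSpace.inner_single_right]
  ring

/-- The central flux term at an internal face. -/
theorem centralInt_self (hM : M.IsRegular) (c : ℝ) {E F : M.Cell} (h : Adjacent E F)
    (u : M.DGSpace r) :
    centralInt c E F u u = 1 / 2 * surfaceForm c E ⟨some F, h⟩ (u E) (u E) (u E) -
      1 / 2 * surfaceForm c E ⟨some F, h⟩ (u F) (u F) (u F) := by
  have hi := fun w : Poly3 r => integrableOn_faceSet hM E ⟨some F, h⟩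
    (continuous_normalFlux_mulVec_dotProduct c w w)
  rw [surfaceForm_self, surfaceForm_self, lineIntegral, lineIntegral, ← integral_const_mul,
    ← integral_const_mul, ← integral_sub ((hi _).const_mul _) ((hi _).const_mul _)]
  simp only [centralInt, central_flux_dotProduct_sub]
  rfl

theorem surfaceForm_swap (hM : M.IsRegular) (c : ℝ) {E F : M.Cell} (h : Adjacent E F)
    (w : Poly3 r) :
    surfaceForm c F ⟨some E, h.symm⟩ w w w = -surfaceForm c E ⟨some F, h⟩ w w w := by
  rw [surfaceForm_self, surfaceForm_self, lineIntegral, lineIntegral, ← integral_neg]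
  change ∫ x in intFace F E, _ ∂_ = ∫ x in intFace E F, _ ∂_
  rw [intFace_comm]
  refine setIntegral_congr_ae (measurableSet_faceSet E ⟨some F, h⟩) ?_
  filter_upwards [hM.ae_isRegularPoint] with x hx hxf
  rw [hx.outerNormal_eq_neg h.1 hxf, normalFlux_neg, Matrix.neg_mulVec, neg_dotProduct]

theorem centralBdry_self (hM : M.IsRegular) (c : ℝ) {E : M.Cell} (h : HasBdryFace E)
    (u : M.DGSpace r) :
    centralBdry c E u u = 1 / 2 * surfaceForm c E ⟨none, h⟩ (u E) (u E) (u E) := by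
  rw [surfaceForm_self, lineIntegral, ← integral_const_mul]
  refine setIntegral_congr_ae (measurableSet_faceSet E ⟨none, h⟩) ?_
  filter_upwards [hM.ae_isRegularPoint] with x hx hxf
  rw [central_flux_mirrorState_dotProduct c _ (hx.norm_outerNormal (bdryFace_subset_frontier E hxf))]

/-- The outgoing energy flux of the neighbouring polynomial at a face; zero at the boundary. -/
noncomputable def neighbourFlux (c : ℝ) (E : M.Cell) (i : Face E) (u : M.DGSpace r) : ℝ :=
  match i.1 with
  | none => 0
  | some F => surfaceForm c E i (u F) (u F) (u F)

theorem faceCentral_self (hM : M.IsRegular) (lab : M.Labelling) (c : ℝ) (E : M.Cell) (i : Face E)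
    (u : M.DGSpace r) :
    faceCentral lab c E i u u = 1 / 2 * surfaceForm c E i (u E) (u E) (u E) -
      1 / 2 * neighbourFlux c E i u := by
  rcases i with ⟨_ | F, hi⟩
  · simp only [faceCentral, neighbourFlux, mul_zero, sub_zero]
    exact centralBdry_self hM c hi u
  · simp only [faceCentral, neighbourFlux]
    split_ifs
    · exact centralInt_self hM c hi u
    · rw [centralInt_self hM c hi.symm u, surfaceForm_swap hM c hi, surfaceForm_swap hM c hi]
      ring

end CutCellMesh

section Mirror

variable {r : ℕ}

theorem sq_add_sq_eq_one_of_norm {n : Pt} (hn : ‖n‖ = 1) : n 0 * n 0 + n 1 * n 1 = 1 := by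
  have := EuclideanSpace.norm_sq_eq n
  rw [hn, Fin.sum_univ_two, Real.norm_eq_abs, Real.norm_eq_abs, sq_abs, sq_abs] at this
  linarith

theorem bind₁_projPoly_projPoly {n : Pt} (hn : ‖n‖ = 1) (q : Pt) (k : Fin 2) :
    MvPolynomial.bind₁ (projPoly n q) (projPoly n q k) = projPoly n q k := by
  have h : (MvPolynomial.C (n 0) * MvPolynomial.C (n 0) + MvPolynomial.C (n 1) *
      MvPolynomial.C (n 1) : MvPolynomial (Fin 2) ℝ) = 1 := by
    rw [← map_mul, ← map_mul, ← map_add, sq_add_sq_eq_one_of_norm hn, map_one]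
  conv_lhs => rw [projPoly]
  simp only [Fin.sum_univ_two, map_sub, map_mul, map_add, MvPolynomial.bind₁_X_right,
    MvPolynomial.bind₁_C_right]
  simp only [projPoly, Fin.sum_univ_two]
  linear_combination ((MvPolynomial.C (n 0) * (MvPolynomial.X 0 - MvPolynomial.C (q 0)) +
    MvPolynomial.C (n 1) * (MvPolynomial.X 1 - MvPolynomial.C (q 1))) * MvPolynomial.C (n k)) * h

theorem compProj_compProj {n : Pt} (hn : ‖n‖ = 1) (q : Pt)
    (g : MvPolynomial.restrictTotalDegree (Fin 2) ℝ r) :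
    compProj n q (compProj n q g) = compProj n q g := by
  refine Subtype.ext ?_
  simp only [compProj]
  rw [MvPolynomial.bind₁_bind₁]
  simp only [bind₁_projPoly_projPoly hn]

theorem compProj_sub_smul (n q : Pt) (a b c : ℝ)
    (g h k : MvPolynomial.restrictTotalDegree (Fin 2) ℝ r) :
    compProj n q (g - a • (b • h + c • k)) =
      compProj n q g - a • (b • compProj n q h + c • compProj n q k) := by
  refine Subtype.ext ?_
  simp [compProj]

theorem mirrorPoly_mirrorPoly {n : Pt} (hn : ‖n‖ = 1) (q : Pt) (u : Poly3 r) :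
    mirrorPoly n q (mirrorPoly n q u) = u := by
  have h := sq_add_sq_eq_one_of_norm hn
  have key : n 0 • compProj n q (mirrorPoly n q u 1) + n 1 • compProj n q (mirrorPoly n q u 2) =
      -(n 0 • compProj n q (u 1) + n 1 • compProj n q (u 2)) := by
    change n 0 • compProj n q (u 1 - (2 * n 0) • (n 0 • compProj n q (u 1) +
      n 1 • compProj n q (u 2))) + n 1 • compProj n q (u 2 - (2 * n 1) •
        (n 0 • compProj n q (u 1) + n 1 • compProj n q (u 2))) = _
    rw [compProj_sub_smul, compProj_sub_smul, compProj_compProj hn, compProj_compProj hn]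
    set A := compProj n q (u 1)
    set B := compProj n q (u 2)
    have e : n 0 • (A - (2 * n 0) • (n 0 • A + n 1 • B)) +
        n 1 • (B - (2 * n 1) • (n 0 • A + n 1 • B)) =
        (n 0 • A + n 1 • B) - (2 * (n 0 * n 0 + n 1 * n 1)) • (n 0 • A + n 1 • B) := by module
    rw [e, h]
    module
  funext i
  fin_cases i
  · rfl
  · change mirrorPoly n q u 1 - (2 * n 0) • (n 0 • compProj n q (mirrorPoly n q u 1) +
      n 1 • compProj n q (mirrorPoly n q u 2)) = u 1
    rw [key]
    change u 1 - (2 * n 0) • (n 0 • compProj n q (u 1) + n 1 • compProj n q (u 2)) - _ = _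
    module
  · change mirrorPoly n q u 2 - (2 * n 1) • (n 0 • compProj n q (mirrorPoly n q u 1) +
      n 1 • compProj n q (mirrorPoly n q u 2)) = u 2
    rw [key]
    change u 2 - (2 * n 1) • (n 0 • compProj n q (u 1) + n 1 • compProj n q (u 2)) - _ = _
    module

end Mirror

namespace CutCellMesh

variable {M : CutCellMesh} {r : ℕ}

section Combinatorics

open scoped Classical in
theorem sum_face (E : M.Cell) (g : Option M.Cell → ℝ) :
    ∑ i : Face E, g i.1 =
      (if HasBdryFace E then g none else 0) + ∑ F, if Adjacent E F then g (some F) else 0 := by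
  rw [← Finset.sum_subtype (Finset.univ.filter (IsFace E)) (fun o => by simp) g,
    Finset.sum_filter, Fintype.sum_option]
  rfl

/-- Summation over all faces of all elements counts internal faces twice. -/
theorem sum_cell_sum_face (lab : M.Labelling) (G : M.Cell → Option M.Cell → ℝ) :
    ∑ E : M.Cell, ∑ i : Face E, G E i.1 =
      ∑ P ∈ intFaces lab, (G P.1 (some P.2) + G P.2 (some P.1)) + ∑ E ∈ bdryCells M, G E none := by
  classical
  have h1 : ∑ P ∈ intFaces lab, (G P.1 (some P.2) + G P.2 (some P.1)) =
      ∑ E, ∑ F, if Adjacent E F then G E (some F) else 0 := by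
    have h2 : ∀ E F : M.Cell, (if Adjacent E F then G E (some F) else 0) =
        (if Adjacent E F ∧ lab.left E F then G E (some F) else 0) +
          (if Adjacent E F ∧ lab.left F E then G E (some F) else 0) := by
      intro E F
      by_cases h : Adjacent E F
      · rcases lab.left_xor E F h with ⟨h3, h4⟩ | ⟨h3, h4⟩ <;> simp [h, h3, h4]
      · simp [h]
    simp only [h2, Finset.sum_add_distrib]
    rw [intFaces, Finset.sum_filter, Finset.sum_filter, Fintype.sum_prod_type,
      Fintype.sum_prod_type]
    congr 1
    rw [Finset.sum_comm]
    refine Finset.sum_congr rfl fun E _ => Finset.sum_congr rfl fun F _ => ?_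
    have : (Adjacent F E ∧ lab.left F E) ↔ (Adjacent E F ∧ lab.left F E) :=
      ⟨fun h => ⟨h.1.symm, h.2⟩, fun h => ⟨h.1.symm, h.2⟩⟩
    simp only [this]
  have h2 : ∑ E ∈ bdryCells M, G E none = ∑ E, if HasBdryFace E then G E none else 0 := by
    rw [bdryCells, Finset.sum_filter]
  rw [h1, h2, ← Finset.sum_add_distrib]
  exact Finset.sum_congr rfl fun E _ => by rw [sum_face, add_comm]

theorem sum_facePairs (lab : M.Labelling) (E : M.Cell) [DecidableEq (Face E)]
    (g : Face E → Face E → ℝ) :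
    ∑ P ∈ facePairs lab E, (g P.1 P.2 + g P.2 P.1) =
      ∑ j, ∑ i ∈ Finset.univ.erase j, g i j := by
  classical
  have h1 : ∀ j, ∑ i ∈ Finset.univ.erase j, g i j =
      ∑ i, ((if lab.num E i < lab.num E j then g i j else 0) +
        if lab.num E j < lab.num E i then g i j else 0) := by
    intro j
    rw [← Finset.filter_ne', Finset.sum_filter]
    refine Finset.sum_congr rfl fun i _ => ?_
    by_cases hij : i = j
    · subst hij
      simp
    · have : lab.num E i ≠ lab.num E j := fun h => hij ((lab.num E).injective h)
      rcases lt_or_gt_of_ne this with h | h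
      · simp [hij, h, h.not_gt]
      · simp [hij, h, h.not_gt]
  simp only [h1, Finset.sum_add_distrib]
  rw [facePairs, Finset.sum_filter, Finset.sum_filter, Fintype.sum_prod_type,
    Fintype.sum_prod_type]
  congr 1
  rw [Finset.sum_comm]

theorem ne_of_mem_facePairs {lab : M.Labelling} {E : M.Cell} {P : Face E × Face E}
    (h : P ∈ facePairs lab E) : P.1 ≠ P.2 := by
  intro h'
  simp only [facePairs, Finset.mem_filter, h', lt_self_iff_false, and_false] at h

end Combinatorics

/-- The central base form preserves the energy. -/
theorem aForm_self (hM : M.IsRegular) (lab : M.Labelling) (c : ℝ) (u : M.DGSpace r) :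
    aForm lab c u u = 0 := by
  let G : M.Cell → Option M.Cell → ℝ := fun E o =>
    lineIntegral (match o with | none => bdryFace E | some F => intFace E F) fun x =>
      (normalFlux c (outerNormal (Cell.set E) x)).mulVec ((u E).val x) ⬝ᵥ (u E).val x
  have hG : ∀ E (i : Face E), surfaceForm c E i (u E) (u E) (u E) = G E i.1 := by
    rintro E ⟨_ | F, hi⟩ <;> exact surfaceForm_self c E _ (u E)
  have h1 : ∑ E, volForm c E (u E) (u E) = 1 / 2 * ∑ E, ∑ i : Face E, G E i.1 := by
    rw [Finset.mul_sum]
    exact Finset.sum_congr rfl fun E _ => by simp only [volForm_self hM, hG]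
  have h2 : ∑ P ∈ intFaces lab, centralInt c P.1 P.2 u u =
      1 / 2 * ∑ P ∈ intFaces lab, (G P.1 (some P.2) + G P.2 (some P.1)) := by
    rw [Finset.mul_sum]
    refine Finset.sum_congr rfl fun P hP => ?_
    have hadj : Adjacent P.1 P.2 := by
      simp only [intFaces, Finset.mem_filter] at hP
      exact hP.2.1
    have h3 := surfaceForm_swap hM c hadj (u P.2)
    have h4 := hG P.2 ⟨some P.1, hadj.symm⟩
    have h5 := hG P.1 ⟨some P.2, hadj⟩
    simp only at h4 h5
    rw [centralInt_self hM c hadj, ← h5, ← h4, h3]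
    ring
  have h3 : ∑ E ∈ bdryCells M, centralBdry c E u u = 1 / 2 * ∑ E ∈ bdryCells M, G E none := by
    rw [Finset.mul_sum]
    refine Finset.sum_congr rfl fun E hE => ?_
    have hb : HasBdryFace E := by
      simp only [bdryCells, Finset.mem_filter] at hE
      exact hE.2
    rw [centralBdry_self hM c hb, hG]
  rw [aForm, h1, h2, h3, sum_cell_sum_face lab]
  ring

section Propagation

variable {c : ℝ} {E : M.Cell} {n q : Pt} {p : PropagationForms r c E}

theorem PropagationForms.surf_mirror (he : p.EnergyPreserving) (hr : p.Reflecting n q)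
    (hn : ‖n‖ = 1) {i j : Face E} (hi : i.1 = none) (hij : j ≠ i) (u : Poly3 r) :
    p.surf j i u (mirrorPoly n q u) (mirrorPoly n q u) =
      1 / 2 * p.surf j i (mirrorPoly n q u) (mirrorPoly n q u) (mirrorPoly n q u) := by
  have h1 := he.2 j i hij u (mirrorPoly n q u)
  have h2 := hr i hi j hij u u u
  have h3 := hr i hi j hij (mirrorPoly n q u) u (mirrorPoly n q u)
  rw [mirrorPoly_mirrorPoly hn] at h3
  rw [p.surf_symm j i hij (mirrorPoly n q u) u] at h2
  rw [map_sub, h2] at h1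
  linarith

/-- The contribution of a pair of faces, before the test functions of the neighbours enter. -/
theorem PropagationForms.pair_identity (he : p.EnergyPreserving) {i j : Face E} (hij : i ≠ j)
    (a b e : Poly3 r) :
    p.surf i j a b e + p.surf j i a b e +
      (-(p.vol a b e - pairWeight E * volForm c E e e + p.volStar a b e) +
        1 / 2 * (p.vol a b a - pairWeight E * volForm c E a a + p.volStar a b a) +
        1 / 2 * (p.vol a b b - pairWeight E * volForm c E b b + p.volStar a b b)) =
      1 / 2 * p.surf i j e e e + 1 / 2 * p.surf j i e e e + p.surf i j a b b + p.surf j i a b a -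
        1 / 2 * p.surf i j b b b - 1 / 2 * p.surf j i a a a := by
  have h1 := he.2 i j hij a b
  have h2 := he.2 j i hij.symm b a
  rw [p.surf_symm j i hij.symm b a] at h2
  rw [map_sub] at h1 h2
  linarith [he.1 i j hij e, he.1 i j hij a, he.1 i j hij b, p.balance i j hij a b e,
    p.balance i j hij a b a, p.balance i j hij a b b]

/-- The outgoing energy of the neighbour at the face `j`, propagated from the face `i`. -/
noncomputable def PropagationForms.neighbourEnergy (p : PropagationForms r c E)
    (u : M.DGSpace r) (i j : Face E) : ℝ :=
  match j.1 with
  | none => 0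
  | some F => p.surf i j (u F) (u F) (u F)

theorem J0pair_add_J1pair_self (he : p.EnergyPreserving) (hr : p.Reflecting n q)
    (hn : HasBdryFace E → ‖n‖ = 1) {i j : Face E} (hij : i ≠ j) (u : M.DGSpace r) :
    J0pair n q p i j u u + J1pair n q p i j u u =
      (1 / 2 * p.surf i j (u E) (u E) (u E) - 1 / 2 * p.neighbourEnergy u i j) +
        (1 / 2 * p.surf j i (u E) (u E) (u E) - 1 / 2 * p.neighbourEnergy u j i) := by
  have key := p.pair_identity he hij (extPair n q E i j u) (extPair n q E j i u) (u E)
  simp only [J0pair, J1pair, J1term, map_sub]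
  rcases i with ⟨_ | F, hi⟩ <;> rcases j with ⟨_ | G, hj⟩
  · exact absurd rfl hij
  · simp only [extPair, extTest, PropagationForms.neighbourEnergy, map_zero] at key ⊢
    have hm := p.surf_mirror he hr (hn hi) (i := ⟨none, hi⟩) rfl hij.symm (u G)
    rw [p.surf_symm _ _ hij.symm] at hm
    linarith
  · simp only [extPair, extTest, PropagationForms.neighbourEnergy, map_zero] at key ⊢
    have hm := p.surf_mirror he hr (hn hj) (i := ⟨none, hj⟩) rfl hij (u F)
    linarith
  · simp only [extPair, extTest, PropagationForms.neighbourEnergy] at key ⊢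
    linarith

theorem sum_facePairs_J_self (hM : M.IsRegular) (lab : M.Labelling) (he : p.EnergyPreserving)
    (hr : p.Reflecting n q) (hn : HasBdryFace E → ‖n‖ = 1) (u : M.DGSpace r) :
    ∑ P ∈ facePairs lab E, (J0pair n q p P.1 P.2 u u + J1pair n q p P.1 P.2 u u) =
      ∑ i : Face E, faceCentral lab c E i u u := by
  classical
  rw [Finset.sum_congr rfl fun P hP =>
    J0pair_add_J1pair_self he hr hn (ne_of_mem_facePairs hP) u,
    sum_facePairs lab E fun i j =>
      1 / 2 * p.surf i j (u E) (u E) (u E) - 1 / 2 * p.neighbourEnergy u i j]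
  refine Finset.sum_congr rfl fun j _ => ?_
  rw [faceCentral_self hM, Finset.sum_sub_distrib, ← Finset.mul_sum, ← Finset.mul_sum]
  have hcons : ∀ w : Poly3 r, ∑ i ∈ Finset.univ.erase j, p.surf i j w w w =
      surfaceForm c E j w w w := fun w => by
    convert p.consistency j w w w
  rw [hcons]
  congr 2
  rcases j with ⟨_ | F, hj⟩
  · simp [PropagationForms.neighbourEnergy, neighbourFlux]
  · exact hcons (u F)

end Propagation

/-- The central stabilization preserves the energy. -/
theorem DoDScheme.Ja_self (hM : M.IsRegular) (D : M.DoDScheme r)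
    (he : ∀ E : M.SmallCell D.α, (D.forms E).EnergyPreserving)
    (hr : ∀ E : M.SmallCell D.α, (D.forms E).Reflecting (D.wallNormal E) (D.wallPoint E))
    (u : M.DGSpace r) : D.Ja u u = 0 := by
  rw [DoDScheme.Ja, ← Finset.sum_add_distrib]
  refine Finset.sum_eq_zero fun E _ => ?_
  have h := sum_facePairs_J_self hM D.lab (he E) (hr E) (fun hb => (D.flat E hb).1) u
  rw [Finset.sum_add_distrib] at h
  rw [J0, J1, ← h]
  ring

end CutCellMesh

theorem normalState_dotProduct (n : Pt) (v : Fin 3 → ℝ) :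
    normalState n ⬝ᵥ v = v 1 * n 0 + v 2 * n 1 := by
  simp [normalState, dotProduct, Fin.sum_univ_three]
  ring

theorem sub_mirrorState (n : Pt) (v : Fin 3 → ℝ) :
    v - mirrorState n v = (2 * (v 1 * n 0 + v 2 * n 1)) • normalState n := by
  funext i
  fin_cases i <;> simp [mirrorState, normalState]

/-- The dissipation at the wall is nonnegative. -/
theorem wall_dissipation_nonneg {S : Matrix (Fin 3) (Fin 3) ℝ} {n : Pt} (hn : ‖n‖ = 1)
    (hS : ∀ v : Fin 3 → ℝ, 0 ≤ S.mulVec v ⬝ᵥ v)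
    (hw : ∃ μ : ℝ, S.mulVec (normalState n) = μ • normalState n) (v : Fin 3 → ℝ) :
    0 ≤ S.mulVec (v - mirrorState n v) ⬝ᵥ v := by
  obtain ⟨μ, hμ⟩ := hw
  have h1 := hS (normalState n)
  have h2 : normalState n ⬝ᵥ normalState n = 1 := by
    rw [normalState_dotProduct]
    simpa [normalState] using sq_add_sq_eq_one_of_norm hn
  rw [hμ, smul_dotProduct, h2, smul_eq_mul, mul_one] at h1
  rw [sub_mirrorState, Matrix.mulVec_smul, hμ, smul_dotProduct, smul_dotProduct,
    normalState_dotProduct, smul_eq_mul, smul_eq_mul]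
  have := mul_nonneg h1 (mul_self_nonneg (v 1 * n 0 + v 2 * n 1))
  linarith

namespace CutCellMesh

variable {M : CutCellMesh} {r : ℕ}

section Dissipation

variable {S : Pt → Matrix (Fin 3) (Fin 3) ℝ}

theorem lineIntegral_nonneg {γ : Set Pt} (hγ : MeasurableSet γ) {f : Pt → ℝ}
    (h : ∀ᵐ x ∂(Measure.hausdorffMeasure 1 : Measure Pt), x ∈ γ → 0 ≤ f x) :
    0 ≤ lineIntegral γ f :=
  setIntegral_nonneg_of_ae_restrict ((ae_restrict_iff' hγ).2 h)

theorem lineIntegral_eq_zero {γ : Set Pt} (hγ : MeasurableSet γ) {f : Pt → ℝ}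
    (h : ∀ᵐ x ∂(Measure.hausdorffMeasure 1 : Measure Pt), x ∈ γ → f x = 0) :
    lineIntegral γ f = 0 :=
  integral_eq_zero_of_ae ((ae_restrict_iff' hγ).2 h)

theorem IsRegularPoint.norm_faceNormal {x : Pt} (hx : M.IsRegularPoint x) (lab : M.Labelling)
    {E : M.Cell} {i : Face E} (h : x ∈ faceSet E i) : ‖faceNormal lab E i x‖ = 1 := by
  rcases i with ⟨_ | F, hi⟩
  · exact hx.norm_outerNormal (bdryFace_subset_frontier E h)
  · simp only [faceNormal]
    split_ifs
    · exact hx.norm_outerNormal (intFace_subset_frontier hi.1 h)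
    · refine hx.norm_outerNormal (intFace_subset_frontier hi.1.symm ?_)
      rw [intFace_comm]
      exact h

theorem dissipInt_self_nonneg (hM : M.IsRegular)
    (hS : ∀ n : Pt, ‖n‖ = 1 → ∀ v : Fin 3 → ℝ, 0 ≤ (S n).mulVec v ⬝ᵥ v) {L R : M.Cell}
    (h : Adjacent L R) (u : M.DGSpace r) : 0 ≤ dissipInt S L R u u := by
  refine lineIntegral_nonneg (measurableSet_faceSet L ⟨some R, h⟩) ?_
  filter_upwards [hM.ae_isRegularPoint] with x hx hxf
  exact hS _ (hx.norm_outerNormal (intFace_subset_frontier h.1 hxf)) _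

theorem dissipBdry_self_nonneg (hM : M.IsRegular)
    (hS : ∀ n : Pt, ‖n‖ = 1 → ∀ v : Fin 3 → ℝ, 0 ≤ (S n).mulVec v ⬝ᵥ v)
    (hw : ∀ n : Pt, ‖n‖ = 1 → ∃ μ : ℝ, (S n).mulVec (normalState n) = μ • normalState n)
    {E : M.Cell} (h : HasBdryFace E) (u : M.DGSpace r) : 0 ≤ dissipBdry S E u u := by
  refine lineIntegral_nonneg (measurableSet_faceSet E ⟨none, h⟩) ?_
  filter_upwards [hM.ae_isRegularPoint] with x hx hxf
  have hn := hx.norm_outerNormal (bdryFace_subset_frontier E hxf)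
  exact wall_dissipation_nonneg hn (hS _ hn) (hw _ hn) _

theorem Jspair_self_nonneg (hM : M.IsRegular)
    (hS : ∀ n : Pt, ‖n‖ = 1 → ∀ v : Fin 3 → ℝ, 0 ≤ (S n).mulVec v ⬝ᵥ v) (lab : M.Labelling)
    (n q : Pt) (E : M.Cell) (i j : Face E) (u : M.DGSpace r) :
    0 ≤ Jspair lab S n q E i j u u := by
  refine add_nonneg ?_ ?_ <;>
  · refine mul_nonneg (by norm_num) (Finset.sum_nonneg fun γ _ => ?_)
    refine lineIntegral_nonneg (measurableSet_faceSet E γ) ?_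
    filter_upwards [hM.ae_isRegularPoint] with x hx hxf
    exact hS _ (hx.norm_faceNormal lab hxf) _

open scoped Classical in
/-- The dissipation at a face, depending on the label of the face only. -/
theorem faceDissip_eq (lab : M.Labelling) (E : M.Cell) (i : Face E) (u w : M.DGSpace r) :
    faceDissip lab S E i u w = (match i.1 with
      | none => dissipBdry S E u w
      | some F => if lab.left E F then dissipInt S E F u w else dissipInt S F E u w) := rfl

/-- The weighted sum of the dissipation terms of the elements, sorted by faces. -/
theorem sum_mul_sum_faceDissip (lab : M.Labelling) (θ : M.Cell → ℝ) (u : M.DGSpace r) :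
    ∑ E, θ E * ∑ i : Face E, faceDissip lab S E i u u =
      ∑ P ∈ intFaces lab, (θ P.1 + θ P.2) * dissipInt S P.1 P.2 u u +
        ∑ E ∈ bdryCells M, θ E * dissipBdry S E u u := by
  classical
  have h := sum_cell_sum_face lab fun E o => θ E * (match o with
      | none => dissipBdry S E u u
      | some F => if lab.left E F then dissipInt S E F u u else dissipInt S F E u u)
  simp only [Finset.mul_sum, faceDissip_eq]
  refine Eq.trans ?_ (h.trans ?_)
  · refine Finset.sum_congr rfl fun E _ => Finset.sum_congr rfl fun i _ => ?_
    rcases i with ⟨_ | F, hi⟩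
    · rfl
    · rfl
  · congr 1
    refine Finset.sum_congr rfl fun P hP => ?_
    simp only [intFaces, Finset.mem_filter] at hP
    have h2 : ¬ lab.left P.2 P.1 := by
      rcases lab.left_xor P.1 P.2 hP.2.1 with h3 | h3
      · exact h3.2
      · exact absurd hP.2.2 h3.2
    simp only [hP.2.2, h2, if_true, if_false]
    ring

open scoped Classical in
/-- The stabilization parameter, extended by zero to the elements that are not stabilized. -/
noncomputable def stabWeight (D : M.DoDScheme r) (E : M.Cell) : ℝ :=
  if M.IsSmall D.α E then stabParam r D.c D.Δt E else 0

theorem sum_smallCell (D : M.DoDScheme r) (g : M.Cell → ℝ) :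
    ∑ E : M.SmallCell D.α, stabParam r D.c D.Δt E.1 * g E.1 = ∑ E, stabWeight D E * g E := by
  classical
  rw [← Finset.sum_subtype (Finset.univ.filter (M.IsSmall D.α)) (fun o => by simp)
    fun E => stabParam r D.c D.Δt E * g E, Finset.sum_filter]
  refine Finset.sum_congr rfl fun E _ => ?_
  simp only [stabWeight]
  split_ifs <;> simp

theorem DoDScheme.JsForm_eq (D : M.DoDScheme r) (u : M.DGSpace r) :
    D.JsForm u u = (∑ E : M.SmallCell D.α, stabParam r D.c D.Δt E.1 *
        ∑ P ∈ facePairs D.lab E.1,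
          Jspair D.lab D.S (D.wallNormal E) (D.wallPoint E) E.1 P.1 P.2 u u) -
      ∑ E, stabWeight D E * ∑ i : Face E, faceDissip D.lab D.S E i u u := by
  rw [← sum_smallCell D fun E => ∑ i : Face E, faceDissip D.lab D.S E i u u,
    ← Finset.sum_sub_distrib]
  rfl

/-- The stabilized scheme is dissipative if the stabilization parameters lie in `[0, 1]`. -/
theorem DoDScheme.dissipation_nonneg (hM : M.IsRegular) (D : M.DoDScheme r)
    (h_neighbours : ∀ E F : M.Cell, M.IsSmall D.α E → Adjacent E F → ¬ M.IsSmall D.α F)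
    (hS : ∀ n : Pt, ‖n‖ = 1 → ∀ v : Fin 3 → ℝ, 0 ≤ (D.S n).mulVec v ⬝ᵥ v)
    (hw : ∀ n : Pt, ‖n‖ = 1 → ∃ μ : ℝ, (D.S n).mulVec (normalState n) = μ • normalState n)
    (hη : ∀ E : M.SmallCell D.α, stabParam r D.c D.Δt E.1 ∈ Icc (0 : ℝ) 1) (u : M.DGSpace r) :
    0 ≤ sForm D.lab D.S u u + D.JsForm u u := by
  have hθ : ∀ E, stabWeight D E ≤ 1 := fun E => by
    simp only [stabWeight]
    split_ifs with h
    · exact (hη ⟨E, h⟩).2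
    · exact zero_le_one
  have hθ2 : ∀ E F : M.Cell, Adjacent E F → stabWeight D E + stabWeight D F ≤ 1 := by
    intro E F hEF
    by_cases hE : M.IsSmall D.α E
    · have hF : stabWeight D F = 0 := if_neg (h_neighbours E F hE hEF)
      rw [hF, add_zero]
      exact hθ E
    · have hE' : stabWeight D E = 0 := if_neg hE
      rw [hE', zero_add]
      exact hθ F
  rw [D.JsForm_eq, sum_mul_sum_faceDissip, sForm]
  have h1 : 0 ≤ ∑ E : M.SmallCell D.α, stabParam r D.c D.Δt E.1 *
      ∑ P ∈ facePairs D.lab E.1,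
        Jspair D.lab D.S (D.wallNormal E) (D.wallPoint E) E.1 P.1 P.2 u u :=
    Finset.sum_nonneg fun E _ => mul_nonneg (hη E).1 (Finset.sum_nonneg fun P _ =>
      Jspair_self_nonneg hM hS _ _ _ _ _ _ _)
  have h2 : ∑ P ∈ intFaces D.lab, (stabWeight D P.1 + stabWeight D P.2) *
      dissipInt D.S P.1 P.2 u u ≤ ∑ P ∈ intFaces D.lab, dissipInt D.S P.1 P.2 u u := by
    refine Finset.sum_le_sum fun P hP => ?_
    simp only [intFaces, Finset.mem_filter] at hP
    exact mul_le_of_le_one_left (dissipInt_self_nonneg hM hS hP.2.1 u) (hθ2 _ _ hP.2.1)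
  have h3 : ∑ E ∈ bdryCells M, stabWeight D E * dissipBdry D.S E u u ≤
      ∑ E ∈ bdryCells M, dissipBdry D.S E u u := by
    refine Finset.sum_le_sum fun E hE => ?_
    simp only [bdryCells, Finset.mem_filter] at hE
    exact mul_le_of_le_one_left (dissipBdry_self_nonneg hM hS hw hE.2 u) (hθ E)
  linarith

/-- Without dissipation matrices there is no dissipation. -/
theorem DoDScheme.dissipation_eq_zero (hM : M.IsRegular) (D : M.DoDScheme r)
    (hS : ∀ n : Pt, ‖n‖ = 1 → D.S n = 0) (u : M.DGSpace r) :
    sForm D.lab D.S u u + D.JsForm u u = 0 := by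
  have h1 : ∀ L R : M.Cell, Adjacent L R → dissipInt D.S L R u u = 0 := fun L R h => by
    refine lineIntegral_eq_zero (measurableSet_faceSet L ⟨some R, h⟩) ?_
    filter_upwards [hM.ae_isRegularPoint] with x hx hxf
    rw [hS _ (hx.norm_outerNormal (intFace_subset_frontier h.1 hxf)), Matrix.zero_mulVec,
      zero_dotProduct]
  have h2 : ∀ E : M.Cell, HasBdryFace E → dissipBdry D.S E u u = 0 := fun E h => by
    refine lineIntegral_eq_zero (measurableSet_faceSet E ⟨none, h⟩) ?_
    filter_upwards [hM.ae_isRegularPoint] with x hx hxf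
    rw [hS _ (hx.norm_outerNormal (bdryFace_subset_frontier E hxf)), Matrix.zero_mulVec,
      zero_dotProduct]
  have h3 : ∀ (E : M.SmallCell D.α) (i j : Face E.1),
      Jspair D.lab D.S (D.wallNormal E) (D.wallPoint E) E.1 i j u u = 0 := fun E i j => by
    have h4 : ∀ (γ : Face E.1) (f g : Pt → Fin 3 → ℝ), lineIntegral (faceSet E.1 γ) (fun x =>
        (D.S (faceNormal D.lab E.1 γ x)).mulVec (f x) ⬝ᵥ (g x)) = 0 := fun γ f g => by
      refine lineIntegral_eq_zero (measurableSet_faceSet E.1 γ) ?_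
      filter_upwards [hM.ae_isRegularPoint] with x hx hxf
      rw [hS _ (hx.norm_faceNormal D.lab hxf), Matrix.zero_mulVec, zero_dotProduct]
    rw [Jspair, Finset.sum_eq_zero fun γ _ => h4 γ _ _, Finset.sum_eq_zero fun γ _ => h4 γ _ _]
    ring
  have h4 : ∀ P ∈ intFaces D.lab, dissipInt D.S P.1 P.2 u u = 0 := fun P hP => by
    simp only [intFaces, Finset.mem_filter] at hP
    exact h1 _ _ hP.2.1
  have h5 : ∀ E ∈ bdryCells M, dissipBdry D.S E u u = 0 := fun E hE => by
    simp only [bdryCells, Finset.mem_filter] at hE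
    exact h2 _ hE.2
  rw [D.JsForm_eq, sum_mul_sum_faceDissip, sForm, Finset.sum_eq_zero h4, Finset.sum_eq_zero h5,
    Finset.sum_eq_zero (s := Finset.univ) fun E _ => by
      rw [Finset.sum_eq_zero fun P _ => h3 E _ _, mul_zero],
    Finset.sum_eq_zero fun P hP => by rw [h4 P hP, mul_zero],
    Finset.sum_eq_zero fun E hE => by rw [h5 E hE, mul_zero]]
  ring

end Dissipation

section Energy

theorem inner_toFun_eq_sum_indicator (u w : M.DGSpace r) (x : Pt) :
    ⟪DGSpace.toFun u x, DGSpace.toFun w x⟫ =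
      ∑ E : M.Cell, (Cell.set E).indicator (fun x => (u E).val x ⬝ᵥ (w E).val x) x := by
  have hval : ∀ (v : M.DGSpace r) (E : M.Cell), x ∈ Cell.set E →
      DGSpace.toFun v x = WithLp.toLp 2 ((v E).val x) := by
    intro v E hE
    rw [DGSpace.toFun, Finset.sum_eq_single E, indicator_of_mem hE]
    · exact fun F _ hF => indicator_of_notMem
        (fun hxF => (Cell.disjoint_set hF).le_bot ⟨hxF, hE⟩) _
    · exact fun h => absurd (Finset.mem_univ E) h
  by_cases h : ∃ E : M.Cell, x ∈ Cell.set E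
  · obtain ⟨E, hE⟩ := h
    rw [hval u E hE, hval w E hE, Finset.sum_eq_single E, indicator_of_mem hE]
    · simp [PiLp.inner_apply, dotProduct, mul_comm]
    · exact fun F _ hF => indicator_of_notMem
        (fun hxF => (Cell.disjoint_set hF).le_bot ⟨hxF, hE⟩) _
    · exact fun h => absurd (Finset.mem_univ E) h
  · push Not at h
    have h0 : DGSpace.toFun u x = 0 := by
      rw [DGSpace.toFun, Finset.sum_eq_zero fun E _ => indicator_of_notMem (h E) _]
      rfl
    rw [h0, inner_zero_left, Finset.sum_eq_zero fun E _ => indicator_of_notMem (h E) _]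

theorem continuous_val_dotProduct (u w : Poly3 r) : Continuous fun x => u.val x ⬝ᵥ w.val x :=
  (Poly3.continuous_val u).dotProduct (Poly3.continuous_val w)

theorem integrable_indicator_val_dotProduct (E : M.Cell) (u w : Poly3 r) :
    Integrable ((Cell.set E).indicator fun x => u.val x ⬝ᵥ w.val x) :=
  (integrableOn_of_isBounded (Cell.isBounded_set E)
    (continuous_val_dotProduct u w)).integrable_indicator (Cell.isOpen_set E).measurableSet

theorem l2Inner_eq_sum (u w : M.DGSpace r) :
    l2Inner u w = ∑ E : M.Cell, ∫ x in Cell.set E, (u E).val x ⬝ᵥ (w E).val x := by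
  simp only [l2Inner, inner_toFun_eq_sum_indicator]
  rw [integral_finsetSum _ fun E _ => (integrable_indicator_val_dotProduct E _ _).integrableOn]
  refine Finset.sum_congr rfl fun E _ => ?_
  rw [setIntegral_indicator (Cell.isOpen_set E).measurableSet,
    inter_eq_right.2 (Cell.set_subset_domain E)]

theorem l2Inner_comm (u w : M.DGSpace r) : l2Inner u w = l2Inner w u := by
  simp only [l2Inner, real_inner_comm]

theorem measurable_toFun (u : M.DGSpace r) : Measurable (DGSpace.toFun u) := by
  refine (PiLp.continuous_toLp 2 _).measurable.comp ?_
  exact Finset.measurable_sum _ fun E _ =>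
    (Poly3.continuous_val (u E)).measurable.indicator (Cell.isOpen_set E).measurableSet

theorem l2Norm_sq (u : M.DGSpace r) : l2Norm u ^ 2 = l2Inner u u := by
  have hsq : ∀ x, ‖DGSpace.toFun u x‖ ^ 2 = ⟪DGSpace.toFun u x, DGSpace.toFun u x⟫ := fun x =>
    (real_inner_self_eq_norm_sq _).symm
  have hint : Integrable (fun x => ‖DGSpace.toFun u x‖ ^ 2) (volume.restrict M.domain) := by
    simp only [hsq, inner_toFun_eq_sum_indicator]
    exact (integrable_finsetSum _ fun E _ =>
      integrable_indicator_val_dotProduct E _ _).integrableOn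
  have hmem : MemLp (DGSpace.toFun u) 2 (volume.restrict M.domain) :=
    (memLp_two_iff_integrable_sq_norm (measurable_toFun u).aestronglyMeasurable).2 hint
  rw [l2Norm, hmem.eLpNorm_eq_integral_rpow_norm two_ne_zero ENNReal.ofNat_ne_top]
  simp only [ENNReal.toReal_ofNat, Real.rpow_two]
  have h0 : 0 ≤ ∫ x in M.domain, ‖DGSpace.toFun u x‖ ^ 2 := integral_nonneg fun x => by positivity
  rw [ENNReal.toReal_ofReal (by positivity), ← Real.rpow_natCast, ← Real.rpow_mul h0]
  simp only [Nat.cast_ofNat, inv_mul_cancel₀ (two_ne_zero' ℝ), Real.rpow_one, hsq]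
  rfl

/-- The exponents of the monomials that may occur in polynomials of degree at most `r`. -/
noncomputable def exponents (r : ℕ) : Finset (Fin 2 →₀ ℕ) :=
  Finset.Icc 0 (Finsupp.equivFunOnFinite.symm fun _ => r)

theorem val_eq_sum_exponents (u : Poly3 r) (x : Pt) (i : Fin 3) :
    u.val x i = ∑ m ∈ exponents r, MvPolynomial.coeff m (u i : MvPolynomial (Fin 2) ℝ) *
      ∏ k, x k ^ m k := by
  rw [Poly3.val, MvPolynomial.eval_eq']
  refine Finset.sum_subset (fun m hm => ?_) fun m _ hm => ?_
  · rw [exponents, Finset.mem_Icc]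
    refine ⟨zero_le, fun k => ?_⟩
    have h1 := (MvPolynomial.mem_restrictTotalDegree _ _ _).1 (u i).2
    have h2 := MvPolynomial.le_totalDegree hm
    have h3 : m k ≤ m.sum fun _ e => e := by
      by_cases hk : k ∈ m.support
      · exact Finset.single_le_sum (f := fun k => m k) (fun _ _ => Nat.zero_le _) hk
      · rw [Finsupp.notMem_support_iff.1 hk]
        exact Nat.zero_le _
    exact (h3.trans h2).trans h1
  · rw [MvPolynomial.notMem_support_iff.1 hm, zero_mul]

/-- The `L²` inner product in terms of the coefficients. -/
theorem l2Inner_eq_sum_coeff (u w : M.DGSpace r) :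
    l2Inner u w = ∑ E : M.Cell, ∑ i : Fin 3, ∑ m ∈ exponents r, ∑ m' ∈ exponents r,
      (MvPolynomial.coeff m (u E i : MvPolynomial (Fin 2) ℝ) *
        MvPolynomial.coeff m' (w E i : MvPolynomial (Fin 2) ℝ)) *
          ∫ x in Cell.set E, (∏ k, x k ^ m k) * ∏ k, x k ^ m' k := by
  rw [l2Inner_eq_sum]
  refine Finset.sum_congr rfl fun E _ => ?_
  have hmon : ∀ m m' : Fin 2 →₀ ℕ,
      IntegrableOn (fun x : Pt => (∏ k, x k ^ m k) * ∏ k, x k ^ m' k) (Cell.set E) :=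
    fun m m' => integrableOn_of_isBounded (Cell.isBounded_set E) (by fun_prop)
  have h1 : ∀ x : Pt, (u E).val x ⬝ᵥ (w E).val x =
      ∑ i : Fin 3, ∑ m ∈ exponents r, ∑ m' ∈ exponents r,
        (MvPolynomial.coeff m (u E i : MvPolynomial (Fin 2) ℝ) *
          MvPolynomial.coeff m' (w E i : MvPolynomial (Fin 2) ℝ)) *
            ((∏ k, x k ^ m k) * ∏ k, x k ^ m' k) := by
    intro x
    rw [dotProduct]
    refine Finset.sum_congr rfl fun i _ => ?_
    rw [val_eq_sum_exponents, val_eq_sum_exponents, Finset.sum_mul_sum]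
    exact Finset.sum_congr rfl fun m _ => Finset.sum_congr rfl fun m' _ => by ring
  simp only [h1]
  rw [integral_finsetSum _ fun i _ => integrable_finsetSum _ fun m _ =>
    integrable_finsetSum _ fun m' _ => (hmon m m').const_mul _]
  refine Finset.sum_congr rfl fun i _ => ?_
  rw [integral_finsetSum _ fun m _ => integrable_finsetSum _ fun m' _ => (hmon m m').const_mul _]
  refine Finset.sum_congr rfl fun m _ => ?_
  rw [integral_finsetSum _ fun m' _ => (hmon m m').const_mul _]
  exact Finset.sum_congr rfl fun m' _ => integral_const_mul _ _

/-- The time derivative of the energy. -/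
theorem hasDerivWithinAt_energy {u : ℝ → M.DGSpace r} {du : M.DGSpace r} {s : Set ℝ} {t : ℝ}
    (h : ∀ (E : M.Cell) (i : Fin 3) (m : Fin 2 →₀ ℕ),
      HasDerivWithinAt (fun s => MvPolynomial.coeff m (u s E i : MvPolynomial (Fin 2) ℝ))
        (MvPolynomial.coeff m (du E i : MvPolynomial (Fin 2) ℝ)) s t) :
    HasDerivWithinAt (fun s => 1 / 2 * l2Norm (u s) ^ 2) (l2Inner du (u t)) s t := by
  have h1 : l2Inner du (u t) = 1 / 2 * (l2Inner du (u t) + l2Inner (u t) du) := by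
    rw [l2Inner_comm (u t) du]
    ring
  rw [h1]
  simp only [l2Norm_sq, l2Inner_eq_sum_coeff, ← Finset.sum_add_distrib, ← add_mul]
  refine HasDerivWithinAt.const_mul _ ?_
  refine HasDerivWithinAt.fun_sum fun E _ => HasDerivWithinAt.fun_sum fun i _ =>
    HasDerivWithinAt.fun_sum fun m _ => HasDerivWithinAt.fun_sum fun m' _ => ?_
  exact ((h E i m).mul (h E i m')).mul_const _

theorem le_of_hasDerivWithinAt_nonpos {f f' : ℝ → ℝ} {T : ℝ} (hT : 0 ≤ T)
    (hf : ∀ t ∈ Icc 0 T, HasDerivWithinAt f (f' t) (Icc 0 T) t) (h : ∀ t ∈ Icc 0 T, f' t ≤ 0) :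
    f T ≤ f 0 := by
  have hint : ∀ t ∈ interior (Icc 0 T), HasDerivAt f (f' t) t := fun t ht =>
    (hf t (interior_subset ht)).hasDerivAt (mem_interior_iff_mem_nhds.1 ht)
  refine antitoneOn_of_deriv_nonpos (convex_Icc 0 T) (fun t ht => (hf t ht).continuousWithinAt)
    (fun t ht => (hint t ht).differentiableAt.differentiableWithinAt) (fun t ht => ?_)
    (left_mem_Icc.2 hT) (right_mem_Icc.2 hT) hT
  rw [(hint t ht).deriv]
  exact h t (interior_subset ht)

end Energy

end CutCellMesh

end

theorem mainTheorem1 (M : CutCellMesh) (hM : M.IsRegular) (r : ℕ) (D : M.DoDScheme r)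
    -- small cells do not have small neighbours
    (h_neighbours : ∀ E F : M.Cell,
      M.IsSmall D.α E → CutCellMesh.Adjacent E F → ¬ M.IsSmall D.α F)
    -- the propagation forms are energy preserving and reflecting
    (h_energy : ∀ E : M.SmallCell D.α, (D.forms E).EnergyPreserving)
    (h_reflecting : ∀ E : M.SmallCell D.α,
      (D.forms E).Reflecting (D.wallNormal E) (D.wallPoint E))
    -- the dissipation matrices are positive semi-definite (symmetry is not required) and have the
    -- normal velocity as an eigenvector
    (h_psd : ∀ n : Pt, ‖n‖ = 1 → ∀ v : Fin 3 → ℝ, 0 ≤ (D.S n).mulVec v ⬝ᵥ v)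
    (h_wall : ∀ n : Pt, ‖n‖ = 1 → ∃ μ : ℝ, (D.S n).mulVec (normalState n) = μ • normalState n)
    (T : ℝ) (hT : 0 < T) (u : ℝ → M.DGSpace r) (hu : D.IsSolution T u) :
    -- the energy does not grow, if the stabilization parameters lie in `[0, 1]`
    ((∀ E : M.SmallCell D.α, CutCellMesh.stabParam r D.c D.Δt E.1 ∈ Set.Icc (0 : ℝ) 1) →
        1 / 2 * CutCellMesh.l2Norm (u T) ^ 2 ≤ 1 / 2 * CutCellMesh.l2Norm (u 0) ^ 2) ∧
      -- the energy is conserved, if there is no dissipation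
      ((∀ n : Pt, ‖n‖ = 1 → D.S n = 0) →
        1 / 2 * CutCellMesh.l2Norm (u T) ^ 2 = 1 / 2 * CutCellMesh.l2Norm (u 0) ^ 2) := by
  obtain ⟨du, hdu⟩ := hu
  have hder := fun t ht => CutCellMesh.hasDerivWithinAt_energy (hdu t ht).1
  have hrate : ∀ t ∈ Set.Icc 0 T, CutCellMesh.l2Inner (du t) (u t) =
      -(CutCellMesh.sForm D.lab D.S (u t) (u t) + D.JsForm (u t) (u t)) := by
    intro t ht
    have h := (hdu t ht).2 (u t)
    rw [CutCellMesh.aForm_self hM, D.Ja_self hM h_energy h_reflecting] at h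
    linarith
  refine ⟨fun hη => ?_, fun hS => ?_⟩
  · refine CutCellMesh.le_of_hasDerivWithinAt_nonpos hT.le hder fun t ht => ?_
    rw [hrate t ht, neg_nonpos]
    exact D.dissipation_nonneg hM h_neighbours h_psd h_wall hη (u t)
  · have h0 : ∀ t ∈ Set.Icc 0 T, CutCellMesh.l2Inner (du t) (u t) = 0 := fun t ht => by
      rw [hrate t ht, D.dissipation_eq_zero hM hS, neg_zero]
    refine le_antisymm ?_ (neg_le_neg_iff.1 ?_)
    · exact CutCellMesh.le_of_hasDerivWithinAt_nonpos hT.le hder fun t ht => (h0 t ht).le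
    · exact CutCellMesh.le_of_hasDerivWithinAt_nonpos hT.le (fun t ht => (hder t ht).neg)
        fun t ht => by rw [h0 t ht, neg_zero]
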